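/- All manifolds are smooth, Hausdorff and second countable. Let $n\ge 1$, and let $S_1,S_2$ be $n$-manifolds without boundary (not assumed compact or connected). Let $M$ be a connected $(n+1)$-manifold with boundary, equipped with a smooth Lorentzian metric $g$ of signature $(-,+,\dots,+)$ and a time orientation. A tangent vector $v$ is timelike if $g(v,v)<0$. A curve $\gamma\colon[a,b]\to M$ with $a<b$ is timelike if it is $C^1$ and $\dot\gamma(t)$ is timelike for every $t\in[a,b]$ (one-sided derivatives at the end points). It is closed if $\gamma(a)=\gamma(b)$. Suppose that: 1. $(M,g)$ is a weak Lorentzian pseudocobordism between $S_1$ and $S_2$. That is, $\partial M$ is the disjoint union $S_1\sqcup S_2$ (identified by smooth embeddings of $S_1$ and $S_2$ into $M$ with disjoint images whose union is $\partial M$), and there is a smooth timelike (hence nowhere vanishing) vector field $V$ on $M$ which is inward-directed at every point of $S_1$ and outward-directed at every point of $S_2$. 2. $M$ is causally compact. That is, for every $p\in M$ the closure of $I(p)=I^+(p)\cup I^-(p)$ is compact, where $I^+(p)$ (respectively $I^-(p)$) is the set of points $q$ for which there is a future-directed timelike curve from $p$ to $q$ (respectively from $q$ to $p$). 3. $M$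 satisfies the chronology condition. That is, $M$ contains no closed timelike curve. Then there is a diffeomorphism $\varphi\colon S_1\times[0,1]\to M$ such that for every $x\in S_1$ the submanifold $\varphi(\{x\}\times[0,1])$ is timelike, in the sense that the curve $t\mapsto\varphi(x,t)$, $t\in[0,1]$, is a timelike curve. In particular, $M$ is topologically trivial (diffeomorphic to $S_1\times[0,1]$), and $S_1$ and $S_2$ are diffeomorphic. -/

import Mathlib

open scoped Manifold ContDiff
open Set

namespace LorentzianCobordism

noncomputable section

section Geometry

variable (n : ℕ) (M : Type*) [TopologicalSpace M] [ChartedSpace (EuclideanHalfSpace (n + 1)) M]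
  [IsManifold (𝓡∂ (n + 1)) ∞ M]

/-- A smooth Lorentzian metric, of signature `(-, +, ..., +)`, on an `(n + 1)`-manifold `M`
with (possibly empty) boundary: a smooth field of symmetric bilinear forms on the tangent spaces,
each of which takes a negative value on some vector `u` and is positive definite on the orthogonal
complement of `u`. -/
structure LorentzianMetric where
  /-- The bilinear form on each tangent space. -/
  val : ∀ p : M, TangentSpace (𝓡∂ (n + 1)) p →L[ℝ] TangentSpace (𝓡∂ (n + 1)) p →L[ℝ] ℝ
  symm : ∀ (p : M) (v w : TangentSpace (𝓡∂ (n + 1)) p), val p v w = val p w v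
  signature : ∀ p : M, ∃ u : TangentSpace (𝓡∂ (n + 1)) p, val p u u < 0 ∧
    ∀ w : TangentSpace (𝓡∂ (n + 1)) p, val p u w = 0 → w ≠ 0 → 0 < val p w w
  contMDiff : ContMDiff (𝓡∂ (n + 1))
    ((𝓡∂ (n + 1)).prod 𝓘(ℝ, EuclideanSpace ℝ (Fin (n + 1)) →L[ℝ]
      EuclideanSpace ℝ (Fin (n + 1)) →L[ℝ] ℝ)) ∞
    (fun p : M => (Bundle.TotalSpace.mk' (EuclideanSpace ℝ (Fin (n + 1)) →L[ℝ]
      EuclideanSpace ℝ (Fin (n + 1)) →L[ℝ] ℝ) p (val p) :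
      Bundle.TotalSpace (EuclideanSpace ℝ (Fin (n + 1)) →L[ℝ]
        EuclideanSpace ℝ (Fin (n + 1)) →L[ℝ] ℝ)
        (fun p : M => TangentSpace (𝓡∂ (n + 1)) p →L[ℝ]
          TangentSpace (𝓡∂ (n + 1)) p →L[ℝ] ℝ)))

end Geometry

section Causality

variable {n : ℕ} {M : Type*} [TopologicalSpace M] [ChartedSpace (EuclideanHalfSpace (n + 1)) M]
  [IsManifold (𝓡∂ (n + 1)) ∞ M]

/-- A tangent vector `v` is timelike if `g(v, v) < 0`. -/
def LorentzianMetric.IsTimelike (g : LorentzianMetric n M) {p : M}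
    (v : TangentSpace (𝓡∂ (n + 1)) p) : Prop :=
  g.val p v v < 0

/-- A time orientation of `(M, g)`, given by a continuous timelike vector field: a timelike vector
is future-directed if it lies in the same half of the timelike cone as the field. -/
structure TimeOrientation (g : LorentzianMetric n M) where
  /-- The vector field singling out the future cones. -/
  field : ∀ p : M, TangentSpace (𝓡∂ (n + 1)) p
  continuous : Continuous (fun p => (⟨p, field p⟩ : TangentBundle (𝓡∂ (n + 1)) M))
  timelike : ∀ p, g.IsTimelike (field p)

/-- The velocity at the parameter `t` of a curve defined on `[a, b]`
(one-sided at the end points). -/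
def velocity (γ : ℝ → M) (a b t : ℝ) : TangentSpace (𝓡∂ (n + 1)) (γ t) :=
  mfderivWithin 𝓘(ℝ, ℝ) (𝓡∂ (n + 1)) γ (Icc a b) t 1

/-- The restriction of `γ` to the nondegenerate interval `[a, b]` is a continuously differentiable
timelike curve: all its velocity vectors are timelike. -/
structure LorentzianMetric.IsTimelikeCurve (g : LorentzianMetric n M) (γ : ℝ → M) (a b : ℝ) :
    Prop where
  lt : a < b
  contMDiffOn : ContMDiffOn 𝓘(ℝ, ℝ) (𝓡∂ (n + 1)) 1 γ (Icc a b)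
  timelike : ∀ t ∈ Icc a b, g.IsTimelike (velocity (n := n) γ a b t)

/-- The restriction of `γ` to `[a, b]` is a future-directed timelike curve. In signature
`(-, +, ..., +)`, two timelike vectors lie in the same half of the timelike cone
if and only if their product is negative. -/
structure TimeOrientation.IsFutureTimelikeCurve {g : LorentzianMetric n M} (T : TimeOrientation g)
    (γ : ℝ → M) (a b : ℝ) : Prop where
  isTimelikeCurve : g.IsTimelikeCurve γ a b
  future : ∀ t ∈ Icc a b, g.val (γ t) (T.field (γ t)) (velocity (n := n) γ a b t) < 0

/-- The chronological future `I⁺(p)`. -/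
def TimeOrientation.chronologicalFuture {g : LorentzianMetric n M} (T : TimeOrientation g)
    (p : M) : Set M :=
  {q | ∃ (γ : ℝ → M) (a b : ℝ), T.IsFutureTimelikeCurve γ a b ∧ γ a = p ∧ γ b = q}

/-- The chronological past `I⁻(p)`. -/
def TimeOrientation.chronologicalPast {g : LorentzianMetric n M} (T : TimeOrientation g)
    (p : M) : Set M :=
  {q | ∃ (γ : ℝ → M) (a b : ℝ), T.IsFutureTimelikeCurve γ a b ∧ γ a = q ∧ γ b = p}

/-- `(M, g)` is causally compact if the closure of `I(p) = I⁺(p) ∪ I⁻(p)` is compact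
for each point `p`. -/
def TimeOrientation.IsCausallyCompact {g : LorentzianMetric n M} (T : TimeOrientation g) : Prop :=
  ∀ p : M, IsCompact (closure (T.chronologicalFuture p ∪ T.chronologicalPast p))

/-- The chronology condition: there are no closed timelike curves. -/
def LorentzianMetric.IsChronological (g : LorentzianMetric n M) : Prop :=
  ¬ ∃ (γ : ℝ → M) (a b : ℝ), g.IsTimelikeCurve γ a b ∧ γ a = γ b

end Causality

section Cobordism

variable {n : ℕ} {M : Type*} [TopologicalSpace M] [ChartedSpace (EuclideanHalfSpace (n + 1)) M]
  [IsManifold (𝓡∂ (n + 1)) ∞ M]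

/-- A tangent vector `v` at a boundary point `p` of `M` is inward-directed: its component
transverse to the boundary `{x₀ = 0}` of the half-space `{0 ≤ x₀}`, in a boundary chart at `p`,
is positive. -/
def IsInward {p : M} (v : TangentSpace (𝓡∂ (n + 1)) p) : Prop :=
  0 < NormedSpace.fromTangentSpace (extChartAt (𝓡∂ (n + 1)) p p)
    (mfderiv (𝓡∂ (n + 1)) 𝓘(ℝ, EuclideanSpace ℝ (Fin (n + 1)))
      (extChartAt (𝓡∂ (n + 1)) p) p v) 0

/-- A tangent vector at a boundary point is outward-directed if its negative is
inward-directed. -/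
def IsOutward {p : M} (v : TangentSpace (𝓡∂ (n + 1)) p) : Prop :=
  IsInward (-v)

variable {S₁ S₂ : Type*} [TopologicalSpace S₁] [ChartedSpace (EuclideanSpace ℝ (Fin n)) S₁]
  [TopologicalSpace S₂] [ChartedSpace (EuclideanSpace ℝ (Fin n)) S₂]

/-- `(M, g)` is a weak Lorentzian pseudocobordism between `S₁` and `S₂`. The identification of
`∂M` with the disjoint union `S₁ ⊔ S₂` is given by smooth embeddings `ι₁`, `ι₂` with disjoint
images whose union is `∂M`. The vector field `V` vanishes nowhere, because it is timelike. -/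
structure IsWeakLorentzianPseudocobordism (g : LorentzianMetric n M) (ι₁ : S₁ → M) (ι₂ : S₂ → M) :
    Prop where
  isSmoothEmbedding₁ : Manifold.IsSmoothEmbedding (𝓡 n) (𝓡∂ (n + 1)) ∞ ι₁
  isSmoothEmbedding₂ : Manifold.IsSmoothEmbedding (𝓡 n) (𝓡∂ (n + 1)) ∞ ι₂
  disjoint_range : Disjoint (range ι₁) (range ι₂)
  range_union_range : range ι₁ ∪ range ι₂ = (𝓡∂ (n + 1)).boundary M
  exists_field : ∃ V : ∀ p : M, TangentSpace (𝓡∂ (n + 1)) p,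
    ContMDiff (𝓡∂ (n + 1)) (𝓡∂ (n + 1)).tangent ∞
      (fun p => (⟨p, V p⟩ : TangentBundle (𝓡∂ (n + 1)) M)) ∧
    (∀ p, g.IsTimelike (V p)) ∧
    (∀ x : S₁, IsInward (V (ι₁ x))) ∧
    (∀ x : S₂, IsOutward (V (ι₂ x)))

end Cobordism

end

end LorentzianCobordism

/-! The diffeomorphism follows the integral curves of the timelike field `V`. If each of them enters
through `S₁` and leaves through `S₂` after finite time, then the entry point and the elapsed
fraction of the total time are coordinates on `M` with values in `S₁ × [0,1]`. The lines `{x} ×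
[0,1]` are then integral curves with time rescaled by a positive constant, hence timelike.
`IsCrossingField` isolates what the causal hypotheses must supply for this.

The point is that no integral curve is trapped (`IsCrossingField.exists_exit`). Since `M` is
connected, `V` or `-V` is future-directed, so the integral curve through `p` stays in the compact
set `closure I(p) ∪ {p}`. A curve that never exits would have a cluster point `q` at arbitrarily
late times. Near a point of `S₁` every curve has entered only recently, and near a point of `S₂`
every curve exits soon, so `q` is interior. The curve then returns near `q` after a long time.
Because being timelike is an open condition, the last stretch of the curve can be bent inside a
small box so that it ends exactly where it began, which gives a closed timelike curve
(`FlowBox.exists_nhds_not_return`). Reversing time shows that every point was reached from `S₁`.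

Smoothness comes from flow boxes, which also exist at boundary points: there the field is extended
across the boundary by higher order reflections (`exists_contDiff_extension`), and the flow of the
extension meets the half-space exactly in the times of one sign. The local flow is `C^k` by the
implicit function theorem applied to the integral equation (`exists_contDiffAt_flow`). Boxes have a
finite order `k` and may shrink as `k` grows. Entry point, entry time and exit time do not depend on
the boxes, so they are `C^k` for every `k`. -/

namespace LorentzianCobordism

noncomputable section

/-! ### Superposition operators on spaces of continuous functions. -/

section Nemytskii

open ContinuousMap Filter Topology

variable {X : Type*} [TopologicalSpace X] [CompactSpace X]
  {E G : Type} [NormedAddCommGroup E] [NormedSpace ℝ E] [NormedAddCommGroup G] [NormedSpace ℝ G]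

/-- The pointwise application of a continuous family of operators to a continuous family of
vectors. -/
def pointwiseApply : C(X, E →L[ℝ] G) →L[ℝ] C(X, E) →L[ℝ] C(X, G) :=
  LinearMap.mkContinuous₂
    (LinearMap.mk₂ ℝ (fun (A : C(X, E →L[ℝ] G)) (h : C(X, E)) =>
        (⟨fun t => A t (h t), A.continuous.clm_apply h.continuous⟩ : C(X, G)))
      (fun _ _ _ => by ext; simp) (fun _ _ _ => by ext; simp)
      (fun _ _ _ => by ext; simp) (fun _ _ _ => by ext; simp)) 1
    (fun A h => by
      rw [one_mul]
      refine (ContinuousMap.norm_le _ (by positivity)).2 fun t => ?_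
      exact (A t).le_of_opNorm_le_of_le (A.norm_coe_le_norm t) (h.norm_coe_le_norm t))

@[simp] lemma pointwiseApply_apply (A : C(X, E →L[ℝ] G)) (h : C(X, E)) (t : X) :
    pointwiseApply A h t = A t (h t) := rfl

lemma exists_dist_postcomp_lt {H : Type} [NormedAddCommGroup H] (w : C(E, H)) (u : C(X, E))
    {c : ℝ} (hc : 0 < c) :
    ∃ δ > 0, ∀ u', dist u' u < δ → dist (w.comp u') (w.comp u) < c :=
  Metric.continuous_iff.1 (ContinuousMap.continuous_postcomp w) u c hc

/-- The superposition operator `u ↦ v ∘ u` is differentiable if `v` is `C¹`. -/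
lemma hasFDerivAt_postcomp {v : C(E, G)} {v' : C(E, E →L[ℝ] G)}
    (hv : ∀ x, HasFDerivAt v (v' x) x) (u : C(X, E)) :
    HasFDerivAt (fun u : C(X, E) => v.comp u) (pointwiseApply (v'.comp u)) u := by
  rw [hasFDerivAt_iff_isLittleO_nhds_zero, Asymptotics.isLittleO_iff]
  intro c hc
  obtain ⟨δ, hδ, H⟩ := exists_dist_postcomp_lt v' u hc
  filter_upwards [Metric.ball_mem_nhds (0 : C(X, E)) hδ] with h hh
  rw [mem_ball_zero_iff] at hh
  refine (ContinuousMap.norm_le _ (by positivity)).2 fun t => ?_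
  -- Mean value inequality at each `t`. The points of the segment are values at `t` of `u + θ • h`,
  -- which is uniformly close to `u`, so one bound on the variation of `v'` serves all `t`.
  have key := (convex_segment (u t) (u t + h t)).norm_image_sub_le_of_norm_hasFDerivWithin_le'
    (f := v) (f' := fun x => v' x) (φ := v' (u t)) (C := c)
    (fun x _ => (hv x).hasFDerivWithinAt) (fun x hx => by
      rw [segment_eq_image'] at hx
      obtain ⟨θ, hθ, rfl⟩ := hx
      have h1 : dist (u + θ • h) u < δ := by
        rw [dist_eq_norm, add_sub_cancel_left, norm_smul, Real.norm_of_nonneg hθ.1]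
        exact (mul_le_of_le_one_left (norm_nonneg _) hθ.2).trans_lt hh
      have h2 := (ContinuousMap.dist_apply_le_dist (f := v'.comp (u + θ • h))
        (g := v'.comp u) t).trans (H _ h1).le
      simpa [dist_eq_norm] using h2)
    (left_mem_segment ℝ _ _) (right_mem_segment ℝ _ _)
  simp only [add_sub_cancel_left] at key
  calc _ ≤ c * ‖h t‖ := by simpa using key
    _ ≤ c * ‖h‖ := by gcongr; exact h.norm_coe_le_norm t

/-- The superposition operator `u ↦ v ∘ u` is of class `C^k` if `v` is. -/
lemma contDiff_postcomp (k : ℕ) : ∀ {G : Type} [NormedAddCommGroup G] [NormedSpace ℝ G]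
    {v : C(E, G)}, ContDiff ℝ k v → ContDiff ℝ k fun u : C(X, E) => v.comp u := by
  -- The target space must vary in the induction, because the derivative takes values in `E →L[ℝ]
  -- G`.
  induction k with
  | zero =>
    intro G _ _ v _
    simpa [contDiff_zero] using ContinuousMap.continuous_postcomp v
  | succ k ih =>
    intro G _ _ v hv
    obtain ⟨v', hv', hd⟩ := contDiff_succ_iff_hasFDerivAt.1 hv
    refine contDiff_succ_iff_hasFDerivAt.2
      ⟨fun u => pointwiseApply ((⟨v', hv'.continuous⟩ : C(E, E →L[ℝ] G)).comp u), ?_, fun u => ?_⟩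
    · exact (pointwiseApply (X := X) (E := E) (G := G)).contDiff.comp
        (ih (v := ⟨v', hv'.continuous⟩) hv')
    · exact hasFDerivAt_postcomp (v' := ⟨v', hv'.continuous⟩) hd u

end Nemytskii

/-! ### The integration operator and its behaviour under rescaling of time. -/

section Volterra

open MeasureTheory intervalIntegral

variable {E : Type} [NormedAddCommGroup E] [NormedSpace ℝ E]

lemma continuous_comp_projIcc {E : Type} [TopologicalSpace E] (u : C(Icc (0 : ℝ) 1, E)) :
    Continuous fun τ : ℝ => u (projIcc 0 1 zero_le_one τ) :=
  u.continuous.comp continuous_projIcc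

variable (E) in
/-- The integration operator on continuous functions on the unit interval. -/
def volterra : C(Icc (0 : ℝ) 1, E) →L[ℝ] C(Icc (0 : ℝ) 1, E) :=
  LinearMap.mkContinuous
    { toFun := fun u => ⟨fun r => ∫ τ in (0 : ℝ)..r, u (projIcc 0 1 zero_le_one τ),
        (continuous_primitive (fun a b =>
          (continuous_comp_projIcc u).intervalIntegrable a b) 0).comp continuous_subtype_val⟩
      map_add' := fun u w => by
        ext r
        exact integral_add ((continuous_comp_projIcc u).intervalIntegrable _ _)
          ((continuous_comp_projIcc w).intervalIntegrable _ _)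
      map_smul' := fun c u => by
        ext r
        exact intervalIntegral.integral_smul _ _ } 1
    (fun u => by
      refine (ContinuousMap.norm_le _ (by positivity)).2 fun r => ?_
      refine (norm_integral_le_of_norm_le_const (C := ‖u‖)
        fun τ _ => u.norm_coe_le_norm _).trans ?_
      rw [sub_zero, abs_of_nonneg r.2.1, one_mul]
      exact mul_le_of_le_one_right (norm_nonneg _) r.2.2)

lemma volterra_apply (u : C(Icc (0 : ℝ) 1, E)) (r : Icc (0 : ℝ) 1) :
    volterra E u r = ∫ τ in (0 : ℝ)..r, u (projIcc 0 1 zero_le_one τ) := rfl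

/-- Restriction of a function on `[0, 1]` to `[0, r]`, rescaled to `[0, 1]`. -/
def rescale {E : Type} [TopologicalSpace E] (r : Icc (0 : ℝ) 1) (u : C(Icc (0 : ℝ) 1, E)) :
    C(Icc (0 : ℝ) 1, E) :=
  ⟨fun τ => u (r * τ), u.continuous.comp (continuous_const.mul continuous_id)⟩

@[simp] lemma rescale_apply {E : Type} [TopologicalSpace E] (r τ : Icc (0 : ℝ) 1)
    (u : C(Icc (0 : ℝ) 1, E)) :
    rescale r u τ = u (r * τ) := rfl

lemma volterra_rescale (r τ : Icc (0 : ℝ) 1) (u : C(Icc (0 : ℝ) 1, E)) :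
    (r : ℝ) • volterra E (rescale r u) τ = volterra E u (r * τ) := by
  rw [volterra_apply, volterra_apply]
  have h : ∀ s ∈ uIcc (0 : ℝ) τ, rescale r u (projIcc 0 1 zero_le_one s) =
      u (projIcc 0 1 zero_le_one ((r : ℝ) * s)) := by
    intro s hs
    rw [uIcc_of_le τ.2.1] at hs
    have hs' : s ∈ Icc (0 : ℝ) 1 := ⟨hs.1, hs.2.trans τ.2.2⟩
    have hrs : (r : ℝ) * s ∈ Icc (0 : ℝ) 1 := ((r * ⟨s, hs'⟩ : Icc (0 : ℝ) 1)).2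
    rw [rescale_apply, projIcc_of_mem _ hs', projIcc_of_mem _ hrs]
    rfl
  rw [integral_congr h, smul_integral_comp_mul_left
    (fun s => u (projIcc 0 1 zero_le_one s)), mul_zero]
  rfl

end Volterra

/-! ### The local flow of a `C^k` vector field. -/

section Flow

open ContinuousMap Filter Topology intervalIntegral

variable {E : Type} [NormedAddCommGroup E] [NormedSpace ℝ E] [CompleteSpace E]

/-- A solution `u` of the integral equation `u r = x + s ∫₀ʳ v (u τ) dτ` is a zero of this map. -/
def integralEquation (v : C(E, E)) (z : (E × ℝ) × C(Icc (0 : ℝ) 1, E)) :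
    C(Icc (0 : ℝ) 1, E) :=
  z.2 - ContinuousLinearMap.const ℝ (Icc (0 : ℝ) 1) z.1.1 - z.1.2 • volterra E (v.comp z.2)

lemma contDiff_integralEquation {k : ℕ} {v : C(E, E)} (hv : ContDiff ℝ k v) :
    ContDiff ℝ k (integralEquation v) := by
  unfold integralEquation
  refine (contDiff_snd.sub ((ContinuousLinearMap.contDiff _).comp
    (contDiff_fst.comp contDiff_fst))).sub ((contDiff_snd.comp contDiff_fst).smul ?_)
  exact (volterra E).contDiff.comp ((contDiff_postcomp k hv).comp contDiff_snd)

/-- Solutions live on the fixed interval `[0,1]`, and the time `s` is a parameter multiplying the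
field. Following a solution only up to `r` is therefore the same as replacing `s` by `r * s`. -/
lemma integralEquation_rescale {v : C(E, E)} {x : E} {s : ℝ} {u : C(Icc (0 : ℝ) 1, E)}
    (h : integralEquation v ((x, s), u) = 0) (r : Icc (0 : ℝ) 1) :
    integralEquation v ((x, r * s), rescale r u) = 0 := by
  ext τ
  have h1 := DFunLike.congr_fun h (r * τ)
  have h2 := volterra_rescale r τ (v.comp u)
  have h3 : rescale r (v.comp u) = v.comp (rescale r u) := rfl
  rw [h3] at h2
  simp only [integralEquation, ContinuousMap.sub_apply, ContinuousMap.smul_apply,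
    ContinuousMap.zero_apply] at h1 ⊢
  rw [mul_comm (r : ℝ) s, mul_smul, h2]
  exact h1

/-- At `s = 0` the integral term drops out and the equation is affine in `u` with linear part the
identity, so the implicit function theorem applies. -/
lemma isInvertible_fderiv_integralEquation {k : ℕ} (hk : k ≠ 0) {v : C(E, E)}
    (hv : ContDiff ℝ k v) (x₀ : E) (u : C(Icc (0 : ℝ) 1, E)) :
    (fderiv ℝ (integralEquation v) ((x₀, 0), u) ∘L .inr ℝ (E × ℝ) _).IsInvertible := by
  have hd : DifferentiableAt ℝ (integralEquation v) ((x₀, 0), u) :=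
    (contDiff_integralEquation hv).differentiable (by exact_mod_cast hk) _
  have h1 : HasFDerivAt (fun w => integralEquation v ((x₀, 0), w))
      (fderiv ℝ (integralEquation v) ((x₀, 0), u) ∘L .inr ℝ (E × ℝ) _) u :=
    hd.hasFDerivAt.comp u (hasFDerivAt_prodMk_right (x₀, (0 : ℝ)) u)
  have h2 : HasFDerivAt (fun w => integralEquation v ((x₀, 0), w))
      (ContinuousLinearMap.id ℝ C(Icc (0 : ℝ) 1, E)) u := by
    have : (fun w => integralEquation v ((x₀, 0), w)) =
        fun w => w - ContinuousLinearMap.const ℝ (Icc (0 : ℝ) 1) x₀ := by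
      ext w; simp [integralEquation]
    rw [this]
    exact (hasFDerivAt_id u).sub_const _
  rw [h1.unique h2]
  exact ⟨.refl ℝ _, rfl⟩

/-- A `C^k` vector field on a Banach space has a local flow of class `C^k`. -/
theorem exists_contDiffAt_flow {k : ℕ} (hk : k ≠ 0) {v : E → E} (hv : ContDiff ℝ k v) (x₀ : E) :
    ∃ e : E × ℝ → E, ContDiffAt ℝ k e (x₀, 0) ∧ ∀ᶠ z in 𝓝 ((x₀, 0) : E × ℝ),
      e (z.1, 0) = z.1 ∧ HasDerivAt (fun s => e (z.1, s)) (v (e z)) z.2 := by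
  set V : C(E, E) := ⟨v, hv.continuous⟩
  have hk' : (k : WithTop ℕ∞) ≠ 0 := by exact_mod_cast hk
  set c : C(Icc (0 : ℝ) 1, E) := ContinuousLinearMap.const ℝ (Icc (0 : ℝ) 1) x₀ with hc
  have cdf : ContDiffAt ℝ k (integralEquation V) ((x₀, 0), c) :=
    (contDiff_integralEquation (v := V) hv).contDiffAt
  have inv := isInvertible_fderiv_integralEquation hk (v := V) hv x₀ c
  have hzero : integralEquation V ((x₀, 0), c) = 0 := by simp [integralEquation, hc]
  set ψ := cdf.implicitFunction hk' inv with hψ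
  have hψc : ContDiffAt ℝ k ψ (x₀, 0) := cdf.contDiffAt_implicitFunction hk' inv
  have hψ0 : ψ (x₀, 0) = c := cdf.implicitFunction_apply_self hk' inv
  have hev := cdf.eventually_apply_implicitFunction hk' inv
  have hiff := cdf.eventually_apply_eq_iff_implicitFunction hk' inv
  simp only [hzero, ← hψ] at hev hiff
  -- The solution with parameter `s` at the end `1` of the interval is the flow at time `s`.
  set e : E × ℝ → E := fun z => ψ z 1 with he
  have heval : ContDiff ℝ k fun u : C(Icc (0 : ℝ) 1, E) => u 1 :=
    (ContinuousMap.evalCLM (M := E) ℝ (1 : Icc (0 : ℝ) 1)).contDiff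
  have hec : ContDiffAt ℝ k e (x₀, 0) := heval.contDiffAt.comp _ hψc
  obtain ⟨ε, hε, Hiff⟩ := Metric.eventually_nhds_iff_ball.1 hiff
  have hclose : ∀ᶠ z in 𝓝 ((x₀, 0) : E × ℝ), dist (ψ z) c < ε := by
    have := hψc.continuousAt.eventually (Metric.ball_mem_nhds _ hε)
    rw [hψ0] at this
    exact this
  have hcont : ∀ᶠ z in 𝓝 ((x₀, 0) : E × ℝ), ContDiffAt ℝ k e z := hec.eventually (by simp)
  obtain ⟨η, hη, H⟩ := Metric.eventually_nhds_iff_ball.1 (hev.and (hclose.and hcont))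
  set ρ := min η ε
  have hρ : 0 < ρ := lt_min hη hε
  have mem_ball : ∀ {x : E} {s : ℝ} {δ : ℝ}, (x, s) ∈ Metric.ball ((x₀, 0) : E × ℝ) δ ↔
      dist x x₀ < δ ∧ |s| < δ := by
    intro x s δ
    rw [Metric.mem_ball, Prod.dist_eq, max_lt_iff, Real.dist_0_eq_abs]
  -- Both sides solve the equation with parameter `r * s` and are close to the constant `x₀`, so
  -- local uniqueness in the implicit function theorem identifies them. This turns the equation on
  -- `[0,1]` into an integral equation for `e` in the time variable.
  have scale : ∀ x s, (x, s) ∈ Metric.ball ((x₀, 0) : E × ℝ) ρ → ∀ r : Icc (0 : ℝ) 1,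
      ψ (x, r * s) = rescale r (ψ (x, s)) := by
    intro x s hz r
    obtain ⟨h1, h2, -⟩ := H (x, s) (Metric.ball_subset_ball (min_le_left _ _) hz)
    have hm := mem_ball.1 (Metric.ball_subset_ball (min_le_right _ _) hz)
    refine (Hiff ((x, r * s), rescale r (ψ (x, s))) ?_).1 (integralEquation_rescale h1 r)
    have hr : |(r : ℝ) * s| < ε := by
      rw [abs_mul, abs_of_nonneg r.2.1]
      exact (mul_le_of_le_one_left (abs_nonneg _) r.2.2).trans_lt hm.2
    have hs : dist (rescale r (ψ (x, s))) c < ε := by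
      refine lt_of_le_of_lt ?_ h2
      refine (ContinuousMap.dist_le dist_nonneg).2 fun τ => ?_
      exact ContinuousMap.dist_apply_le_dist (f := ψ (x, s)) (g := c) (r * τ)
    simp only [Metric.mem_ball, Prod.dist_eq, max_lt_iff, Real.dist_0_eq_abs]
    exact ⟨⟨hm.1, hr⟩, hs⟩
  have integral_eq : ∀ x s, (x, s) ∈ Metric.ball ((x₀, 0) : E × ℝ) ρ →
      e (x, s) = x + ∫ τ in (0 : ℝ)..s, v (e (x, τ)) := by
    intro x s hz
    obtain ⟨h1, -, -⟩ := H (x, s) (Metric.ball_subset_ball (min_le_left _ _) hz)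
    have h2 := DFunLike.congr_fun h1 1
    simp only [integralEquation, ContinuousMap.sub_apply, ContinuousMap.smul_apply,
    ContinuousMap.zero_apply, volterra_apply] at h2
    have h3 : ∀ r ∈ uIcc (0 : ℝ) (1 : Icc (0 : ℝ) 1),
        (V.comp (ψ (x, s))) (projIcc 0 1 zero_le_one r) = v (e (x, s * r)) := by
      intro r hr
      rw [uIcc_of_le (by simp)] at hr
      have hr' : r ∈ Icc (0 : ℝ) 1 := by simpa using hr
      have := DFunLike.congr_fun (scale x s hz ⟨r, hr'⟩) 1
      rw [rescale_apply, mul_one] at this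
      rw [projIcc_of_mem _ hr']
      simp only [he, mul_comm s r, ContinuousMap.comp_apply]
      rw [this]
      rfl
    rw [integral_congr h3, smul_integral_comp_mul_left (fun τ => v (e (x, τ)))] at h2
    rw [sub_sub, sub_eq_zero] at h2
    simpa using h2
  refine ⟨e, hec, ?_⟩
  filter_upwards [Metric.ball_mem_nhds _ hρ] with z hz
  obtain ⟨x, s⟩ := z
  have hm := mem_ball.1 hz
  have hsub : ∀ τ, |τ| < ρ → (x, τ) ∈ Metric.ball ((x₀, 0) : E × ℝ) ρ :=
    fun τ hτ => mem_ball.2 ⟨hm.1, hτ⟩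
  refine ⟨by simpa using integral_eq x 0 (hsub 0 (by simpa using hρ)), ?_⟩
  have hco : ContinuousOn (fun τ => v (e (x, τ))) (Ioo (-ρ) ρ) := by
    intro τ hτ
    have h4 := (H (x, τ) (Metric.ball_subset_ball (min_le_left _ _)
      (hsub τ (abs_lt.2 hτ)))).2.2.continuousAt
    have h5 : ContinuousAt (fun τ : ℝ => e (x, τ)) τ :=
      ContinuousAt.comp (f := fun τ : ℝ => (x, τ)) h4 (by fun_prop)
    exact (hv.continuous.continuousAt.comp h5).continuousWithinAt
  have hs : s ∈ Ioo (-ρ) ρ := abs_lt.1 hm.2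
  have hd : HasDerivAt (fun s => x + ∫ τ in (0 : ℝ)..s, v (e (x, τ))) (v (e (x, s))) s := by
    refine (integral_hasDerivAt_right ?_ ?_ ?_).const_add x
    · refine (hco.mono ?_).intervalIntegrable
      exact ordConnected_Ioo.uIcc_subset ⟨by linarith, hρ⟩ hs
    · exact hco.stronglyMeasurableAtFilter isOpen_Ioo s hs
    · exact hco.continuousAt (isOpen_Ioo.mem_nhds hs)
  refine hd.congr_of_eventuallyEq ?_
  filter_upwards [isOpen_Ioo.mem_nhds hs] with τ hτ
  exact integral_eq x τ (hsub τ (abs_lt.2 hτ))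

end Flow

/-! ### Extension of `C^k` functions across a hyperplane by reflections. -/

section Extension

open Topology

variable {E : Type} [NormedAddCommGroup E] [NormedSpace ℝ E] (l : E →L[ℝ] ℝ) (w : E)

/-- The linear map fixing the kernel of `l` and multiplying `w` by `-c`, where `l w = 1`. -/
def stretchReflection (c : ℝ) : E →L[ℝ] E :=
  ContinuousLinearMap.id ℝ E - (1 + c) • l.smulRight w

lemma stretchReflection_apply (c : ℝ) (x : E) :
    stretchReflection l w c x = x - ((1 + c) * l x) • w := by
  simp [stretchReflection, mul_smul]

variable {l w}

lemma map_stretchReflection (hw : l w = 1) (c : ℝ) (x : E) :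
    l (stretchReflection l w c x) = -c * l x := by
  simp [stretchReflection_apply, hw]; ring

variable (l w) {ι : Type} [Fintype ι]

open Classical in
/-- The extension by higher order reflections of a function on the half-space `0 ≤ l`. -/
def reflectionExtension {G : Type} [AddCommMonoid G] [Module ℝ G] (c a : ι → ℝ) (f : E → G)
    (x : E) : G :=
  if 0 ≤ l x then f x else ∑ j, a j • f (stretchReflection l w (c j) x)

variable {l w} {c : ι → ℝ}

lemma reflectionExtension_of_nonneg {G : Type} [AddCommMonoid G] [Module ℝ G] {a : ι → ℝ}
    {f : E → G} {x : E} (hx : 0 ≤ l x) : reflectionExtension l w c a f x = f x := if_pos hx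

lemma reflectionExtension_of_nonpos {G : Type} [AddCommGroup G] [Module ℝ G] {a : ι → ℝ}
    (ha : ∑ j, a j = 1) {f : E → G} {x : E} (hx : l x ≤ 0) :
    reflectionExtension l w c a f x = ∑ j, a j • f (stretchReflection l w (c j) x) := by
  unfold reflectionExtension
  split_ifs with h
  · have h0 : l x = 0 := le_antisymm hx h
    simp [stretchReflection_apply, h0, ← Finset.sum_smul, ha]
  · rfl

lemma uniqueDiffOn_halfSpace (hw : l w = 1) : UniqueDiffOn ℝ {x | 0 ≤ l x} := by
  refine uniqueDiffOn_convex (convex_halfSpace_ge l.isLinear 0) ⟨w, ?_⟩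
  refine mem_interior_iff_mem_nhds.2 (Filter.mem_of_superset
    ((isOpen_lt continuous_const l.continuous).mem_nhds (show (0 : ℝ) < l w by simp [hw])) ?_)
  exact fun x (hx : 0 < l x) => hx.le

/-- Induction on `k`: the derivative is again built from reflection extensions. Differentiating
along `w` multiplies the weights `a j` by `-c j`, which shifts the moment conditions by one, and
differentiating along `ker l` keeps the weights. -/
lemma contDiff_reflectionExtension (hw : l w = 1) (hc : ∀ j, 0 < c j) (k : ℕ) :
    ∀ {G : Type} [NormedAddCommGroup G] [NormedSpace ℝ G] {f : E → G} {a : ι → ℝ},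
      ContDiffOn ℝ k f {x | 0 ≤ l x} → (∀ m ≤ k, ∑ j, a j * (-c j) ^ m = 1) →
      ContDiff ℝ k (reflectionExtension l w c a f) := by
  have hmaps : ∀ j, MapsTo (stretchReflection l w (c j)) {x | l x ≤ 0} {x | 0 ≤ l x} := by
    intro j x hx
    change 0 ≤ l _
    rw [map_stretchReflection hw]
    exact mul_nonneg_of_nonpos_of_nonpos (by linarith [hc j]) hx
  induction k with
  | zero =>
    intro G _ _ f a hf ha
    have ha0 : ∑ j, a j = 1 := by simpa using ha 0 le_rfl
    rw [Nat.cast_zero, contDiff_zero]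
    rw [Nat.cast_zero, contDiffOn_zero] at hf
    unfold reflectionExtension
    refine continuous_if_le continuous_const l.continuous hf ?_ ?_
    · refine continuousOn_finsetSum _ fun j _ => continuousOn_const.smul ?_
      exact hf.comp (stretchReflection l w (c j)).continuous.continuousOn (hmaps j)
    · intro x hx
      rw [← reflectionExtension_of_nonpos ha0 hx.ge, reflectionExtension_of_nonneg hx.le]
  | succ k ih =>
    intro G _ _ f a hf ha
    have ha0 : ∑ j, a j = 1 := by simpa using ha 0 (Nat.zero_le _)
    have ha1 : ∑ j, a j * (-c j) = 1 := by simpa using ha 1 (by omega)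
    have hud := uniqueDiffOn_halfSpace hw
    set D : E → E →L[ℝ] G := fderivWithin ℝ f {x | 0 ≤ l x} with hDdef
    have hD : ContDiffOn ℝ k D {x | 0 ≤ l x} :=
      hf.fderivWithin hud (by push_cast; exact le_rfl)
    have hfd : ∀ x, 0 ≤ l x → HasFDerivWithinAt f (D x) {x | 0 ≤ l x} x := fun x hx =>
      (hf.differentiableOn (by norm_cast) x hx).hasFDerivWithinAt
    -- `P` is the projection to `ker l` along `w`. A reflection equals `P` on `ker l` and multiplies
    -- `w` by `-c j`, so the two components of `D` are extended with different weights.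
    set P : E →L[ℝ] E := ContinuousLinearMap.id ℝ E - l.smulRight w with hP
    have h1 := ih (f := fun x => D x w) (a := fun j => a j * (-c j))
      (hD.clm_apply contDiffOn_const) (fun m hm => by
        rw [← ha (m + 1) (by omega)]
        exact Finset.sum_congr rfl fun j _ => by ring)
    have h2 := ih (f := fun x => (D x).comp P) (a := a)
      (hD.clm_comp contDiffOn_const) (fun m hm => ha m (by omega))
    refine contDiff_succ_iff_hasFDerivAt.2
      ⟨fun x => l.smulRight (reflectionExtension l w c (fun j => a j * (-c j)) (fun x => D x w) x)
        + reflectionExtension l w c a (fun x => (D x).comp P) x, ?_, fun x => ?_⟩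
    · exact ((ContinuousLinearMap.smulRightL ℝ E G l).contDiff.comp h1).add h2
    set g := l.smulRight (reflectionExtension l w c (fun j => a j * (-c j)) (fun x => D x w) x)
        + reflectionExtension l w c a (fun x => (D x).comp P) x with hg
    have hpos : 0 ≤ l x → HasFDerivWithinAt (reflectionExtension l w c a f) g
        {x | 0 ≤ l x} x := by
      intro hx
      have : g = D x := by
        rw [hg, reflectionExtension_of_nonneg hx, reflectionExtension_of_nonneg hx]
        ext y
        simp [hP]
      rw [this]
      exact (hfd x hx).congr (fun y hy => reflectionExtension_of_nonneg hy)
        (reflectionExtension_of_nonneg hx)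
    have hneg : l x ≤ 0 → HasFDerivWithinAt (reflectionExtension l w c a f) g
        {x | l x ≤ 0} x := by
      intro hx
      have : g = ∑ j, a j • (D (stretchReflection l w (c j) x)).comp
          (stretchReflection l w (c j)) := by
        rw [hg, reflectionExtension_of_nonpos ha1 hx, reflectionExtension_of_nonpos ha0 hx]
        ext y
        simp only [add_apply, ContinuousLinearMap.smulRight_apply,
          sum_apply, smul_apply,
          ContinuousLinearMap.comp_apply, Finset.smul_sum, ← Finset.sum_add_distrib,
          stretchReflection_apply, hP, sub_apply,
          ContinuousLinearMap.id_apply, map_sub, map_smul]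
        refine Finset.sum_congr rfl fun j _ => ?_
        module
      rw [this]
      have hsum : HasFDerivWithinAt
          (fun y => ∑ j, a j • f (stretchReflection l w (c j) y))
          (∑ j, a j • (D (stretchReflection l w (c j) x)).comp (stretchReflection l w (c j)))
          {x | l x ≤ 0} x := by
        refine HasFDerivWithinAt.fun_sum fun j _ => HasFDerivWithinAt.const_smul ?_ (a j)
        exact (hfd _ (hmaps j hx)).comp x
          (stretchReflection l w (c j)).hasFDerivAt.hasFDerivWithinAt (hmaps j)
      exact hsum.congr (fun y hy => reflectionExtension_of_nonpos ha0 hy)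
        (reflectionExtension_of_nonpos ha0 hx)
    rcases lt_trichotomy (l x) 0 with h | h | h
    · exact (hneg h.le).hasFDerivAt (Filter.mem_of_superset
        ((isOpen_lt l.continuous continuous_const).mem_nhds h) fun y (hy : l y < 0) => hy.le)
    -- On the hyperplane the derivatives from both sides are the same `g`, and the two closed
    -- half-spaces cover `E`.
    · have hu := (hpos h.ge).union (hneg h.le)
      rwa [show {x | 0 ≤ l x} ∪ {x | l x ≤ 0} = univ from
        eq_univ_of_forall fun y => le_total 0 (l y), hasFDerivWithinAt_univ] at hu
    · exact (hpos h.le).hasFDerivAt (Filter.mem_of_superset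
        ((isOpen_lt continuous_const l.continuous).mem_nhds h) fun y (hy : 0 < l y) => hy.le)

/-- A function of class `C^k` on a closed half-space extends to a function of class `C^k`. -/
theorem exists_contDiff_extension (hw : l w = 1) (k : ℕ) {G : Type} [NormedAddCommGroup G]
    [NormedSpace ℝ G] {f : E → G} (hf : ContDiffOn ℝ k f {x | 0 ≤ l x}) :
    ∃ f' : E → G, ContDiff ℝ k f' ∧ EqOn f' f {x | 0 ≤ l x} := by
  let c : Fin (k + 1) → ℝ := fun j => (j : ℝ) + 1
  -- The moment conditions say that evaluation at `1` of a polynomial of degree at most `k` equals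
  -- the weighted sum of its values at the nodes `-c j`. Lagrange interpolation on `k + 1` distinct
  -- nodes gives such weights.
  let a : Fin (k + 1) → ℝ := fun j =>
    (Lagrange.basis Finset.univ (fun i => -c i) j).eval 1
  refine ⟨reflectionExtension l w c a f,
    contDiff_reflectionExtension hw (fun j => by positivity) k hf fun m hm => ?_,
    fun x hx => reflectionExtension_of_nonneg hx⟩
  have hinj : InjOn (fun i => -c i) (Finset.univ : Finset (Fin (k + 1))) := by
    intro i _ j _ hij
    simpa [c, Fin.ext_iff] using hij
  have h := Lagrange.eq_interpolate (f := (Polynomial.X : Polynomial ℝ) ^ m) hinj (by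
    rw [Polynomial.degree_X_pow, Finset.card_univ, Fintype.card_fin]
    exact_mod_cast Nat.lt_succ_of_le hm)
  have h1 := congrArg (Polynomial.eval 1) h
  simp only [Polynomial.eval_pow, Polynomial.eval_X, one_pow, Lagrange.interpolate_apply,
    Polynomial.eval_finsetSum, Polynomial.eval_mul, Polynomial.eval_C] at h1
  rw [h1]
  exact Finset.sum_congr rfl fun j _ => mul_comm _ _

end Extension

/-! ### Straightening a vector field on a vector space. -/

section StraighteningFlow

open Filter Topology

variable {E F : Type} [NormedAddCommGroup E] [NormedSpace ℝ E] [CompleteSpace E]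
  [NormedAddCommGroup F] [NormedSpace ℝ F] [CompleteSpace F]

/-- Straightening of a `C^k` vector field near a point where it does not vanish. -/
theorem exists_straightening {k : ℕ} (hk : k ≠ 0) {v : E → E} (hv : ContDiff ℝ k v) (x₀ : E)
    (A : (F × ℝ) ≃L[ℝ] E) (hA : A (0, 1) = v x₀) :
    ∃ Θ : OpenPartialHomeomorph (F × ℝ) E, (0, 0) ∈ Θ.source ∧ Θ (0, 0) = x₀ ∧
      ContDiffOn ℝ k Θ Θ.source ∧ ContDiffOn ℝ k Θ.symm Θ.target ∧
      (∀ z ∈ Θ.source, HasDerivAt (fun s => Θ (z.1, s)) (v (Θ z)) z.2) ∧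
      ∀ z ∈ Θ.source, Θ (z.1, 0) = x₀ + A (z.1, 0) := by
  obtain ⟨e, hec, hev⟩ := exists_contDiffAt_flow hk hv x₀
  have hk' : (k : WithTop ℕ∞) ≠ 0 := by exact_mod_cast hk
  set m : F × ℝ → E × ℝ := fun z => (x₀ + A (z.1, 0), z.2) with hm
  have hmc : ContDiff ℝ k m := by
    refine ContDiff.prodMk (contDiff_const.add (A.contDiff.comp ?_)) contDiff_snd
    exact contDiff_fst.prodMk contDiff_const
  have hm0 : m (0, 0) = (x₀, 0) := by simp [hm, show ((0, 0) : F × ℝ) = 0 from rfl]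
  set f : F × ℝ → E := e ∘ m with hf
  have hfc : ContDiffAt ℝ k f (0, 0) := by
    refine ContDiffAt.comp _ ?_ hmc.contDiffAt
    rwa [hm0]
  have hev' : ∀ᶠ z in 𝓝 ((0, 0) : F × ℝ), f (z.1, 0) = x₀ + A (z.1, 0) ∧
      HasDerivAt (fun s => f (z.1, s)) (v (f z)) z.2 := by
    have := (hmc.continuous.tendsto (0, 0)).eventually (hm0 ▸ hev)
    filter_upwards [this] with z hz
    exact hz
  have hf0 : f (0, 0) = x₀ := by
    simpa [show ((0, 0) : F × ℝ) = 0 from rfl] using hev'.self_of_nhds.1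
  -- `f` flows for time `s` from the point `x₀ + A (y, 0)`. Its derivative agrees with `A` on `F ×
  -- 0` by the initial values and on `(0, 1)` by the differential equation, so the inverse function
  -- theorem applies.
  have hd : HasFDerivAt f (A : F × ℝ →L[ℝ] E) (0, 0) := by
    have h := (hfc.differentiableAt hk').hasFDerivAt
    set L := fderiv ℝ f (0, 0)
    have h1 : L.comp (.inl ℝ F ℝ) = (A : F × ℝ →L[ℝ] E).comp (.inl ℝ F ℝ) := by
      have h2 : HasFDerivAt (fun y => f (y, 0)) (L.comp (.inl ℝ F ℝ)) 0 :=
        HasFDerivAt.comp (f := fun y : F => (y, (0 : ℝ))) (0 : F) h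
          (hasFDerivAt_prodMk_left (0 : F) (0 : ℝ))
      have h3 : HasFDerivAt (fun y => x₀ + A (y, 0))
          ((A : F × ℝ →L[ℝ] E).comp (.inl ℝ F ℝ)) 0 :=
        (((A : F × ℝ →L[ℝ] E).comp (.inl ℝ F ℝ)).hasFDerivAt (x := 0)).const_add x₀
      refine h2.unique (h3.congr_of_eventuallyEq ?_)
      have h4 : Tendsto (fun y : F => (y, (0 : ℝ))) (𝓝 0) (𝓝 (0, 0)) :=
        (Continuous.prodMk_left (0 : ℝ)).tendsto 0
      filter_upwards [h4.eventually hev'] with y hy using hy.1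
    have h5 : L (0, 1) = v x₀ := by
      have h6 : HasDerivAt (fun s : ℝ => f (0, s)) (L (0, 1)) 0 :=
        h.comp_hasDerivAt (0 : ℝ) ((hasDerivAt_const (0 : ℝ) (0 : F)).prodMk (hasDerivAt_id 0))
      exact h6.unique (hf0 ▸ hev'.self_of_nhds.2)
    have : L = (A : F × ℝ →L[ℝ] E) := by
      ext z
      · exact DFunLike.congr_fun h1 z
      · simpa [hA] using h5
    rwa [this] at h
  set Θ := hfc.toOpenPartialHomeomorph f hd hk' with hΘ
  have hΘf : ∀ z, Θ z = f z := fun z => rfl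
  have h0 : ((0, 0) : F × ℝ) ∈ Θ.source := hfc.mem_toOpenPartialHomeomorph_source hd hk'
  have hinv : ContDiffAt ℝ k Θ.symm x₀ := hf0 ▸ hfc.to_localInverse hd hk'
  have hN : ∀ᶠ z in 𝓝 ((0, 0) : F × ℝ), ContDiffAt ℝ k f z ∧ ContDiffAt ℝ k Θ.symm (Θ z) ∧
      f (z.1, 0) = x₀ + A (z.1, 0) ∧ HasDerivAt (fun s => f (z.1, s)) (v (f z)) z.2 := by
    refine (hfc.eventually (by simp)).and (Filter.Eventually.and ?_ hev')
    have : Tendsto Θ (𝓝 (0, 0)) (𝓝 x₀) := by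
      have := Θ.continuousAt h0
      rwa [ContinuousAt, hΘf, hf0] at this
    exact this.eventually (hinv.eventually (by simp))
  obtain ⟨O, hO, hOo, hO0⟩ := eventually_nhds_iff.1 hN
  refine ⟨Θ.restrOpen O hOo, ⟨h0, hO0⟩, hf0, ?_, ?_, ?_, ?_⟩
  · intro z hz
    exact (hO z hz.2).1.contDiffWithinAt
  · intro x hx
    rw [Θ.restrOpen_toPartialEquiv] at hx
    have := (hO (Θ.symm x) hx.2).2.1
    rw [Θ.right_inv hx.1] at this
    exact this.contDiffWithinAt
  · intro z hz
    exact (hO z hz.2).2.2.2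
  · intro z hz
    exact (hO z hz.2).2.2.1

end StraighteningFlow

/-! ### Vector fields in charts. -/

section ChartField

open Filter Topology

variable {E : Type} [NormedAddCommGroup E] [NormedSpace ℝ E] {H : Type*} [TopologicalSpace H]
  (I : ModelWithCorners ℝ E H) {M : Type*} [TopologicalSpace M] [ChartedSpace H M]

/-- The coordinate representation of a vector field in the extended chart at `p`. -/
def chartField (V : ∀ p : M, TangentSpace I p) (p : M) (x : E) : E :=
  mfderiv I 𝓘(ℝ, E) (extChartAt I p) ((extChartAt I p).symm x) (V ((extChartAt I p).symm x))

variable {I} [IsManifold I ∞ M] {V : ∀ p : M, TangentSpace I p}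

lemma contDiffWithinAt_chartField
    (hV : ContMDiff I I.tangent ∞ fun p => (⟨p, V p⟩ : TangentBundle I M)) (p : M) :
    ContDiffWithinAt ℝ ∞ (chartField I V p) (range I) (extChartAt I p p) := by
  have h1 : ContMDiffAt I 𝓘(ℝ, E) ∞
      (fun q => (trivializationAt E (TangentSpace I) p ⟨q, V q⟩).2) p :=
    (Bundle.contMDiffAt_totalSpace.1 (hV p)).2
  let f : M → E := fun q => mfderiv I 𝓘(ℝ, E) (extChartAt I p) q (V q)
  have h2 : ContMDiffAt I 𝓘(ℝ, E) ∞ f p := by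
    refine h1.congr_of_eventuallyEq ?_
    filter_upwards [(chartAt H p).open_source.mem_nhds (mem_chart_source H p)] with q hq
    have hq' : q ∈ (trivializationAt E (TangentSpace I) p).baseSet := by simpa using hq
    simp only [f]
    rw [← TangentBundle.continuousLinearMapAt_trivializationAt hq]
    exact Bundle.Trivialization.continuousLinearMapAt_apply_of_mem ℝ _ hq' _
  rw [contMDiffAt_iff] at h2
  exact h2.2

lemma mfderivWithin_extChartAt_symm_chartField {p : M} {x : E}
    (hx : x ∈ (extChartAt I p).target) :
    mfderivWithin 𝓘(ℝ, E) I (extChartAt I p).symm (range I) x (chartField (E := E) I V p x) =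
      V ((extChartAt I p).symm x) :=
  DFunLike.congr_fun (mfderivWithin_extChartAt_symm_comp_mfderiv_extChartAt hx)
    (V ((extChartAt I p).symm x))

/-- A function of class `C^k` near a point, relative to a set, agrees near the point with one of
class `C^k` on the whole set. -/
lemma exists_contDiffOn_eventuallyEq [FiniteDimensional ℝ E] {k : ℕ} {f : E → E} {R : Set E}
    {x₀ : E} (hx₀ : x₀ ∈ R) (hf : ContDiffWithinAt ℝ k f R x₀) :
    ∃ f' : E → E, ContDiffOn ℝ k f' R ∧ f' =ᶠ[𝓝 x₀] f := by
  obtain ⟨u, hu, hfu⟩ := hf.contDiffOn le_rfl (by simp)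
  rw [insert_eq_of_mem hx₀] at hu
  obtain ⟨r, hr, hru⟩ := Metric.mem_nhdsWithin_iff.1 hu
  let χ : ContDiffBump x₀ := ⟨r / 4, r / 2, by positivity, by linarith⟩
  refine ⟨fun x => χ x • f x, ?_, ?_⟩
  · intro x hx
    by_cases hxr : dist x x₀ < r
    · have h1 : ContDiffWithinAt ℝ k f R x := by
        refine (hfu.2 x (hru ⟨hxr, hx⟩)).mono_of_mem_nhdsWithin ?_
        exact mem_of_superset (inter_mem_nhdsWithin R (Metric.isOpen_ball.mem_nhds hxr))
          (inter_comm R _ ▸ hru)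
      exact χ.contDiff.contDiffWithinAt.smul h1
    · have h0 : (fun x => χ x • f x) =ᶠ[𝓝 x] fun _ => 0 := by
        have : {y | r / 2 < dist y x₀} ∈ 𝓝 x :=
          (isOpen_lt continuous_const (by fun_prop)).mem_nhds
            (show r / 2 < dist x x₀ by linarith)
        filter_upwards [this] with y hy
        rw [χ.zero_of_le_dist (le_of_lt hy), zero_smul]
      exact (contDiffAt_const.congr_of_eventuallyEq h0).contDiffWithinAt
  · filter_upwards [χ.eventuallyEq_one] with x hx
    simp [hx]

end ChartField

/-! ### Flow boxes and their construction from a straightening. -/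

section FlowBox

open Filter Topology

variable {E F : Type} [NormedAddCommGroup E] [NormedSpace ℝ E] [NormedAddCommGroup F]
  [NormedSpace ℝ F] {H : Type*} [TopologicalSpace H]
  {I : ModelWithCorners ℝ E H} {M : Type*} [TopologicalSpace M] [ChartedSpace H M]

variable (I F) in
/-- A box in which a vector field is straightened: coordinates `(y, s)` near `p` such that the
curves `y = const` are integral curves, parametrized by `s`, where `s` ranges over a neighbourhood
of `0` in a set `J` that is the line or a half-line. -/
structure FlowBox (V : ∀ p : M, TangentSpace I p) (k : ℕ) (p : M) where
  radius : ℝ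
  radius_pos : 0 < radius
  times : Set ℝ
  times_eq : times = univ ∨ times = Ici 0 ∨ times = Iic 0
  chart : M → F × ℝ
  param : F × ℝ → M
  source : Set M
  isOpen_source : IsOpen source
  mem_source : p ∈ source
  chart_mem : ∀ q ∈ source,
    chart q ∈ Metric.ball (0 : F) radius ×ˢ (Ioo (-radius) radius ∩ times)
  param_mem : ∀ z ∈ Metric.ball (0 : F) radius ×ˢ (Ioo (-radius) radius ∩ times),
    param z ∈ source
  param_chart : ∀ q ∈ source, param (chart q) = q
  chart_param : ∀ z ∈ Metric.ball (0 : F) radius ×ˢ (Ioo (-radius) radius ∩ times),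
    chart (param z) = z
  chart_center : chart p = (0, 0)
  contMDiffOn_chart : ContMDiffOn I 𝓘(ℝ, F × ℝ) k chart source
  contMDiffOn_param : ContMDiffOn 𝓘(ℝ, F × ℝ) I k param
    (Metric.ball (0 : F) radius ×ˢ (Ioo (-radius) radius ∩ times))
  isMIntegralCurveOn : ∀ y ∈ Metric.ball (0 : F) radius,
    IsMIntegralCurveOn (fun s => param (y, s)) V (Ioo (-radius) radius ∩ times)

variable [CompleteSpace E] [CompleteSpace F] [IsManifold I ∞ M] {V : ∀ p : M, TangentSpace I p}

/-- The straightened field `v` represents `V` only on the model range. Hypothesis `hR` makes the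
range correspond to the times in `J`, so cutting a small ball down to these times yields a box in
`M`. -/
lemma nonempty_flowBox_of_eventually {k : ℕ} {p : M} {v : E → E}
    (hvV : ∀ᶠ x in 𝓝[range I] (extChartAt I p p), v x = chartField I V p x)
    {J : Set ℝ} (hJ : J = univ ∨ J = Ici 0 ∨ J = Iic 0)
    {Θ : OpenPartialHomeomorph (F × ℝ) E} (h0 : (0, 0) ∈ Θ.source)
    (hΘ0 : Θ (0, 0) = extChartAt I p p)
    (hΘ : ContDiffOn ℝ k Θ Θ.source) (hΘ' : ContDiffOn ℝ k Θ.symm Θ.target)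
    (hd : ∀ z ∈ Θ.source, HasDerivAt (fun s => Θ (z.1, s)) (v (Θ z)) z.2)
    (hR : ∀ᶠ z in 𝓝 ((0, 0) : F × ℝ), Θ z ∈ range I ↔ z.2 ∈ J) :
    ∃ b : FlowBox F I V k p, b.times = J := by
  set φ := extChartAt I p with hφ
  have hgood : ∀ᶠ x in 𝓝 (φ p), x ∈ range I → x ∈ φ.target ∧ v x = chartField I V p x := by
    have : ∀ᶠ x in 𝓝[range I] (φ p), x ∈ φ.target := by
      exact extChartAt_target_mem_nhdsWithin (I := I) p
    exact eventually_nhdsWithin_iff.1 (this.and hvV)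
  have hΘt : Tendsto Θ (𝓝 (0, 0)) (𝓝 (φ p)) := hΘ0 ▸ Θ.continuousAt h0
  obtain ⟨δ, hδ, Hδ⟩ := Metric.eventually_nhds_iff_ball.1
    ((Θ.open_source.eventually_mem h0).and (hR.and (hΘt.eventually hgood)))
  set B : Set (F × ℝ) := Metric.ball (0 : F) δ ×ˢ Ioo (-δ) δ with hB
  have hBball : B = Metric.ball ((0, 0) : F × ℝ) δ := by
    rw [hB, ← ball_prod_same, Real.ball_eq_Ioo]; simp
  have HB : ∀ z ∈ B, z ∈ Θ.source ∧ (Θ z ∈ range I ↔ z.2 ∈ J) ∧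
      (Θ z ∈ range I → Θ z ∈ φ.target ∧ v (Θ z) = chartField I V p (Θ z)) := fun z hz =>
    Hδ z (hBball ▸ hz)
  set D : Set (F × ℝ) := Metric.ball (0 : F) δ ×ˢ (Ioo (-δ) δ ∩ J) with hD
  have hDB : ∀ z ∈ D, z ∈ B := fun z hz => ⟨hz.1, hz.2.1⟩
  have hDt : ∀ z ∈ D, Θ z ∈ φ.target := fun z hz =>
    ((HB z (hDB z hz)).2.2 ((HB z (hDB z hz)).2.1.2 hz.2.2)).1
  have hJ0 : (0 : ℝ) ∈ J := by rcases hJ with rfl | rfl | rfl <;> simp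
  have hBo : IsOpen B := Metric.isOpen_ball.prod isOpen_Ioo
  have hBs : B ⊆ Θ.source := fun z hz => (HB z hz).1
  refine ⟨{
    radius := δ
    radius_pos := hδ
    times := J
    times_eq := hJ
    chart := fun q => Θ.symm (φ q)
    param := fun z => φ.symm (Θ z)
    source := φ.source ∩ φ ⁻¹' (Θ '' B)
    isOpen_source := (continuousOn_extChartAt p).isOpen_inter_preimage
      (isOpen_extChartAt_source p) (Θ.isOpen_image_of_subset_source hBo hBs)
    mem_source := ⟨mem_extChartAt_source p, (0, 0), by simp [hB, hδ], hΘ0⟩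
    chart_mem := ?_
    param_mem := ?_
    param_chart := ?_
    chart_param := ?_
    chart_center := ?_
    contMDiffOn_chart := ?_
    contMDiffOn_param := ?_
    isMIntegralCurveOn := ?_ }, rfl⟩
  · rintro q ⟨hq, z, hz, hzq⟩
    change Θ.symm (φ q) ∈ D
    rw [← hzq, Θ.left_inv (hBs hz)]
    exact ⟨hz.1, hz.2, (HB z hz).2.1.1
      (hzq ▸ extChartAt_target_subset_range p (φ.map_source hq))⟩
  · intro z hz
    exact ⟨φ.map_target (hDt z hz), z, hDB z hz, (φ.right_inv (hDt z hz)).symm⟩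
  · rintro q ⟨hq, z, hz, hzq⟩
    rw [← hzq, Θ.left_inv (hBs hz), hzq, φ.left_inv hq]
  · intro z hz
    rw [φ.right_inv (hDt z hz), Θ.left_inv (hBs (hDB z hz))]
  · rw [← hΘ0, Θ.left_inv h0]
  · refine hΘ'.contMDiffOn.comp ((contMDiffOn_extChartAt (n := ∞)).of_le
      (by exact_mod_cast le_top) |>.mono ?_) ?_
    · intro q hq
      simpa [hφ] using hq.1
    · rintro q ⟨hq, z, hz, hzq⟩
      simp only [mem_preimage, ← hzq]
      exact Θ.map_source (hBs hz)
  · refine ((contMDiffOn_extChartAt_symm (n := ∞) p).of_le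
      (by exact_mod_cast le_top)).comp (hΘ.contMDiffOn.mono (fun z hz => hBs (hDB z hz))) ?_
    exact fun z hz => hDt z hz
  · intro y hy s hs
    have hz : (y, s) ∈ D := ⟨hy, hs⟩
    have h1 := ((hd (y, s) (hBs (hDB _ hz))).hasDerivWithinAt
      (s := Ioo (-δ) δ ∩ J)).hasFDerivWithinAt.hasMFDerivWithinAt
    have h2 := (mdifferentiableWithinAt_extChartAt_symm (hDt _ hz)).hasMFDerivWithinAt
    have h3 := HasMFDerivWithinAt.comp (f := fun s => Θ (y, s)) s h2 h1 (fun t ht =>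
      extChartAt_target_subset_range p (hDt (y, t) ⟨hy, ht⟩))
    refine h3.congr_mfderiv ?_
    have h4 := ((HB _ (hDB _ hz)).2.2 ((HB _ (hDB _ hz)).2.1.2 hs.2)).2
    ext
    have h5 := mfderivWithin_extChartAt_symm_chartField (V := V) (hDt _ hz)
    rw [← h4] at h5
    have h6 : (1 : ℝ) • V (φ.symm (Θ (y, s))) = V (φ.symm (Θ (y, s))) := one_smul ℝ _
    refine Eq.trans ?_ (h5.trans h6.symm)
    exact congrArg (mfderivWithin 𝓘(ℝ, E) I φ.symm (range I) (Θ (y, s))) (one_smul ℝ (v (Θ (y, s))))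

/-- Along each flow line `l` is strictly increasing, because `l (v _) > 0` near the centre, and it
vanishes at time `0`. Hence the flow lies on the side of the boundary given by the sign of the time.
-/
lemma eventually_sign_iff {v : E → E} (hv : Continuous v) {Θ : OpenPartialHomeomorph (F × ℝ) E}
    (h0 : (0, 0) ∈ Θ.source)
    (hd : ∀ z ∈ Θ.source, HasDerivAt (fun s => Θ (z.1, s)) (v (Θ z)) z.2) (l : E →L[ℝ] ℝ)
    (hl0 : ∀ z ∈ Θ.source, l (Θ (z.1, 0)) = 0) (hl : 0 < l (v (Θ (0, 0)))) :
    ∀ᶠ z in 𝓝 ((0, 0) : F × ℝ), (0 ≤ l (Θ z) ↔ 0 ≤ z.2) ∧ (l (Θ z) ≤ 0 ↔ z.2 ≤ 0) := by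
  have hc : ContinuousAt (fun z => l (v (Θ z))) (0, 0) :=
    (l.continuous.comp hv).continuousAt.comp (Θ.continuousAt h0)
  obtain ⟨δ, hδ, Hδ⟩ := Metric.eventually_nhds_iff_ball.1
    ((Θ.open_source.eventually_mem h0).and (hc.eventually (lt_mem_nhds hl)))
  filter_upwards [Metric.ball_mem_nhds _ hδ] with z hz
  rw [← ball_prod_same, Real.ball_eq_Ioo, zero_sub, zero_add] at hz Hδ
  have hder : ∀ s ∈ Ioo (-δ) δ, HasDerivAt (fun s => l (Θ (z.1, s))) (l (v (Θ (z.1, s)))) s :=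
    fun s hs => l.hasFDerivAt.comp_hasDerivAt s (hd (z.1, s) (Hδ (z.1, s) ⟨hz.1, hs⟩).1)
  have hmono : StrictMonoOn (fun s => l (Θ (z.1, s))) (Ioo (-δ) δ) := by
    refine strictMonoOn_of_deriv_pos (convex_Ioo _ _)
      (fun s hs => (hder s hs).continuousAt.continuousWithinAt) fun s hs => ?_
    rw [interior_Ioo] at hs
    rw [(hder s hs).deriv]
    exact (Hδ (z.1, s) ⟨hz.1, hs⟩).2
  have h00 : (0 : ℝ) ∈ Ioo (-δ) δ := ⟨by linarith, hδ⟩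
  have e1 := hmono.le_iff_le h00 hz.2
  have e2 := hmono.le_iff_le hz.2 h00
  simp only [hl0 z (Hδ z hz).1, Prod.mk.eta] at e1 e2
  exact ⟨e1, e2⟩

end FlowBox

/-! ### Existence of flow boxes at interior and boundary points. -/

section Existence

open Filter Topology

lemma exists_equiv_of_transverse {n : ℕ} (l : EuclideanSpace ℝ (Fin (n + 1)) →L[ℝ] ℝ)
    (u : EuclideanSpace ℝ (Fin (n + 1))) (hu : l u ≠ 0) :
    ∃ A : (EuclideanSpace ℝ (Fin n) × ℝ) ≃L[ℝ] EuclideanSpace ℝ (Fin (n + 1)),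
      A (0, 1) = u ∧ ∀ y, l (A (y, 0)) = 0 := by
  have hl : (l : EuclideanSpace ℝ (Fin (n + 1)) →ₗ[ℝ] ℝ) ≠ 0 := by
    intro h
    exact hu (by simpa using DFunLike.congr_fun h u)
  have hker : Module.finrank ℝ (EuclideanSpace ℝ (Fin n)) =
      Module.finrank ℝ (LinearMap.ker (l : EuclideanSpace ℝ (Fin (n + 1)) →ₗ[ℝ] ℝ)) := by
    have := Module.Dual.finrank_ker_add_one_of_ne_zero hl
    simp only [finrank_euclideanSpace, Fintype.card_fin] at this ⊢
    omega
  let B := LinearEquiv.ofFinrankEq _ _ hker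
  let f : (EuclideanSpace ℝ (Fin n) × ℝ) →ₗ[ℝ] EuclideanSpace ℝ (Fin (n + 1)) :=
    LinearMap.coprod ((Submodule.subtype _).comp B.toLinearMap) (LinearMap.toSpanSingleton ℝ _ u)
  have hf : ∀ z, f z = (B z.1 : EuclideanSpace ℝ (Fin (n + 1))) + z.2 • u := fun z => rfl
  have hB : ∀ y, l (B y : EuclideanSpace ℝ (Fin (n + 1))) = 0 := fun y => (B y).2
  have hinj : Function.Injective f := by
    rw [injective_iff_map_eq_zero]
    rintro ⟨y, s⟩ h
    rw [hf] at h
    have hs : s = 0 := by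
      have := congrArg l h
      simpa [hB, hu] using this
    subst hs
    simpa using h
  have hdim : Module.finrank ℝ (EuclideanSpace ℝ (Fin n) × ℝ) =
      Module.finrank ℝ (EuclideanSpace ℝ (Fin (n + 1))) := by simp
  refine ⟨(LinearEquiv.ofInjectiveOfFinrankEq f hinj hdim).toContinuousLinearEquiv, ?_, ?_⟩
  · change f (0, 1) = u
    simp [hf]
  · intro y
    change l (f (y, 0)) = 0
    simp [hf, hB]

variable {n : ℕ} {M : Type*} [TopologicalSpace M] [ChartedSpace (EuclideanHalfSpace (n + 1)) M]
  [IsManifold (𝓡∂ (n + 1)) ∞ M] {V : ∀ p : M, TangentSpace (𝓡∂ (n + 1)) p}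

lemma range_model_eq : range (𝓡∂ (n + 1)) =
    {x | 0 ≤ EuclideanSpace.proj (𝕜 := ℝ) (0 : Fin (n + 1)) x} :=
  range_modelWithCornersEuclideanHalfSpace (n + 1)

/-- Near an interior point, a nowhere vanishing vector field has a flow box without boundary. -/
theorem exists_flowBox_interior
    (hV : ContMDiff (𝓡∂ (n + 1)) (𝓡∂ (n + 1)).tangent ∞
      fun p => (⟨p, V p⟩ : TangentBundle (𝓡∂ (n + 1)) M))
    {k : ℕ} (hk : k ≠ 0) {p : M} (hp : (𝓡∂ (n + 1)).IsInteriorPoint p)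
    (hVp : chartField (𝓡∂ (n + 1)) V p (extChartAt (𝓡∂ (n + 1)) p p) ≠ 0) :
    ∃ b : FlowBox (EuclideanSpace ℝ (Fin n)) (𝓡∂ (n + 1)) V k p, b.times = univ := by
  set x₀ := extChartAt (𝓡∂ (n + 1)) p p with hx₀
  have hnh : range (𝓡∂ (n + 1)) ∈ 𝓝 x₀ := mem_interior_iff_mem_nhds.1 hp
  obtain ⟨v, hv, hveq⟩ := exists_contDiffOn_eventuallyEq (R := univ) (mem_univ x₀)
    (((contDiffWithinAt_chartField hV p).of_le (m := k) (by exact_mod_cast le_top)).contDiffAt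
      hnh).contDiffWithinAt
  rw [contDiffOn_univ] at hv
  -- In the interior any hyperplane transverse to `v x₀` will do; its orthogonal complement is one.
  obtain ⟨A, hA, -⟩ := exists_equiv_of_transverse
    (innerSL ℝ (v x₀)) (v x₀) (by simpa [hveq.self_of_nhds] using hVp)
  obtain ⟨Θ, h0, hΘ0, hΘ, hΘ', hd, -⟩ := exists_straightening hk hv x₀ A hA
  refine nonempty_flowBox_of_eventually (hveq.filter_mono nhdsWithin_le_nhds) (Or.inl rfl)
    h0 hΘ0 hΘ hΘ' hd ?_
  have hΘt : Tendsto Θ (𝓝 (0, 0)) (𝓝 x₀) := hΘ0 ▸ Θ.continuousAt h0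
  filter_upwards [hΘt hnh] with z hz
  simpa using hz

lemma extChartAt_zero_eq_zero {p : M} (hp : p ∈ (𝓡∂ (n + 1)).boundary M) :
    extChartAt (𝓡∂ (n + 1)) p p 0 = 0 := by
  have h : extChartAt (𝓡∂ (n + 1)) p p ∈ frontier (range (𝓡∂ (n + 1))) := hp
  rw [frontier_range_modelWithCornersEuclideanHalfSpace] at h
  exact h.symm

/-- Near a boundary point, a transverse vector field has a flow box with boundary. -/
theorem exists_flowBox_boundary
    (hV : ContMDiff (𝓡∂ (n + 1)) (𝓡∂ (n + 1)).tangent ∞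
      fun p => (⟨p, V p⟩ : TangentBundle (𝓡∂ (n + 1)) M))
    {k : ℕ} (hk : k ≠ 0) {p : M} (hp : p ∈ (𝓡∂ (n + 1)).boundary M) {J : Set ℝ}
    (hJ : J = Ici 0 ∧ 0 < chartField (𝓡∂ (n + 1)) V p (extChartAt (𝓡∂ (n + 1)) p p) 0 ∨
      J = Iic 0 ∧ chartField (𝓡∂ (n + 1)) V p (extChartAt (𝓡∂ (n + 1)) p p) 0 < 0) :
    ∃ b : FlowBox (EuclideanSpace ℝ (Fin n)) (𝓡∂ (n + 1)) V k p, b.times = J := by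
  set x₀ := extChartAt (𝓡∂ (n + 1)) p p with hx₀
  have hx₀0 : x₀ 0 = 0 := extChartAt_zero_eq_zero hp
  have hx₀R : x₀ ∈ range (𝓡∂ (n + 1)) := by rw [range_model_eq]; exact hx₀0.ge
  let l : EuclideanSpace ℝ (Fin (n + 1)) →L[ℝ] ℝ := EuclideanSpace.proj (0 : Fin (n + 1))
  have hlw : l (EuclideanSpace.single 0 1) = 1 := by simp [l]
  obtain ⟨v₁, hv₁, hveq₁⟩ := exists_contDiffOn_eventuallyEq hx₀R
    ((contDiffWithinAt_chartField hV p).of_le (m := k) (by exact_mod_cast le_top))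
  rw [range_model_eq] at hv₁
  -- The extended field has a flow on both sides of the boundary. Its values outside the half-space
  -- do not matter, since the box keeps only the times in `J`.
  obtain ⟨v, hv, hveq₂⟩ := exists_contDiff_extension hlw k hv₁
  have hveq : ∀ᶠ x in 𝓝[range (𝓡∂ (n + 1))] x₀, v x = chartField (𝓡∂ (n + 1)) V p x := by
    filter_upwards [hveq₁.filter_mono nhdsWithin_le_nhds, self_mem_nhdsWithin] with x h1 h2
    rw [← h1]
    rw [range_model_eq] at h2
    exact hveq₂ h2
  have hvx₀ : v x₀ = chartField (𝓡∂ (n + 1)) V p x₀ := hveq.self_of_nhdsWithin hx₀R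
  rw [← hvx₀] at hJ
  obtain ⟨A, hA, hlA⟩ := exists_equiv_of_transverse l (v x₀) (by
    rcases hJ with h | h
    · exact h.2.ne'
    · exact h.2.ne)
  obtain ⟨Θ, h0, hΘ0, hΘ, hΘ', hd, hΘA⟩ := exists_straightening hk hv x₀ A hA
  have hl0 : ∀ z ∈ Θ.source, l (Θ (z.1, 0)) = 0 := by
    intro z hz
    rw [hΘA z hz, map_add, hlA, add_zero]
    exact hx₀0
  refine nonempty_flowBox_of_eventually hveq (by tauto) h0 hΘ0 hΘ hΘ' hd ?_
  rcases hJ with ⟨rfl, hpos⟩ | ⟨rfl, hneg⟩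
  · filter_upwards [eventually_sign_iff hv.continuous h0 hd l hl0 (by rw [hΘ0]; exact hpos)]
      with z hz
    rw [range_model_eq]
    exact hz.1
  · filter_upwards [eventually_sign_iff hv.continuous h0 hd (-l) (by simpa using hl0)
      (by rw [hΘ0]; exact neg_pos.2 hneg)] with z hz
    rw [range_model_eq]
    exact neg_nonpos.symm.trans hz.2

end Existence

/-! ### Integral curves in flow boxes: uniqueness, barriers, time reversal. -/

section BoxDynamics

open Filter Topology

variable {E F : Type} [NormedAddCommGroup E] [NormedSpace ℝ E] [NormedAddCommGroup F]
  [NormedSpace ℝ F] {H : Type*} [TopologicalSpace H]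
  {I : ModelWithCorners ℝ E H} {M : Type*} [TopologicalSpace M] [ChartedSpace H M]
  {V : ∀ p : M, TangentSpace I p} {k : ℕ} {p : M}

namespace FlowBox

/-- The range of the time coordinate of a flow box. -/
def interval (b : FlowBox F I V k p) : Set ℝ := Ioo (-b.radius) b.radius ∩ b.times

/-- The domain of the parametrization of a flow box. -/
def dom (b : FlowBox F I V k p) : Set (F × ℝ) := Metric.ball (0 : F) b.radius ×ˢ b.interval

variable (b : FlowBox F I V k p)

lemma convex_interval : Convex ℝ b.interval := by
  refine (convex_Ioo _ _).inter ?_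
  rcases b.times_eq with h | h | h <;> rw [h]
  exacts [convex_univ, convex_Ici _, convex_Iic _]

lemma zero_mem_interval : (0 : ℝ) ∈ b.interval := by
  refine ⟨⟨by linarith [b.radius_pos], b.radius_pos⟩, ?_⟩
  rcases b.times_eq with h | h | h <;> simp [h]

lemma uniqueDiffOn_interval : UniqueDiffOn ℝ b.interval := by
  refine uniqueDiffOn_convex b.convex_interval ?_
  have hr := b.radius_pos
  rw [interval, interior_inter, interior_Ioo]
  rcases b.times_eq with h | h | h <;> rw [h]
  · exact ⟨0, by simp [hr]⟩
  · exact ⟨b.radius / 2, ⟨by linarith, by linarith⟩, by rw [interior_Ici]; exact half_pos hr⟩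
  · exact ⟨-b.radius / 2, ⟨by linarith, by linarith⟩, by
      rw [interior_Iic]; exact div_neg_of_neg_of_pos (neg_neg_of_pos hr) two_pos⟩

lemma chart_mem_dom {q : M} (hq : q ∈ b.source) : b.chart q ∈ b.dom := b.chart_mem q hq

lemma fst_mem_dom {z : F × ℝ} (hz : z ∈ b.dom) : (z.1, (0 : ℝ)) ∈ b.dom :=
  ⟨hz.1, b.zero_mem_interval⟩

lemma mfderiv_chart_apply (hk : k ≠ 0) {q : M} (hq : q ∈ b.source) :
    mfderiv I 𝓘(ℝ, F × ℝ) b.chart q (V q) = ((0, 1) : F × ℝ) := by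
  obtain ⟨hy, hs⟩ := b.chart_mem_dom hq
  set y := (b.chart q).1
  set s := (b.chart q).2
  have hcs : b.param (y, s) = q := b.param_chart q hq
  have hd : MDifferentiableAt I 𝓘(ℝ, F × ℝ) b.chart q :=
    ((b.contMDiffOn_chart q hq).contMDiffAt (b.isOpen_source.mem_nhds hq)).mdifferentiableAt
      (by exact_mod_cast hk)
  have h1 : HasMFDerivWithinAt 𝓘(ℝ, ℝ) I (fun s => b.param (y, s)) b.interval s _ :=
    b.isMIntegralCurveOn y hy s hs
  have h2 : HasMFDerivWithinAt I 𝓘(ℝ, F × ℝ) b.chart univ (b.param (y, s))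
      (mfderiv I 𝓘(ℝ, F × ℝ) b.chart (b.param (y, s))) := by
    rw [hcs]; exact hd.hasMFDerivAt.hasMFDerivWithinAt
  let D : E →L[ℝ] F × ℝ := mfderiv I 𝓘(ℝ, F × ℝ) b.chart (b.param (y, s))
  let w : E := V (b.param (y, s))
  have h3 : HasFDerivWithinAt (b.chart ∘ fun s => b.param (y, s))
      (D.comp ((1 : ℝ →L[ℝ] ℝ).smulRight w)) b.interval s :=
    (HasMFDerivWithinAt.comp s h2 h1 (fun _ _ => mem_univ _)).hasFDerivWithinAt
  have h4 : HasFDerivWithinAt (b.chart ∘ fun s => b.param (y, s))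
      (ContinuousLinearMap.inr ℝ F ℝ) b.interval s := by
    refine (hasFDerivAt_prodMk_right y s).hasFDerivWithinAt.congr (fun t ht => ?_) ?_
    · exact b.chart_param (y, t) ⟨hy, ht⟩
    · exact b.chart_param (y, s) ⟨hy, hs⟩
  have h5 := DFunLike.congr_fun ((b.uniqueDiffOn_interval s hs).eq h3 h4) 1
  have h6 : D w = ((0, 1) : F × ℝ) := by simpa using h5
  rw [← hcs]
  exact h6

lemma hasDerivWithinAt_chart_comp (hk : k ≠ 0) {γ : ℝ → M} {T : Set ℝ}
    (hγ : IsMIntegralCurveOn γ V T) {t : ℝ} (ht : t ∈ T) (hs : γ t ∈ b.source) :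
    HasDerivWithinAt (b.chart ∘ γ) (0, 1) T t := by
  have hd : MDifferentiableAt I 𝓘(ℝ, F × ℝ) b.chart (γ t) :=
    ((b.contMDiffOn_chart _ hs).contMDiffAt (b.isOpen_source.mem_nhds hs)).mdifferentiableAt
      (by exact_mod_cast hk)
  let D : E →L[ℝ] F × ℝ := mfderiv I 𝓘(ℝ, F × ℝ) b.chart (γ t)
  let w : E := V (γ t)
  have h : HasFDerivWithinAt (b.chart ∘ γ) (D.comp ((1 : ℝ →L[ℝ] ℝ).smulRight w)) T t :=
    (HasMFDerivWithinAt.comp t (hd.hasMFDerivAt.hasMFDerivWithinAt (s := univ)) (hγ t ht)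
      (fun _ _ => mem_univ _)).hasFDerivWithinAt
  have hw : D w = ((0, 1) : F × ℝ) := b.mfderiv_chart_apply hk hs
  have h' := h.hasDerivWithinAt
  simpa [hw] using h'

/-- In box coordinates the field is `(0, 1)`, so the coordinates of the curve minus `(0, t)` have
zero derivative on the convex set `T`. -/
lemma chart_comp_eq (hk : k ≠ 0) {γ : ℝ → M} {T : Set ℝ} (hT : Convex ℝ T)
    (hγ : IsMIntegralCurveOn γ V T) (hs : MapsTo γ T b.source) {t₀ t : ℝ} (ht₀ : t₀ ∈ T)
    (ht : t ∈ T) : b.chart (γ t) = b.chart (γ t₀) + (0, t - t₀) := by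
  have h := hT.norm_image_sub_le_of_norm_hasDerivWithin_le (C := 0)
    (f := fun t => b.chart (γ t) - (0, t)) (f' := fun _ => 0) (fun t ht => by
      have h1 := (b.hasDerivWithinAt_chart_comp hk hγ ht (hs ht)).sub
        (((hasDerivAt_const t (0 : F)).prodMk (hasDerivAt_id t)).hasDerivWithinAt (s := T))
      rw [sub_self] at h1
      exact h1) (fun _ _ => by simp) ht₀ ht
  rw [zero_mul, norm_le_zero_iff, sub_eq_zero, sub_eq_iff_eq_add] at h
  rw [h]
  ext <;> simp [sub_add_eq_add_sub, add_sub_assoc]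

end FlowBox

/-- Integral curves are determined by one value, if there are flow boxes. -/
theorem eqOn_of_isMIntegralCurveOn [T2Space M] (hk : k ≠ 0)
    (hbox : ∀ p, Nonempty (FlowBox F I V k p)) {γ η : ℝ → M} {T : Set ℝ} (hT : Convex ℝ T)
    (hγ : IsMIntegralCurveOn γ V T) (hη : IsMIntegralCurveOn η V T) {t₀ : ℝ} (ht₀ : t₀ ∈ T)
    (h₀ : γ t₀ = η t₀) : EqOn γ η T := by
  intro t ht
  -- Agreement is relatively open by the box coordinates, disagreement by the Hausdorff property,
  -- and `T` is connected.
  refine (hT.isPreconnected.induction₂ (fun t t' => γ t = η t ↔ γ t' = η t') ?_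
    (fun _ _ _ _ _ _ h h' => h.trans h') (fun _ _ _ _ h => h.symm) ht₀ ht).1 h₀
  intro t ht
  by_cases h : γ t = η t
  · obtain ⟨b⟩ := hbox (γ t)
    have hN := b.isOpen_source.mem_nhds b.mem_source
    have h1 := (hγ.continuousWithinAt ht).eventually hN
    have h2 := (hη.continuousWithinAt ht).eventually (show b.source ∈ 𝓝 (η t) from h ▸ hN)
    obtain ⟨ε, hε, Hε⟩ := Metric.mem_nhdsWithin_iff.1 (h1.and h2)
    filter_upwards [inter_mem_nhdsWithin T (Metric.ball_mem_nhds t hε)] with t' ht'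
    have hsub : T ∩ Metric.ball t ε ⊆ T := inter_subset_left
    have hc := hT.inter (convex_ball t ε)
    have htt : t ∈ T ∩ Metric.ball t ε := ⟨ht, Metric.mem_ball_self hε⟩
    have e1 := b.chart_comp_eq hk hc (hγ.mono hsub) (fun x hx => (Hε hx.symm).1) htt ht'
    have e2 := b.chart_comp_eq hk hc (hη.mono hsub) (fun x hx => (Hε hx.symm).2) htt ht'
    have e3 := congrArg b.param (e1.trans ((congrArg (b.chart · + (0, t' - t)) h).trans e2.symm))
    rw [b.param_chart _ (Hε ht'.symm).1, b.param_chart _ (Hε ht'.symm).2] at e3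
    exact ⟨fun _ => e3, fun _ => h⟩
  · have := ((hγ.continuousWithinAt ht).prodMk (hη.continuousWithinAt ht)).eventually
      (isOpen_ne_fun continuous_fst continuous_snd |>.mem_nhds h)
    filter_upwards [this] with t' ht'
    exact ⟨fun h' => absurd h' h, fun h' => absurd h' ht'⟩

variable [T2Space M]

namespace FlowBox

variable (b : FlowBox F I V k p)

/-- The curve is not assumed to remain in the box: uniqueness forces it to follow the box line
through `γ t₁` for as long as that line and the curve both exist. -/
lemma eq_param (hk : k ≠ 0) (hbox : ∀ p, Nonempty (FlowBox F I V k p)) {γ : ℝ → M} {T : Set ℝ}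
    (hT : Convex ℝ T) (hγ : IsMIntegralCurveOn γ V T) {t₁ t : ℝ} (ht₁ : t₁ ∈ T) (ht : t ∈ T)
    (hs : γ t₁ ∈ b.source) (h : (b.chart (γ t₁)).2 + (t - t₁) ∈ b.interval) :
    γ t = b.param ((b.chart (γ t₁)).1, (b.chart (γ t₁)).2 + (t - t₁)) := by
  obtain ⟨hy, hs₁⟩ := b.chart_mem_dom hs
  set y := (b.chart (γ t₁)).1 with hy'
  set s := (b.chart (γ t₁)).2 with hs'
  have h1 : IsMIntegralCurveOn ((fun s => b.param (y, s)) ∘ (· + (s - t₁))) V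
      {t | t + (s - t₁) ∈ b.interval} :=
    IsMIntegralCurveOn.comp_add (b.isMIntegralCurveOn y hy) (s - t₁)
  have hc : Convex ℝ {t | t + (s - t₁) ∈ b.interval} := by
    have := b.convex_interval.translate_preimage_left (s - t₁)
    exact this
  have hmem : ∀ t, s + (t - t₁) ∈ b.interval ↔ t ∈ {t | t + (s - t₁) ∈ b.interval} := by
    intro t
    rw [mem_ofPred_eq, show t + (s - t₁) = s + (t - t₁) by ring]
  have h2 := eqOn_of_isMIntegralCurveOn hk hbox (hT.inter hc) (hγ.mono inter_subset_left)
    (h1.mono inter_subset_right) (t₀ := t₁) ⟨ht₁, (hmem t₁).1 (by simpa using hs₁)⟩ (by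
      have : t₁ + (s - t₁) = s := by ring
      simp only [Function.comp_apply, this]
      exact (b.param_chart _ hs).symm)
  rw [h2 ⟨ht, (hmem t).1 h⟩, Function.comp_apply]
  congr 2
  ring

/-- A curve that meets a flow box at the initial boundary cannot have existed for long. -/
lemma sub_le_of_times_eq_Ici (hk : k ≠ 0) (hbox : ∀ p, Nonempty (FlowBox F I V k p))
    (hb : b.times = Ici 0) {γ : ℝ → M} {a c t₁ : ℝ} (hγ : IsMIntegralCurveOn γ V (Icc a c))
    (ht₁ : t₁ ∈ Icc a c) (hs : γ t₁ ∈ b.source) : t₁ - a ≤ (b.chart (γ t₁)).2 := by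
  by_contra! hlt
  obtain ⟨hy, hs₁⟩ := b.chart_mem_dom hs
  set s := (b.chart (γ t₁)).2 with hs'
  have hs0 : 0 ≤ s := by have := hs₁.2; rwa [hb] at this
  have ht₂ : t₁ - s ∈ Icc a c := ⟨by linarith, by linarith [ht₁.2]⟩
  have h1 := b.eq_param hk hbox (convex_Icc a c) hγ ht₁ ht₂ hs
    (by rw [← hs']; simpa using b.zero_mem_interval)
  rw [← hs', show s + (t₁ - s - t₁) = 0 by ring] at h1
  have h0 : ((b.chart (γ t₁)).1, (0 : ℝ)) ∈ b.dom := ⟨hy, b.zero_mem_interval⟩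
  have h2 : γ (t₁ - s) ∈ b.source := h1 ▸ b.param_mem _ h0
  have h3 := (hγ.continuousWithinAt ht₂).eventually (b.isOpen_source.mem_nhds h2)
  obtain ⟨ε, hε, Hε⟩ := Metric.mem_nhdsWithin_iff.1 h3
  -- At `t₁ - s` the curve is on the slice of time `0`. If it had existed earlier, then at `t'` it
  -- would still be in the box but with negative time coordinate.
  set t' := max a (t₁ - s - ε / 2) with ht'
  have ht'lt : t' < t₁ - s := max_lt (by linarith) (by linarith)
  have ht'ge : t₁ - s - ε / 2 ≤ t' := le_max_right _ _
  have ht'm : t' ∈ Icc a c := ⟨le_max_left _ _, by linarith [ht₂.2]⟩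
  have hb' : t' ∈ Metric.ball (t₁ - s) ε := by
    rw [Metric.mem_ball, Real.dist_eq, abs_lt]; constructor <;> linarith
  have h4 := b.chart_comp_eq hk ((convex_ball (t₁ - s) ε).inter (convex_Icc a c))
    (hγ.mono inter_subset_right) Hε ⟨Metric.mem_ball_self hε, ht₂⟩ ⟨hb', ht'm⟩
  have h5 := (b.chart_mem_dom (Hε ⟨hb', ht'm⟩)).2.2
  rw [h4, h1, b.chart_param _ h0, hb] at h5
  simp only [Prod.mk_add_mk, zero_add, mem_Ici] at h5
  linarith

/-- The flow box of the opposite vector field. -/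
def neg (b : FlowBox F I V k p) : FlowBox F I (fun q => -V q) k p where
  radius := b.radius
  radius_pos := b.radius_pos
  times := -b.times
  times_eq := by rcases b.times_eq with h | h | h <;> simp [h]
  chart := fun q => ((b.chart q).1, -(b.chart q).2)
  param := fun z => b.param (z.1, -z.2)
  source := b.source
  isOpen_source := b.isOpen_source
  mem_source := b.mem_source
  chart_mem := fun q hq => by
    obtain ⟨h1, h2, h3⟩ := b.chart_mem q hq
    exact ⟨h1, ⟨by linarith [h2.2], by linarith [h2.1]⟩, by simpa using h3⟩
  param_mem := fun z hz => b.param_mem _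
    ⟨hz.1, ⟨by linarith [hz.2.1.2], by linarith [hz.2.1.1]⟩, hz.2.2⟩
  param_chart := fun q hq => by simpa using b.param_chart q hq
  chart_param := fun z hz => by
    have hz' : (z.1, -z.2) ∈ b.dom :=
      ⟨hz.1, ⟨by linarith [hz.2.1.2], by linarith [hz.2.1.1]⟩, hz.2.2⟩
    simp [b.chart_param _ hz']
  chart_center := by simp [b.chart_center]
  contMDiffOn_chart := by
    have h : ContDiff ℝ k fun z : F × ℝ => (z.1, -z.2) := contDiff_fst.prodMk contDiff_snd.neg
    exact h.contMDiff.comp_contMDiffOn b.contMDiffOn_chart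
  contMDiffOn_param := by
    have h : ContDiff ℝ k fun z : F × ℝ => (z.1, -z.2) := contDiff_fst.prodMk contDiff_snd.neg
    refine b.contMDiffOn_param.comp h.contMDiff.contMDiffOn fun z hz => ?_
    exact ⟨hz.1, ⟨by linarith [hz.2.1.2], by linarith [hz.2.1.1]⟩, hz.2.2⟩
  isMIntegralCurveOn := fun y hy => by
    have h := (b.isMIntegralCurveOn y hy).comp_mul (-1)
    convert! h using 1
    · ext s; simp
    · ext q; simp
    · ext s
      simp only [mem_inter_iff, mem_Ioo, mem_ofPred_eq, mul_neg, mul_one, Set.mem_neg]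
      constructor
      · rintro ⟨⟨h1, h2⟩, h3⟩; exact ⟨⟨by linarith, by linarith⟩, h3⟩
      · rintro ⟨⟨h1, h2⟩, h3⟩; exact ⟨⟨by linarith, by linarith⟩, h3⟩

end FlowBox

end BoxDynamics

/-! ### Reachability along integral curves, and the absence of trapping. -/

section Reach

open Filter Topology

variable {E F : Type} [NormedAddCommGroup E] [NormedSpace ℝ E] [NormedAddCommGroup F]
  [NormedSpace ℝ F] {H : Type*} [TopologicalSpace H]
  {I : ModelWithCorners ℝ E H} {M : Type*} [TopologicalSpace M] [ChartedSpace H M]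

/-- The point `q` lies on an integral curve of `V` issuing from `p`, at the time `t ≥ 0`. -/
def Reach (V : ∀ p : M, TangentSpace I p) (p : M) (t : ℝ) (q : M) : Prop :=
  0 ≤ t ∧ ∃ γ : ℝ → M, IsMIntegralCurveOn γ V (Icc 0 t) ∧ γ 0 = p ∧ γ t = q

variable {V : ∀ p : M, TangentSpace I p} {p q r : M} {s t : ℝ}

lemma reach_of_isMIntegralCurveOn {γ : ℝ → M} {a c : ℝ} (hγ : IsMIntegralCurveOn γ V (Icc a c))
    (hac : a ≤ c) : Reach V (γ a) (c - a) (γ c) := by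
  refine ⟨sub_nonneg.2 hac, γ ∘ (· + a), (hγ.comp_add a).mono fun t ht => ?_, by simp, by simp⟩
  exact ⟨by simpa using ht.1, by simpa [le_sub_iff_add_le] using ht.2⟩

lemma Reach.refl (V : ∀ p : M, TangentSpace I p) (p : M) : Reach V p 0 p := by
  refine ⟨le_rfl, fun _ => p, fun t ht => ?_, rfl, rfl⟩
  rw [Icc_self] at ht ⊢
  obtain rfl := mem_singleton_iff.1 ht
  refine ⟨(continuousWithinAt_const : ContinuousWithinAt (fun _ : ℝ => p) _ _), ?_⟩
  simp only [writtenInExtChartAt, extChartAt_model_space_eq_id, PartialEquiv.refl_symm,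
    PartialEquiv.refl_coe, preimage_id, ModelWithCorners.range_eq_univ, inter_univ, id_eq]
  -- On the degenerate interval `[0, 0]` every linear map is a derivative, so a constant curve is an
  -- integral curve there.
  exact HasFDerivWithinAt.of_subsingleton (E := ℝ) (F := E) subsingleton_singleton

lemma isMIntegralCurveOn_ite {γ η : ℝ → M} {a b c : ℝ} (hab : a ≤ b) (hbc : b ≤ c)
    (hγ : IsMIntegralCurveOn γ V (Icc a b)) (hη : IsMIntegralCurveOn η V (Icc b c))
    (h : γ b = η b) :
    IsMIntegralCurveOn (fun t => if t ≤ b then γ t else η t) V (Icc a c) := by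
  set f : ℝ → M := fun t => if t ≤ b then γ t else η t with hf
  have hf1 : ∀ t ∈ Icc a b, f t = γ t := fun t ht => if_pos ht.2
  have hf2 : ∀ t ∈ Icc b c, f t = η t := by
    intro t ht
    rcases ht.1.eq_or_lt with rfl | hlt
    · rw [hf1 b ⟨hab, le_rfl⟩, h]
    · exact if_neg hlt.not_ge
  have h1 : IsMIntegralCurveOn f V (Icc a b) := fun t ht => by
    rw [hf1 t ht]
    exact HasMFDerivWithinAt.congr_mono (hγ t ht) hf1 (hf1 t ht) Subset.rfl
  have h2 : IsMIntegralCurveOn f V (Icc b c) := fun t ht => by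
    rw [hf2 t ht]
    exact HasMFDerivWithinAt.congr_mono (hη t ht) hf2 (hf2 t ht) Subset.rfl
  rw [← Icc_union_Icc_eq_Icc hab hbc]
  -- At a common point the derivatives within both sets combine. At a point outside the closed set
  -- `s'`, the union looks locally like `s`.
  have key : ∀ {s s' : Set ℝ} {t : ℝ}, IsClosed s' → IsMIntegralCurveOn f V s →
      IsMIntegralCurveOn f V s' → t ∈ s →
      HasMFDerivWithinAt 𝓘(ℝ, ℝ) I f (s ∪ s') t ((1 : ℝ →L[ℝ] ℝ).smulRight (V (f t))) := by
    intro s s' t hs' h1 h2 ht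
    by_cases ht' : t ∈ s'
    · exact (h1 t ht).union (h2 t ht')
    · refine (h1 t ht).mono_of_mem_nhdsWithin ?_
      rw [mem_nhdsWithin_iff_eventually]
      filter_upwards [hs'.isOpen_compl.mem_nhds ht'] with x hx hx'
      exact hx'.resolve_right hx
  rintro t (ht | ht)
  · exact key isClosed_Icc h1 h2 ht
  · rw [union_comm]
    exact key isClosed_Icc h2 h1 ht

lemma Reach.trans (h : Reach V p s q) (h' : Reach V q t r) : Reach V p (s + t) r := by
  obtain ⟨hs, γ, hγ, hγ0, hγs⟩ := h
  obtain ⟨ht, η, hη, hη0, hηt⟩ := h'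
  have hη' : IsMIntegralCurveOn (η ∘ (· + -s)) V (Icc s (s + t)) :=
    (hη.comp_add (-s)).mono fun x hx => by
      rw [mem_ofPred_eq, ← sub_eq_add_neg]
      exact ⟨sub_nonneg.2 hx.1, sub_le_iff_le_add'.2 hx.2⟩
  refine ⟨add_nonneg hs ht, _, isMIntegralCurveOn_ite hs (by linarith) hγ hη' ?_, ?_, ?_⟩
  · simp [hγs, hη0]
  · simp [hs, hγ0]
  -- If the second curve has length `0`, the end point is still given by the first branch.
  · rcases ht.eq_or_lt with rfl | ht'
    · simp [hγs, ← hηt, hη0]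
    · simp [ht'.not_ge, hηt]

lemma Reach.exists_split (h : Reach V p t q) (hs : 0 ≤ s) (hst : s ≤ t) :
    ∃ r, Reach V p s r ∧ Reach V r (t - s) q := by
  obtain ⟨ht, γ, hγ, hγ0, hγt⟩ := h
  refine ⟨γ s, ⟨hs, γ, hγ.mono (Icc_subset_Icc_right hst), hγ0, rfl⟩, ?_⟩
  rw [← hγt]
  exact reach_of_isMIntegralCurveOn (hγ.mono (Icc_subset_Icc_left hs)) hst

lemma Reach.neg (h : Reach V p t q) : Reach (fun x => -V x) q t p := by
  obtain ⟨ht, γ, hγ, hγ0, hγt⟩ := h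
  refine ⟨ht, γ ∘ (t - ·), ?_, by simp [hγt], by simp [hγ0]⟩
  have h1 : IsMIntegralCurveOn (γ ∘ (t - ·)) (fun x => -V x)
      {x | x + -t ∈ {y | y * -1 ∈ Icc 0 t}} := by
    convert! (hγ.comp_mul (-1)).comp_add (-t) using 1
    · ext x
      simp [sub_eq_add_neg]
    · ext x
      simp
  refine h1.mono fun x hx => ?_
  simp only [mem_ofPred_eq, mem_Icc] at hx ⊢
  constructor <;> linarith [hx.1, hx.2]

lemma reach_neg_iff : Reach (fun x => -V x) q t p ↔ Reach V p t q :=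
  ⟨fun h => by simpa using h.neg, Reach.neg⟩

variable [T2Space M] {k : ℕ}

lemma Reach.eq_right (hk : k ≠ 0) (hbox : ∀ p, Nonempty (FlowBox F I V k p))
    (h : Reach V p t q) (h' : Reach V p t r) : q = r := by
  obtain ⟨ht, γ, hγ, hγ0, hγt⟩ := h
  obtain ⟨-, η, hη, hη0, hηt⟩ := h'
  rw [← hγt, ← hηt]
  exact eqOn_of_isMIntegralCurveOn hk hbox (convex_Icc 0 t) hγ hη (left_mem_Icc.2 ht)
    (hγ0.trans hη0.symm) (right_mem_Icc.2 ht)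

lemma Reach.eq_left (hk : k ≠ 0) (hbox : ∀ p, Nonempty (FlowBox F I V k p))
    (h : Reach V p t r) (h' : Reach V q t r) : p = q :=
  h.neg.eq_right (F := F) hk (fun p => (hbox p).map FlowBox.neg) h'.neg

namespace FlowBox

variable (b : FlowBox F I V k p)

omit [T2Space M] in
lemma reach_param {y : F} {s s' : ℝ} (hs : (y, s) ∈ b.dom) (hs' : (y, s') ∈ b.dom)
    (hss' : s ≤ s') : Reach V (b.param (y, s)) (s' - s) (b.param (y, s')) :=
  reach_of_isMIntegralCurveOn ((b.isMIntegralCurveOn y hs.1).mono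
    (b.convex_interval.ordConnected.out hs.2 hs'.2)) hss'

/-- An entrance box is a barrier to the past: the time coordinate bounds the age of any curve that
arrives in it. -/
lemma le_chart_of_reach (hk : k ≠ 0) (hbox : ∀ p, Nonempty (FlowBox F I V k p))
    (hb : b.times = Ici 0) (h : Reach V r t q) (hq : q ∈ b.source) : t ≤ (b.chart q).2 := by
  obtain ⟨ht, γ, hγ, hγ0, rfl⟩ := h
  simpa using b.sub_le_of_times_eq_Ici hk hbox hb hγ (right_mem_Icc.2 ht) hq

lemma le_neg_chart_of_reach (hk : k ≠ 0) (hbox : ∀ p, Nonempty (FlowBox F I V k p))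
    (hb : b.times = Iic 0) (h : Reach V q t r) (hq : q ∈ b.source) : t ≤ -(b.chart q).2 :=
  b.neg.le_chart_of_reach hk (fun p => (hbox p).map FlowBox.neg)
    (by change -b.times = _; simp [hb]) h.neg hq

end FlowBox

variable (F) in
/-- A vector field on `M` that enters through `A₁`, leaves through `A₂`, is straightened by flow
boxes of any finite order of smoothness, and whose integral curves are not trapped: each one
lies in a compact set and none returns near an interior point. -/
structure IsCrossingField (V : ∀ p : M, TangentSpace I p) (A₁ A₂ : Set M) : Prop where
  exists_box : ∀ k : ℕ, k ≠ 0 → ∀ p, ∃ b : FlowBox F I V k p,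
    (p ∈ A₁ → b.times = Ici 0) ∧ (p ∈ A₂ → b.times = Iic 0) ∧
      (p ∉ A₁ → p ∉ A₂ → b.times = univ)
  exists_compact : ∀ p, ∃ K : Set M, IsCompact K ∧
    ∀ t q, Reach V p t q ∨ Reach V q t p → q ∈ K
  exists_nhds_not_return : ∀ q, q ∉ A₁ → q ∉ A₂ → ∃ N ∈ 𝓝 q, ∃ τ : ℝ,
    ∀ t r r', τ ≤ t → Reach V r t r' → r ∈ N → r' ∉ N

namespace IsCrossingField

variable {A₁ A₂ : Set M}

omit [T2Space M] in
lemma neg (h : IsCrossingField F V A₁ A₂) : IsCrossingField F (fun q => -V q) A₂ A₁ where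
  exists_box := fun k hk p => by
    obtain ⟨b, h1, h2, h3⟩ := h.exists_box k hk p
    have e : b.neg.times = -b.times := rfl
    refine ⟨b.neg, fun hp => ?_, fun hp => ?_, fun hp hp' => ?_⟩
    · simp [e, h2 hp]
    · simp [e, h1 hp]
    · simp [e, h3 hp' hp]
  exists_compact := fun p => by
    obtain ⟨K, hK, hKp⟩ := h.exists_compact p
    exact ⟨K, hK, fun t q hq => hKp t q (by rwa [reach_neg_iff, reach_neg_iff, or_comm] at hq)⟩
  exists_nhds_not_return := fun q hq₂ hq₁ => by
    obtain ⟨N, hN, τ, hτ⟩ := h.exists_nhds_not_return q hq₁ hq₂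
    exact ⟨N, hN, τ, fun t r r' ht hr hrN hr'N =>
      hτ t r' r ht (reach_neg_iff.1 hr) hr'N hrN⟩

omit [T2Space M] in
lemma nonempty_flowBox (h : IsCrossingField F V A₁ A₂) {k : ℕ} (hk : k ≠ 0) (p : M) :
    Nonempty (FlowBox F I V k p) := ⟨(h.exists_box k hk p).choose⟩

/-- If the time coordinate of a flow box is not positive, all points of it exit. -/
lemma exists_exit_of_times_eq_Iic (h : IsCrossingField F V A₁ A₂) {q r : M}
    (b : FlowBox F I V 1 q) (hb : b.times = Iic 0) (hr : r ∈ b.source) :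
    ∃ t, ∃ z ∈ A₂, Reach V r t z := by
  have hbox := h.nonempty_flowBox one_ne_zero
  have hd := b.chart_mem_dom hr
  set y := (b.chart r).1 with hy
  set s := (b.chart r).2 with hs
  have hs0 : s ≤ 0 := by have := hd.2.2; rwa [hb] at this
  have h1 : Reach V r (0 - s) (b.param (y, 0)) := by
    have := b.reach_param (y := y) hd (b.fst_mem_dom hd) hs0
    rwa [show b.param (y, s) = r from b.param_chart r hr] at this
  refine ⟨_, b.param (y, 0), ?_, h1⟩
  -- Outside `A₂`, a box at the end point would allow times beyond `0`, prolonging the curve past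
  -- the bound `-s` on the remaining time.
  by_contra hz
  obtain ⟨b', h1', -, h3'⟩ := h.exists_box 1 one_ne_zero (b.param (y, 0))
  have hpos : Ici 0 ⊆ b'.times := by
    by_cases hz₁ : b.param (y, 0) ∈ A₁
    · rw [h1' hz₁]
    · rw [h3' hz₁ hz]; exact subset_univ _
  have hr' := b'.radius_pos
  have hc := b'.chart_mem_dom b'.mem_source
  rw [b'.chart_center] at hc
  have hc' : ((0 : F), b'.radius / 2) ∈ b'.dom :=
    ⟨hc.1, ⟨by linarith, by linarith⟩, hpos (half_pos hr').le⟩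
  have h2 := b'.reach_param hc hc' (by linarith)
  rw [← b'.chart_center, b'.param_chart _ b'.mem_source] at h2
  have := b.le_neg_chart_of_reach one_ne_zero hbox hb (h1.trans h2) hr
  linarith

/-- If the times are not `Iic 0`, points near the centre can advance by a quarter of the radius
without leaving the box. -/
lemma exists_nhds_exit_or_advance (h : IsCrossingField F V A₁ A₂) (q : M) :
    ∃ N ∈ 𝓝 q, ∃ ε > 0, ∀ r ∈ N,
      (∃ t, ∃ z ∈ A₂, Reach V r t z) ∨ ∃ r', Reach V r ε r' := by
  obtain ⟨b, -⟩ := h.exists_box 1 one_ne_zero q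
  have hr := b.radius_pos
  by_cases hb : b.times = Iic 0
  · exact ⟨b.source, b.isOpen_source.mem_nhds b.mem_source, 1, one_pos,
      fun r hr => Or.inl (h.exists_exit_of_times_eq_Iic b hb hr)⟩
  have hc : ContinuousAt b.chart q :=
    b.contMDiffOn_chart.continuousOn.continuousAt (b.isOpen_source.mem_nhds b.mem_source)
  have hN : ∀ᶠ r in 𝓝 q, r ∈ b.source ∧ (b.chart r).2 < b.radius / 2 := by
    refine (b.isOpen_source.eventually_mem b.mem_source).and ?_
    refine (continuous_snd.continuousAt.comp hc).eventually (gt_mem_nhds ?_)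
    simp only [Function.comp_apply, b.chart_center]
    linarith
  refine ⟨_, hN, b.radius / 4, by linarith, ?_⟩
  rintro r ⟨hrs, hrlt⟩
  right
  have hd := b.chart_mem_dom hrs
  have hd' : ((b.chart r).1, (b.chart r).2 + b.radius / 4) ∈ b.dom := by
    refine ⟨hd.1, ⟨by linarith [hd.2.1.1], by linarith⟩, ?_⟩
    rcases b.times_eq with h1 | h1 | h1
    · rw [h1]; exact mem_univ _
    · have := hd.2.2
      rw [h1, mem_Ici] at this ⊢
      linarith
    · exact absurd h1 hb
  have := b.reach_param hd hd' (by linarith)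
  rw [Prod.mk.eta, b.param_chart r hrs, add_sub_cancel_left] at this
  exact ⟨_, this⟩

/-- Every point flows to the exit set in finite time. -/
theorem exists_exit (h : IsCrossingField F V A₁ A₂) (p : M) : ∃ t, ∃ z ∈ A₂, Reach V p t z := by
  by_contra hp
  have hbox := h.nonempty_flowBox one_ne_zero
  obtain ⟨K, hK, hKp⟩ := h.exists_compact p
  obtain ⟨ε, hε, Hε⟩ : ∃ ε > 0, ∀ r ∈ K,
      (∃ t, ∃ z ∈ A₂, Reach V r t z) ∨ ∃ r', Reach V r ε r' := by
    -- Compactness makes the step length uniform on `K`. A curve that never exits can then be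
    -- continued by `ε` indefinitely, because it stays in `K`.
    refine hK.induction_on (p := fun S => ∃ ε > 0, ∀ r ∈ S,
      (∃ t, ∃ z ∈ A₂, Reach V r t z) ∨ ∃ r', Reach V r ε r') ⟨1, one_pos, by simp⟩ ?_ ?_ ?_
    · rintro S S' hS ⟨ε, hε, H⟩
      exact ⟨ε, hε, fun r hr => H r (hS hr)⟩
    · rintro S S' ⟨ε, hε, H⟩ ⟨ε', hε', H'⟩
      refine ⟨min ε ε', lt_min hε hε', ?_⟩
      rintro r (hr | hr)
      · refine (H r hr).imp_right ?_
        rintro ⟨r', hr'⟩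
        exact ⟨_, (hr'.exists_split (lt_min hε hε').le (min_le_left _ _)).choose_spec.1⟩
      · refine (H' r hr).imp_right ?_
        rintro ⟨r', hr'⟩
        exact ⟨_, (hr'.exists_split (lt_min hε hε').le (min_le_right _ _)).choose_spec.1⟩
    · intro q _
      obtain ⟨N, hN, ε, hε, H⟩ := h.exists_nhds_exit_or_advance q
      exact ⟨N, mem_nhdsWithin_of_mem_nhds hN, ε, hε, H⟩
  have hstep : ∀ z : {r : M // ∃ t, Reach V p t r}, ∃ z' : {r : M // ∃ t, Reach V p t r},
      Reach V z.1 ε z'.1 := by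
    rintro ⟨r, t, hr⟩
    rcases Hε r (hKp t r (Or.inl hr)) with ⟨t', z, hz, hrz⟩ | ⟨r', hr'⟩
    · exact absurd ⟨_, z, hz, hr.trans hrz⟩ hp
    · exact ⟨⟨r', _, hr.trans hr'⟩, hr'⟩
  choose next hnext using hstep
  let u : ℕ → {r : M // ∃ t, Reach V p t r} := fun m => next^[m] ⟨p, 0, Reach.refl V p⟩
  have hu : ∀ m, Reach V (u m).1 ε (u (m + 1)).1 := by
    intro m
    have : u (m + 1) = next (u m) := Function.iterate_succ_apply' next m _
    rw [this]
    exact hnext _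
  have hreach : ∀ i j : ℕ, Reach V (u i).1 (j * ε) (u (i + j)).1 := by
    intro i j
    induction j with
    | zero => simpa using Reach.refl V (u i).1
    | succ j ih =>
      have := ih.trans (hu (i + j))
      rw [show (j : ℝ) * ε + ε = ((j + 1 : ℕ) : ℝ) * ε by push_cast; ring] at this
      exact this
  have huK : ∀ m, (u m).1 ∈ K := fun m => hKp _ _ (Or.inl (u m).2.choose_spec)
  obtain ⟨q, -, hq⟩ := hK.exists_mapClusterPt (f := atTop) (u := fun m => (u m).1)
    (tendsto_principal.2 (Eventually.of_forall huK))
  have hfreq : ∀ N ∈ 𝓝 q, ∀ m₀ : ℕ, ∃ m ≥ m₀, (u m).1 ∈ N := fun N hN m₀ =>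
    frequently_atTop.1 (hq.frequently hN) m₀
  -- Near an entrance point the age of a curve is less than the radius, and near an exit point so is
  -- its remaining time. Both contradict arbitrarily long curves, and for other `q` the returns are
  -- too late.
  obtain ⟨b, hb1, hb2, -⟩ := h.exists_box 1 one_ne_zero q
  have hbs := b.isOpen_source.mem_nhds b.mem_source
  by_cases hq₁ : q ∈ A₁
  · obtain ⟨m₀, hm₀⟩ := exists_nat_gt (b.radius / ε)
    obtain ⟨m, hm, hmN⟩ := hfreq _ hbs m₀
    have h1 := b.le_chart_of_reach one_ne_zero hbox (hb1 hq₁) (zero_add m ▸ hreach 0 m) hmN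
    have h2 := (b.chart_mem_dom hmN).2.1.2
    rw [div_lt_iff₀ hε] at hm₀
    have h3 : (m₀ : ℝ) * ε ≤ m * ε := by gcongr
    linarith
  by_cases hq₂ : q ∈ A₂
  · obtain ⟨m, -, hmN⟩ := hfreq _ hbs 0
    obtain ⟨j, hj⟩ := exists_nat_gt (b.radius / ε)
    have h1 := b.le_neg_chart_of_reach one_ne_zero hbox (hb2 hq₂) (hreach m j) hmN
    have h2 := (b.chart_mem_dom hmN).2.1.1
    rw [div_lt_iff₀ hε] at hj
    linarith
  · obtain ⟨N, hN, τ, hτ⟩ := h.exists_nhds_not_return q hq₁ hq₂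
    obtain ⟨i, -, hi⟩ := hfreq N hN 0
    obtain ⟨j₀, hj₀⟩ := exists_nat_gt (τ / ε)
    obtain ⟨m, hm, hmN⟩ := hfreq N hN (i + j₀)
    obtain ⟨j, rfl⟩ := Nat.exists_eq_add_of_le hm
    have h1 := hreach i (j₀ + j)
    rw [← add_assoc] at h1
    refine hτ _ _ _ ?_ h1 hi hmN
    rw [div_lt_iff₀ hε] at hj₀
    have h3 : (j₀ : ℝ) * ε ≤ (j₀ + j : ℕ) * ε := by gcongr; omega
    linarith

/-- Every point is reached from the entrance set in finite time. -/
theorem exists_entry (h : IsCrossingField F V A₁ A₂) (p : M) : ∃ t, ∃ z ∈ A₁, Reach V z t p := by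
  obtain ⟨t, z, hz, hr⟩ := h.neg.exists_exit p
  exact ⟨t, z, hz, reach_neg_iff.1 hr⟩

/-- With different entry times, backward uniqueness places one entry point in the interior of the
longer curve. A point of `A₁` cannot be reached after a positive time, since its own box has time
coordinate `0` there. -/
lemma entry_unique (h : IsCrossingField F V A₁ A₂) {p z z' : M} {t t' : ℝ} (hz : z ∈ A₁)
    (hz' : z' ∈ A₁) (hr : Reach V z t p) (hr' : Reach V z' t' p) : t = t' ∧ z = z' := by
  have hbox := h.nonempty_flowBox one_ne_zero
  have key : ∀ {z z' : M} {t t' : ℝ}, z ∈ A₁ → Reach V z t p → Reach V z' t' p → t' ≤ t := by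
    intro z z' t t' hz hr hr'
    by_contra! hlt
    obtain ⟨w, h1, h2⟩ := hr'.exists_split (s := t' - t) (by linarith) (by linarith [hr.1])
    rw [sub_sub_cancel] at h2
    obtain rfl := h2.eq_left one_ne_zero hbox hr
    obtain ⟨b, hb, -⟩ := h.exists_box 1 one_ne_zero w
    have := b.le_chart_of_reach one_ne_zero hbox (hb hz) h1 b.mem_source
    rw [b.chart_center] at this
    linarith
  have ht : t = t' := le_antisymm (key hz' hr' hr) (key hz hr hr')
  subst ht
  exact ⟨rfl, hr.eq_left one_ne_zero hbox hr'⟩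

end IsCrossingField

end Reach

/-! ### Propagation of properties along integral curves. -/

section Transport

open Filter Topology

variable {E F : Type} [NormedAddCommGroup E] [NormedSpace ℝ E] [NormedAddCommGroup F]
  [NormedSpace ℝ F] {H : Type*} [TopologicalSpace H]
  {I : ModelWithCorners ℝ E H} {M : Type*} [TopologicalSpace M] [ChartedSpace H M]
  {V : ∀ p : M, TangentSpace I p} {k : ℕ} {p q : M}

namespace FlowBox

variable (b : FlowBox F I V k p)

lemma param_mem_source {z : F × ℝ} (hz : z ∈ b.dom) : b.param z ∈ b.source := b.param_mem z hz

lemma chart_param' {z : F × ℝ} (hz : z ∈ b.dom) : b.chart (b.param z) = z := b.chart_param z hz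

/-- The projection of a flow box to the slice at the time `s`. -/
def toSlice (s : ℝ) (q : M) : M := b.param ((b.chart q).1, s)

variable {s : ℝ}

lemma toSlice_mem (hs : s ∈ b.interval) (hq : q ∈ b.source) :
    ((b.chart q).1, s) ∈ b.dom := ⟨(b.chart_mem_dom hq).1, hs⟩

lemma contMDiffOn_toSlice (hs : s ∈ b.interval) : ContMDiffOn I I k (b.toSlice s) b.source := by
  refine b.contMDiffOn_param.comp (ContMDiffOn.comp (t := univ)
    (g := fun z : F × ℝ => (z.1, s)) ?_ b.contMDiffOn_chart (fun _ _ => mem_univ _))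
    fun q hq => b.toSlice_mem hs hq
  exact (contDiff_fst.prodMk contDiff_const).contMDiff.contMDiffOn

lemma contMDiffAt_toSlice (hs : s ∈ b.interval) (hq : q ∈ b.source) :
    ContMDiffAt I I k (b.toSlice s) q :=
  (b.contMDiffOn_toSlice hs q hq).contMDiffAt (b.isOpen_source.mem_nhds hq)

lemma contMDiffAt_chart (hq : q ∈ b.source) : ContMDiffAt I 𝓘(ℝ, F × ℝ) k b.chart q :=
  (b.contMDiffOn_chart q hq).contMDiffAt (b.isOpen_source.mem_nhds hq)

lemma reach_toSlice_or (hs : s ∈ b.interval) (hq : q ∈ b.source) :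
    (0 ≤ (b.chart q).2 - s ∧ Reach V (b.toSlice s q) ((b.chart q).2 - s) q) ∨
      (0 ≤ s - (b.chart q).2 ∧ Reach V q (s - (b.chart q).2) (b.toSlice s q)) := by
  have h1 := b.chart_mem_dom hq
  have h2 := b.toSlice_mem hs hq
  have e : b.param ((b.chart q).1, (b.chart q).2) = q := b.param_chart q hq
  rcases le_total s (b.chart q).2 with h | h
  · have := b.reach_param h2 h1 h
    rw [e] at this
    exact Or.inl ⟨sub_nonneg.2 h, this⟩
  · have := b.reach_param h1 h2 h
    rw [e] at this
    exact Or.inr ⟨sub_nonneg.2 h, this⟩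

end FlowBox

/-- A property that is transported along flow boxes is invariant along integral curves. -/
lemma Reach.iff_of_transport (hk : k ≠ 0) (hbox : ∀ p, Nonempty (FlowBox F I V k p))
    {P : M → Prop} (hP : ∀ (x : M) (b : FlowBox F I V k x) (y : F) (s s' : ℝ), (y, s) ∈ b.dom →
      (y, s') ∈ b.dom → P (b.param (y, s)) → P (b.param (y, s')))
    {t : ℝ} (h : Reach V p t q) : P p ↔ P q := by
  obtain ⟨ht, γ, hγ, rfl, rfl⟩ := h
  have hT : Convex ℝ (Icc 0 t) := convex_Icc 0 t
  refine hT.isPreconnected.induction₂ (fun s s' => P (γ s) ↔ P (γ s')) ?_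
    (fun _ _ _ _ _ _ h h' => h.trans h') (fun _ _ _ _ h => h.symm) (left_mem_Icc.2 ht)
    (right_mem_Icc.2 ht)
  intro s hs
  obtain ⟨b⟩ := hbox (γ s)
  obtain ⟨ε, hε, Hε⟩ := Metric.mem_nhdsWithin_iff.1
    ((hγ.continuousWithinAt hs).eventually (b.isOpen_source.mem_nhds b.mem_source))
  filter_upwards [inter_mem_nhdsWithin (Icc 0 t) (Metric.ball_mem_nhds s hε)] with s' hs'
  have hss : s ∈ Icc 0 t ∩ Metric.ball s ε := ⟨hs, Metric.mem_ball_self hε⟩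
  have e1 := b.chart_comp_eq hk (hT.inter (convex_ball s ε)) (hγ.mono inter_subset_left)
    (fun x hx => Hε hx.symm) hss hs'
  have hd := b.chart_mem_dom (Hε hss.symm)
  have hd' := b.chart_mem_dom (Hε hs'.symm)
  have e2 : (b.chart (γ s')).1 = (b.chart (γ s)).1 := by rw [e1]; simp
  have p1 : b.param ((b.chart (γ s)).1, (b.chart (γ s)).2) = γ s := b.param_chart _ (Hε hss.symm)
  have p2 : b.param ((b.chart (γ s)).1, (b.chart (γ s')).2) = γ s' := by
    rw [← e2]; exact b.param_chart _ (Hε hs'.symm)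
  have hd'' : ((b.chart (γ s)).1, (b.chart (γ s')).2) ∈ b.dom := by rw [← e2]; exact hd'
  constructor
  · intro h
    rw [← p1] at h
    exact p2 ▸ hP _ b _ _ _ hd hd'' h
  · intro h
    rw [← p2] at h
    exact p1 ▸ hP _ b _ _ _ hd'' hd h

end Transport

/-! ### Entry and exit of integral curves, and their smoothness. -/

section Entry

open Filter Topology

variable {E F : Type} [NormedAddCommGroup E] [NormedSpace ℝ E] [NormedAddCommGroup F]
  [NormedSpace ℝ F] {H : Type*} [TopologicalSpace H]
  {I : ModelWithCorners ℝ E H} {M : Type*} [TopologicalSpace M] [ChartedSpace H M] [T2Space M]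
  {V : ∀ p : M, TangentSpace I p} {A₁ A₂ : Set M} {p q z : M} {t : ℝ}

lemma Reach.eq_of_zero (h : Reach V p 0 q) : p = q := by
  obtain ⟨-, γ, -, rfl, rfl⟩ := h
  rfl

namespace IsCrossingField

variable (h : IsCrossingField F V A₁ A₂)

/-- The time elapsed since the integral curve through a point entered the manifold. -/
def entryTime (p : M) : ℝ := (h.exists_entry p).choose

/-- The point at which the integral curve through a point entered the manifold. -/
def entryPoint (p : M) : M := (h.exists_entry p).choose_spec.choose

lemma entryPoint_mem (p : M) : h.entryPoint p ∈ A₁ :=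
  (h.exists_entry p).choose_spec.choose_spec.1

lemma reach_entry (p : M) : Reach V (h.entryPoint p) (h.entryTime p) p :=
  (h.exists_entry p).choose_spec.choose_spec.2

lemma entry_eq (hz : z ∈ A₁) (hr : Reach V z t p) :
    h.entryTime p = t ∧ h.entryPoint p = z :=
  h.entry_unique (h.entryPoint_mem p) hz (h.reach_entry p) hr

lemma entryTime_nonneg (p : M) : 0 ≤ h.entryTime p := (h.reach_entry p).1

lemma entryPoint_of_mem (hz : z ∈ A₁) : h.entryPoint z = z := (h.entry_eq hz (Reach.refl V z)).2

lemma entryTime_of_reach (hr : Reach V p t q) : h.entryTime q = h.entryTime p + t :=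
  (h.entry_eq (h.entryPoint_mem p) ((h.reach_entry p).trans hr)).1

lemma entryPoint_of_reach (hr : Reach V p t q) : h.entryPoint q = h.entryPoint p :=
  (h.entry_eq (h.entryPoint_mem p) ((h.reach_entry p).trans hr)).2

/-- The time until the integral curve through a point leaves the manifold. -/
def exitTime (p : M) : ℝ := h.neg.entryTime p

/-- The point at which the integral curve through a point leaves the manifold. -/
def exitPoint (p : M) : M := h.neg.entryPoint p

lemma exitTime_of_reach (hr : Reach V p t q) : h.exitTime p = h.exitTime q + t :=
  h.neg.entryTime_of_reach hr.neg

lemma reach_exit (p : M) : Reach V p (h.exitTime p) (h.exitPoint p) :=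
  reach_neg_iff.1 (h.neg.reach_entry p)

lemma exitPoint_mem (p : M) : h.exitPoint p ∈ A₂ := h.neg.entryPoint_mem p

lemma exitTime_nonneg (p : M) : 0 ≤ h.exitTime p := (h.reach_exit p).1

variable {k : ℕ} (b : FlowBox F I V k p) {s : ℝ}

lemma entryPoint_toSlice (hs : s ∈ b.interval) (hq : q ∈ b.source) :
    h.entryPoint (b.toSlice s q) = h.entryPoint q := by
  rcases b.reach_toSlice_or hs hq with ⟨-, hr⟩ | ⟨-, hr⟩
  · exact (h.entryPoint_of_reach hr).symm
  · exact h.entryPoint_of_reach hr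

lemma entryTime_toSlice (hs : s ∈ b.interval) (hq : q ∈ b.source) :
    h.entryTime q = h.entryTime (b.toSlice s q) + ((b.chart q).2 - s) := by
  rcases b.reach_toSlice_or hs hq with ⟨-, hr⟩ | ⟨-, hr⟩
  · exact h.entryTime_of_reach hr
  · rw [h.entryTime_of_reach hr]; ring

/-- By the barrier property the slice of time `0` in an entrance box has entry time `0`; the rest of
the box follows along its lines. -/
lemma entryTime_eq_chart (hk : k ≠ 0) (hb : b.times = Ici 0) (hq : q ∈ b.source) :
    h.entryTime q = (b.chart q).2 := by
  have hd := b.toSlice_mem b.zero_mem_interval hq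
  have h1 := b.le_chart_of_reach hk (h.nonempty_flowBox hk) hb
    (h.reach_entry (b.toSlice 0 q)) (b.param_mem_source hd)
  rw [FlowBox.toSlice, b.chart_param' hd] at h1
  have h2 := h.entryTime_toSlice b b.zero_mem_interval hq
  have h3 : h.entryTime (b.toSlice 0 q) = 0 := le_antisymm h1 (h.entryTime_nonneg _)
  rw [h2, h3]
  ring

lemma exitTime_eq_neg_chart (hk : k ≠ 0) (hb : b.times = Iic 0) (hq : q ∈ b.source) :
    h.exitTime q = -(b.chart q).2 :=
  h.neg.entryTime_eq_chart b.neg hk (by change -b.times = _; simp [hb]) hq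

lemma entryPoint_eq_toSlice (hk : k ≠ 0) (hb : b.times = Ici 0) (hq : q ∈ b.source) :
    h.entryPoint q = b.toSlice 0 q := by
  have hd := b.toSlice_mem b.zero_mem_interval hq
  have h1 := h.entryTime_eq_chart b hk hb (b.param_mem_source hd)
  rw [b.chart_param' hd] at h1
  rw [← h.entryPoint_toSlice b b.zero_mem_interval hq]
  have h2 := h.reach_entry (b.toSlice 0 q)
  rw [FlowBox.toSlice, h1] at h2
  exact h2.eq_of_zero

/-- A property that holds on the entrance set and is transported along flow boxes holds
everywhere. -/
lemma induction_along_flow (h : IsCrossingField F V A₁ A₂) (hk : k ≠ 0) {P : M → Prop}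
    (h₁ : ∀ z ∈ A₁, P z)
    (hP : ∀ (x : M) (b : FlowBox F I V k x) (y : F) (s s' : ℝ), (y, s) ∈ b.dom →
      (y, s') ∈ b.dom → P (b.param (y, s)) → P (b.param (y, s'))) (p : M) : P p :=
  ((h.reach_entry p).iff_of_transport hk (h.nonempty_flowBox hk) hP).1
    (h₁ _ (h.entryPoint_mem p))

/-- In an entrance box the entry time is the time coordinate. Within any box, its germ at one point
of a line is obtained from the germ at another by a `C^k` slice projection and a change of time, so
regularity spreads along each integral curve. -/
lemma contMDiffAt_entryTime (hk : k ≠ 0) (p : M) :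
    ContMDiffAt I 𝓘(ℝ, ℝ) k h.entryTime p := by
  refine h.induction_along_flow hk (P := fun p => ContMDiffAt I 𝓘(ℝ, ℝ) k h.entryTime p)
    (fun z hz => ?_) (fun x b y s s' hs hs' hy => ?_) p
  · obtain ⟨b, hb, -⟩ := h.exists_box k hk z
    refine ContMDiffAt.congr_of_eventuallyEq (f := fun q => (b.chart q).2) ?_ ?_
    · exact contDiff_snd.contMDiff.contMDiffAt.comp z (b.contMDiffAt_chart b.mem_source)
    · filter_upwards [b.isOpen_source.mem_nhds b.mem_source] with q hq
      exact h.entryTime_eq_chart b hk (hb hz) hq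
  · have hm := b.param_mem_source hs'
    refine ContMDiffAt.congr_of_eventuallyEq
      (f := fun q => h.entryTime (b.toSlice s q) + ((b.chart q).2 - s)) ?_ ?_
    · refine ContMDiffAt.add (ContMDiffAt.comp (g := h.entryTime) _ ?_
        (b.contMDiffAt_toSlice hs.2 hm)) ?_
      · rwa [FlowBox.toSlice, b.chart_param' hs']
      · exact (contDiff_snd.sub contDiff_const).contMDiff.contMDiffAt.comp _
          (b.contMDiffAt_chart hm)
    · filter_upwards [b.isOpen_source.mem_nhds hm] with q hq
      exact h.entryTime_toSlice b hs.2 hq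

lemma contMDiffAt_exitTime (hk : k ≠ 0) (p : M) : ContMDiffAt I 𝓘(ℝ, ℝ) k h.exitTime p :=
  h.neg.contMDiffAt_entryTime hk p

lemma contMDiffAt_entryPoint (hk : k ≠ 0) (p : M) : ContMDiffAt I I k h.entryPoint p := by
  refine h.induction_along_flow hk (P := fun p => ContMDiffAt I I k h.entryPoint p)
    (fun z hz => ?_) (fun x b y s s' hs hs' hy => ?_) p
  · obtain ⟨b, hb, -⟩ := h.exists_box k hk z
    refine (b.contMDiffAt_toSlice b.zero_mem_interval b.mem_source).congr_of_eventuallyEq ?_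
    filter_upwards [b.isOpen_source.mem_nhds b.mem_source] with q hq
    exact h.entryPoint_eq_toSlice b hk (hb hz) hq
  · have hm := b.param_mem_source hs'
    refine ContMDiffAt.congr_of_eventuallyEq (f := fun q => h.entryPoint (b.toSlice s q)) ?_ ?_
    · refine ContMDiffAt.comp (g := h.entryPoint) _ ?_ (b.contMDiffAt_toSlice hs.2 hm)
      rwa [FlowBox.toSlice, b.chart_param' hs']
    · filter_upwards [b.isOpen_source.mem_nhds hm] with q hq
      exact (h.entryPoint_toSlice b hs.2 hq).symm

end IsCrossingField

end Entry

/-! ### The product structure given by the flow. -/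

section Product

open Filter Topology

variable {E F E' : Type} [NormedAddCommGroup E] [NormedSpace ℝ E] [NormedAddCommGroup F]
  [NormedSpace ℝ F] [NormedAddCommGroup E'] [NormedSpace ℝ E'] {H H' : Type*}
  [TopologicalSpace H] [TopologicalSpace H']
  {I : ModelWithCorners ℝ E H} {J : ModelWithCorners ℝ E' H'} {M : Type*} [TopologicalSpace M]
  [ChartedSpace H M] [T2Space M] {S : Type*} [TopologicalSpace S] [ChartedSpace H' S]
  {V : ∀ p : M, TangentSpace I p} {A₂ : Set M} {ι : S → M}

/-- The charts exhibiting a smooth immersion also exhibit it as a `C^k` immersion, and an embedding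
supplies the continuity of `f` that the criterion for immersions needs. -/
lemma _root_.Manifold.IsSmoothEmbedding.contMDiffAt_of_comp {N : Type*} [TopologicalSpace N]
    {E'' H'' : Type*} [NormedAddCommGroup E''] [NormedSpace ℝ E''] [TopologicalSpace H'']
    {J' : ModelWithCorners ℝ E'' H''} [ChartedSpace H'' N] [IsManifold I ∞ M] [IsManifold J ∞ S]
    (hι : Manifold.IsSmoothEmbedding J I ∞ ι) {k : ℕ} {f : N → S} {x : N}
    (hf : ContMDiffAt J' I k (ι ∘ f) x) : ContMDiffAt J' J k f x := by
  have hle : (k : WithTop ℕ∞) ≤ ∞ := by exact_mod_cast le_top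
  have h := hι.isImmersion.isImmersionAt (f x)
  have h' : Manifold.IsImmersionAt J I k ι (f x) :=
    .mk_of_charts h.equiv h.domChart h.codChart h.mem_domChart_source h.mem_codChart_source
      (IsManifold.maximalAtlas_subset_of_le hle h.domChart_mem_maximalAtlas)
      (IsManifold.maximalAtlas_subset_of_le hle h.codChart_mem_maximalAtlas)
      h.source_subset_preimage_source h.writtenInCharts
  exact (ContMDiffAt.iff_comp_isImmersionAt h').2
    ⟨hι.isEmbedding.isInducing.continuousAt_iff.2 hf.continuousAt, hf⟩

namespace IsCrossingField

variable (h : IsCrossingField F V (range ι) A₂)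

/-- The point of `S` from which the integral curve through a point issues. -/
def source (p : M) : S := (h.entryPoint_mem p).choose

lemma ι_source (p : M) : ι (h.source p) = h.entryPoint p := (h.entryPoint_mem p).choose_spec

lemma source_ι (hι : Function.Injective ι) (x : S) : h.source (ι x) = x :=
  hι ((h.ι_source _).trans (h.entryPoint_of_mem (mem_range_self x)))

lemma source_eq (hι : Function.Injective ι) {p q : M} (hpq : h.entryPoint p = h.entryPoint q) :
    h.source p = h.source q :=
  hι (by rw [h.ι_source, h.ι_source, hpq])

variable {k : ℕ}

lemma contMDiffAt_source [IsManifold I ∞ M] [IsManifold J ∞ S]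
    (hι : Manifold.IsSmoothEmbedding J I ∞ ι) (hk : k ≠ 0) (p : M) :
    ContMDiffAt I J k h.source p := by
  refine hι.contMDiffAt_of_comp ?_
  have : ι ∘ h.source = h.entryPoint := funext h.ι_source
  rw [this]
  exact h.contMDiffAt_entryPoint hk p

/-- There are local sections of the projection to `S` through every point. -/
lemma exists_section (hι : Manifold.IsSmoothEmbedding J I ∞ ι)
    (hk : k ≠ 0) (p : M) : ∃ σ : S → M, ContMDiffAt J I k σ (h.source p) ∧
      σ (h.source p) = p ∧ ∀ᶠ x in 𝓝 (h.source p), h.source (σ x) = x := by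
  have hinj := hι.isEmbedding.injective
  refine h.induction_along_flow hk (P := fun p => ∃ σ : S → M,
    ContMDiffAt J I k σ (h.source p) ∧ σ (h.source p) = p ∧
      ∀ᶠ x in 𝓝 (h.source p), h.source (σ x) = x)
    (fun z hz => ?_) (fun x b y s s' hs hs' => ?_) p
  · refine ⟨ι, (hι.contMDiff _).of_le (by exact_mod_cast le_top), ?_,
      Eventually.of_forall (h.source_ι hinj)⟩
    rw [h.ι_source, h.entryPoint_of_mem hz]
  · rintro ⟨σ, hσ, hσ0, hσx⟩
    have hm := b.param_mem_source hs
    have e : b.toSlice s' (b.param (y, s)) = b.param (y, s') := by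
      rw [FlowBox.toSlice, b.chart_param' hs]
    have e' : h.source (b.param (y, s')) = h.source (b.param (y, s)) := by
      rw [← e]
      exact h.source_eq hinj (h.entryPoint_toSlice b hs'.2 hm)
    rw [e']
    refine ⟨b.toSlice s' ∘ σ, ContMDiffAt.comp _ ?_ hσ, ?_, ?_⟩
    · exact b.contMDiffAt_toSlice hs'.2 (hσ0.symm ▸ hm)
    · rw [Function.comp_apply, hσ0, e]
    · have hev : ∀ᶠ x in 𝓝 (h.source (b.param (y, s))), σ x ∈ b.source :=
        hσ.continuousAt.eventually (by rw [hσ0]; exact b.isOpen_source.mem_nhds hm)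
      filter_upwards [hσx, hev] with x hx hx'
      rw [Function.comp_apply, h.source_eq hinj (h.entryPoint_toSlice b hs'.2 hx'), hx]

/-- The time that the integral curve issuing from a point of `S` spends in the manifold. -/
def length (x : S) : ℝ := h.exitTime (ι x)

lemma length_source (p : M) : h.length (h.source p) = h.entryTime p + h.exitTime p := by
  rw [length, h.ι_source, h.exitTime_of_reach (h.reach_entry p), add_comm]

lemma length_pos (hd : Disjoint (range ι) A₂) (x : S) : 0 < h.length x := by
  refine (h.exitTime_nonneg _).lt_of_ne fun h0 => ?_
  have h1 := h.reach_exit (ι x)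
  rw [← h0] at h1
  exact disjoint_left.1 hd (mem_range_self x) (h1.eq_of_zero ▸ h.exitPoint_mem (ι x))

/-- The fraction of the integral curve through a point that has elapsed. -/
def fraction (p : M) : Icc (0 : ℝ) 1 :=
  projIcc 0 1 zero_le_one (h.entryTime p / (h.entryTime p + h.exitTime p))

lemma fraction_mem (p : M) :
    h.entryTime p / (h.entryTime p + h.exitTime p) ∈ Icc (0 : ℝ) 1 := by
  have h1 := h.entryTime_nonneg p
  have h2 := h.exitTime_nonneg p
  exact ⟨by positivity, div_le_one_of_le₀ (by linarith) (by positivity)⟩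

lemma coe_fraction (p : M) :
    (h.fraction p : ℝ) = h.entryTime p / (h.entryTime p + h.exitTime p) := by
  rw [fraction, projIcc_of_mem _ (h.fraction_mem p)]

/-- The point at a given fraction of the integral curve issuing from a point of `S`. -/
lemma exists_reach (x : S) (t : Icc (0 : ℝ) 1) : ∃ q, Reach V (ι x) (t * h.length x) q := by
  have h0 := h.exitTime_nonneg (ι x)
  obtain ⟨q, hq, -⟩ := (h.reach_exit (ι x)).exists_split (s := t * h.length x)
    (mul_nonneg t.2.1 h0) (mul_le_of_le_one_left h0 t.2.2)
  exact ⟨q, hq⟩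

/-- The map `S × [0, 1] → M` that follows the integral curves. -/
def flowMap (z : S × Icc (0 : ℝ) 1) : M := (h.exists_reach z.1 z.2).choose

lemma reach_flowMap (z : S × Icc (0 : ℝ) 1) : Reach V (ι z.1) (z.2 * h.length z.1) (h.flowMap z) :=
  (h.exists_reach z.1 z.2).choose_spec

lemma source_flowMap (hι : Function.Injective ι) (z : S × Icc (0 : ℝ) 1) :
    h.source (h.flowMap z) = z.1 := by
  refine hι ?_
  rw [h.ι_source]
  exact (h.entry_eq (mem_range_self _) (h.reach_flowMap z)).2

lemma entryTime_flowMap (z : S × Icc (0 : ℝ) 1) :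
    h.entryTime (h.flowMap z) = z.2 * h.length z.1 :=
  (h.entry_eq (mem_range_self _) (h.reach_flowMap z)).1

lemma eq_flowMap {q : M} {z : S × Icc (0 : ℝ) 1}
    (h1 : h.source q = z.1) (h2 : h.entryTime q = z.2 * h.length z.1) : h.flowMap z = q := by
  have h3 := h.reach_entry q
  rw [← h.ι_source, h1, h2] at h3
  exact (h.reach_flowMap z).eq_right one_ne_zero (h.nonempty_flowBox one_ne_zero) h3

/-- The bijection underlying the product structure. -/
def flowEquiv (hι : Function.Injective ι) (hd : Disjoint (range ι) A₂) :
    S × Icc (0 : ℝ) 1 ≃ M where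
  toFun := h.flowMap
  invFun p := (h.source p, h.fraction p)
  left_inv z := by
    have h1 := h.source_flowMap hι z
    refine Prod.ext h1 (Subtype.ext ?_)
    simp only
    rw [h.coe_fraction, ← h.length_source, h1, h.entryTime_flowMap,
      mul_div_cancel_right₀ _ (h.length_pos hd _).ne']
  right_inv p := by
    refine h.eq_flowMap rfl ?_
    simp only
    rw [h.coe_fraction, h.length_source, div_mul_cancel₀]
    rw [← h.length_source]
    exact (h.length_pos hd _).ne'

lemma contMDiffAt_fraction (hd : Disjoint (range ι) A₂) (hk : k ≠ 0) :
    ContMDiff I (𝓡∂ 1) k h.fraction := by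
  refine (contMDiffOn_projIcc (x := (0 : ℝ)) (y := 1)).comp_contMDiff (fun p => ?_)
    h.fraction_mem
  have hpos : h.entryTime p + h.exitTime p ≠ 0 := by
    rw [← h.length_source]
    exact (h.length_pos hd _).ne'
  exact (h.contMDiffAt_entryTime hk p).div₀
    ((h.contMDiffAt_entryTime hk p).add (h.contMDiffAt_exitTime hk p)) hpos

/-- A box may be far from `S`, so a local section `σ` first carries points of `S` into the box
around `flowMap z`. There the flow is a translation of the time coordinate. -/
lemma contMDiffAt_flowMap (hι : Manifold.IsSmoothEmbedding J I ∞ ι)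
    (hk : k ≠ 0) (z : S × Icc (0 : ℝ) 1) :
    ContMDiffAt (J.prod (𝓡∂ 1)) I k h.flowMap z := by
  have hinj := hι.isEmbedding.injective
  set p := h.flowMap z with hp
  have hz1 : h.source p = z.1 := h.source_flowMap hinj z
  obtain ⟨σ, hσ, hσ0, hσx⟩ := h.exists_section hι hk p
  rw [hz1] at hσ hσ0 hσx
  obtain ⟨b, hb1, hb2, hb3⟩ := h.exists_box k hk p
  have hfst : ContMDiffAt (J.prod (𝓡∂ 1)) J k Prod.fst z := contMDiffAt_fst
  have hσz : ContMDiffAt (J.prod (𝓡∂ 1)) I k (fun z => σ z.1) z := hσ.comp z hfst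
  have hlen : ContMDiffAt (J.prod (𝓡∂ 1)) 𝓘(ℝ, ℝ) k (fun z => h.length z.1) z := by
    have h1 : ContMDiffAt J 𝓘(ℝ, ℝ) k h.length z.1 :=
      (h.contMDiffAt_exitTime hk _).comp _ ((hι.contMDiff _).of_le (by exact_mod_cast le_top))
    exact h1.comp z hfst
  have hsnd : ContMDiffAt (J.prod (𝓡∂ 1)) 𝓘(ℝ, ℝ) k
      (fun z : S × Icc (0 : ℝ) 1 => (z.2 : ℝ)) z :=
    contMDiff_subtypeVal_Icc.contMDiffAt.comp z contMDiffAt_snd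
  have hchart : ContMDiffAt (J.prod (𝓡∂ 1)) 𝓘(ℝ, F × ℝ) k (fun z => b.chart (σ z.1)) z := by
    refine ContMDiffAt.comp (g := b.chart) z ?_ hσz
    rw [hσ0]
    exact b.contMDiffAt_chart b.mem_source
  -- The coordinates of `σ z.1`, shifted by the difference between the required entry time and that
  -- of `σ z.1`.
  let w : S × Icc (0 : ℝ) 1 → F × ℝ := fun z =>
    ((b.chart (σ z.1)).1, (b.chart (σ z.1)).2 + (z.2 * h.length z.1 - h.entryTime (σ z.1)))
  have hw : ContMDiffAt (J.prod (𝓡∂ 1)) 𝓘(ℝ, F × ℝ) k w z := by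
    refine ContMDiffAt.prodMk_space ?_ (ContMDiffAt.add ?_ ((hsnd.mul hlen).sub ?_))
    · exact contDiff_fst.contMDiff.contMDiffAt.comp z hchart
    · exact contDiff_snd.contMDiff.contMDiffAt.comp z hchart
    · exact ContMDiffAt.comp (g := h.entryTime) z (h.contMDiffAt_entryTime hk _) hσz
  have hw0 : w z = (0, 0) := by
    simp only [w, hσ0, b.chart_center, zero_add]
    rw [h.entryTime_flowMap z, sub_self]
  have hev1 : ∀ᶠ z' in 𝓝 z, σ z'.1 ∈ b.source ∧ h.source (σ z'.1) = z'.1 := by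
    refine Filter.Eventually.and ?_ (hfst.continuousAt.eventually hσx)
    refine hσz.continuousAt.eventually ?_
    simp only [hσ0]
    exact b.isOpen_source.mem_nhds b.mem_source
  have hev2 : ∀ᶠ z' in 𝓝 z, w z' ∈ Metric.ball (0 : F) b.radius ×ˢ Ioo (-b.radius) b.radius := by
    refine hw.continuousAt.eventually ((Metric.isOpen_ball.prod isOpen_Ioo).mem_nhds ?_)
    rw [hw0]
    exact ⟨Metric.mem_ball_self b.radius_pos, by simp [b.radius_pos]⟩
  have hdom : ∀ᶠ z' in 𝓝 z, w z' ∈ b.dom ∧ h.flowMap z' = b.param (w z') := by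
    filter_upwards [hev1, hev2] with z' h1 h2
    have hl := h.length_source (σ z'.1)
    rw [h1.2] at hl
    have hlen0 := h.exitTime_nonneg (ι z'.1)
    -- In an entrance box the time coordinate of `w z'` is the elapsed time. In an exit box it is
    -- minus the remaining time.
    have ht : (w z').2 ∈ b.times := by
      by_cases hp1 : p ∈ range ι
      · rw [hb1 hp1]
        simp only [w, h.entryTime_eq_chart b hk (hb1 hp1) h1.1, mem_Ici, add_sub_cancel]
        exact mul_nonneg z'.2.2.1 hlen0
      by_cases hp2 : p ∈ A₂
      · rw [hb2 hp2]
        have e := h.exitTime_eq_neg_chart b hk (hb2 hp2) h1.1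
        simp only [w, mem_Iic]
        have := mul_le_of_le_one_left hlen0 z'.2.2.2
        change _ ≤ h.length z'.1 at this
        change _ + ((z'.2 : ℝ) * h.length z'.1 - _) ≤ 0
        have e2 : (z'.2 : ℝ) * h.length z'.1 ≤ h.length z'.1 := this
        linarith
      · rw [hb3 hp1 hp2]; exact mem_univ _
    have hd : w z' ∈ b.dom := ⟨h2.1, h2.2, ht⟩
    have hsl : b.param (w z') = b.toSlice (w z').2 (σ z'.1) := rfl
    refine ⟨hd, h.eq_flowMap ?_ ?_⟩
    · rw [hsl, h.source_eq hinj (h.entryPoint_toSlice b hd.2 h1.1), h1.2]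
    · have e := h.entryTime_toSlice b hd.2 h1.1
      rw [hsl]
      simp only [w] at e ⊢
      linarith
  have hcomp : ContMDiffAt (J.prod (𝓡∂ 1)) I k (fun z => b.param (w z)) z := by
    have h1 : ContMDiffWithinAt (J.prod (𝓡∂ 1)) I k (b.param ∘ w) (w ⁻¹' b.dom) z :=
      ContMDiffWithinAt.comp z (b.contMDiffOn_param _ hdom.self_of_nhds.1) hw.contMDiffWithinAt
        (fun _ hx => hx)
    exact h1.contMDiffAt (hdom.mono fun _ hx => hx.1)
  exact hcomp.congr_of_eventuallyEq (hdom.mono fun _ hx => hx.2)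

/-- The boxes change with `k` but the maps do not, so smoothness may be checked order by order. The
value `k = 0`, for which there are no boxes, follows from `k + 1`. -/
lemma contMDiff_infty_of_nat {N N' : Type*} [TopologicalSpace N] [TopologicalSpace N']
    {E₁ H₁ E₂ H₂ : Type*} [NormedAddCommGroup E₁] [NormedSpace ℝ E₁] [TopologicalSpace H₁]
    [NormedAddCommGroup E₂] [NormedSpace ℝ E₂] [TopologicalSpace H₂]
    {I₁ : ModelWithCorners ℝ E₁ H₁} {I₂ : ModelWithCorners ℝ E₂ H₂} [ChartedSpace H₁ N]
    [ChartedSpace H₂ N'] {f : N → N'} (hf : ∀ k : ℕ, k ≠ 0 → ContMDiff I₁ I₂ k f) :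
    ContMDiff I₁ I₂ ∞ f := by
  rw [contMDiff_infty]
  intro k
  exact (hf (k + 1) k.succ_ne_zero).of_le (by exact_mod_cast k.le_succ)

/-- The diffeomorphism `S × [0, 1] ≃ M` that follows the integral curves. -/
def flowDiffeomorph [IsManifold I ∞ M] [IsManifold J ∞ S]
    (hι : Manifold.IsSmoothEmbedding J I ∞ ι) (hd : Disjoint (range ι) A₂) :
    Diffeomorph (J.prod (𝓡∂ 1)) I (S × Icc (0 : ℝ) 1) M ∞ where
  toEquiv := h.flowEquiv hι.isEmbedding.injective hd
  contMDiff_toFun := contMDiff_infty_of_nat fun _ hk => h.contMDiffAt_flowMap hι hk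
  contMDiff_invFun := contMDiff_infty_of_nat fun _ hk =>
    ContMDiff.prodMk (fun p => h.contMDiffAt_source hι hk p) (h.contMDiffAt_fraction hd hk)

end IsCrossingField

end Product

/-! ### Regularity of integral curves. -/

section IntegralCurve

open Filter Topology

variable {E F : Type} [NormedAddCommGroup E] [NormedSpace ℝ E] [NormedAddCommGroup F]
  [NormedSpace ℝ F] {H : Type*} [TopologicalSpace H]
  {I : ModelWithCorners ℝ E H} {M : Type*} [TopologicalSpace M] [ChartedSpace H M]
  {V : ∀ p : M, TangentSpace I p} {k : ℕ}

lemma contMDiffOn_of_isMIntegralCurveOn (hk : k ≠ 0) (hbox : ∀ p, Nonempty (FlowBox F I V k p))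
    {γ : ℝ → M} {T : Set ℝ} (hT : Convex ℝ T) (hγ : IsMIntegralCurveOn γ V T) :
    ContMDiffOn 𝓘(ℝ, ℝ) I k γ T := by
  intro t ht
  obtain ⟨b⟩ := hbox (γ t)
  obtain ⟨ε, hε, Hε⟩ := Metric.mem_nhdsWithin_iff.1
    ((hγ.continuousWithinAt ht).eventually (b.isOpen_source.mem_nhds b.mem_source))
  have htt : t ∈ T ∩ Metric.ball t ε := ⟨ht, Metric.mem_ball_self hε⟩
  have e1 : ∀ s ∈ T ∩ Metric.ball t ε, b.chart (γ s) = ((0 : F), s - t) := by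
    intro s hs
    rw [b.chart_comp_eq hk (hT.inter (convex_ball t ε)) (hγ.mono inter_subset_left)
      (fun x hx => Hε hx.symm) htt hs, b.chart_center]
    simp
  have h1 : ContDiff ℝ k fun s : ℝ => ((0 : F), s - t) :=
    contDiff_const.prodMk (contDiff_id.sub contDiff_const)
  have h2 : ContMDiffWithinAt 𝓘(ℝ, ℝ) I k (b.param ∘ fun s : ℝ => ((0 : F), s - t))
      (T ∩ Metric.ball t ε) t := by
    refine ContMDiffWithinAt.comp t (t := b.dom) (b.contMDiffOn_param _ ?_)
      h1.contMDiff.contMDiffAt.contMDiffWithinAt fun s hs => ?_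
    · rw [← e1 t htt]
      exact b.chart_mem_dom b.mem_source
    · rw [← e1 s hs]
      exact b.chart_mem_dom (Hε hs.symm)
  refine (h2.congr (f₁ := γ) (fun s hs => ?_) ?_).mono_of_mem_nhdsWithin
    (inter_mem_nhdsWithin T (Metric.ball_mem_nhds t hε))
  · rw [Function.comp_apply, ← e1 s hs, b.param_chart _ (Hε hs.symm)]
  · rw [Function.comp_apply, ← e1 t htt, b.param_chart _ b.mem_source]

end IntegralCurve

/-! ### Timelike vectors and timelike integral curves. -/

section Lorentz

open Filter Topology

variable {n : ℕ} {M : Type*} [TopologicalSpace M] [ChartedSpace (EuclideanHalfSpace (n + 1)) M]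
  [IsManifold (𝓡∂ (n + 1)) ∞ M] {g : LorentzianMetric n M}

/-- Timelike vectors are not orthogonal to one another. -/
lemma LorentzianMetric.IsTimelike.val_ne_zero {p : M} {u w : TangentSpace (𝓡∂ (n + 1)) p}
    (hu : g.IsTimelike u) (hw : g.IsTimelike w) : g.val p u w ≠ 0 := by
  intro h
  obtain ⟨u₀, -, hpos⟩ := g.signature p
  have hwu : g.val p w u = 0 := by rw [g.symm, h]
  have key : ∀ z : TangentSpace (𝓡∂ (n + 1)) p, g.IsTimelike z → g.val p u₀ z ≠ 0 := by
    intro z hz h0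
    refine lt_asymm hz (hpos z h0 ?_)
    rintro rfl
    simp [IsTimelike] at hz
  set α := g.val p u₀ w with hα
  set β := g.val p u₀ u with hβ
  have hu0 : β ≠ 0 := key u hu
  have hw0 : α ≠ 0 := key w hw
  -- Orthogonal timelike vectors would span a negative definite plane. This combination is the
  -- vector of the plane orthogonal to `u₀`, where the metric is positive.
  have hz : g.IsTimelike (α • u - β • w) := by
    have e : g.val p (α • u - β • w) (α • u - β • w) =
        α ^ 2 * g.val p u u + β ^ 2 * g.val p w w := by
      simp only [map_sub, map_smul, sub_apply, smul_apply, smul_eq_mul, h, hwu]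
      ring
    have h1 : α ^ 2 * g.val p u u < 0 := mul_neg_of_pos_of_neg (by positivity) hu
    have h2 : β ^ 2 * g.val p w w < 0 := mul_neg_of_pos_of_neg (by positivity) hw
    change g.val p _ _ < 0
    rw [e]
    linarith
  refine key _ hz ?_
  simp only [map_sub, map_smul, smul_eq_mul, ← hα, ← hβ]
  ring

lemma LorentzianMetric.continuous_val {X : Type*} [TopologicalSpace X] (g : LorentzianMetric n M)
    {f : X → M} {v w : ∀ x, TangentSpace (𝓡∂ (n + 1)) (f x)}
    (hv : Continuous fun x => (⟨f x, v x⟩ : TangentBundle (𝓡∂ (n + 1)) M))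
    (hw : Continuous fun x => (⟨f x, w x⟩ : TangentBundle (𝓡∂ (n + 1)) M)) :
    Continuous fun x => g.val (f x) (v x) (w x) := by
  have hf : Continuous f := (FiberBundle.continuous_proj _ _).comp hv
  have h := Continuous.clm_bundle_apply₂ (F₁ := EuclideanSpace ℝ (Fin (n + 1)))
    (F₂ := EuclideanSpace ℝ (Fin (n + 1))) (F₃ := ℝ) (E₁ := TangentSpace (𝓡∂ (n + 1)))
    (E₂ := TangentSpace (𝓡∂ (n + 1))) (E₃ := Bundle.Trivial M ℝ) (b := f)
    (ψ := fun x => g.val (f x)) (v := v) (w := w) (g.contMDiff.continuous.comp hf) hv hw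
  exact (Bundle.Trivial.homeomorphProd M ℝ).continuous.comp h |>.snd

lemma LorentzianMetric.isOpen_setOf_isTimelike (g : LorentzianMetric n M) :
    IsOpen {v : TangentBundle (𝓡∂ (n + 1)) M | g.IsTimelike v.2} :=
  isOpen_lt (g.continuous_val (f := Bundle.TotalSpace.proj) continuous_id continuous_id)
    continuous_const

lemma velocity_eq {γ : ℝ → M} {a c t : ℝ} (hac : a < c) (ht : t ∈ Icc a c)
    {L : ℝ →L[ℝ] TangentSpace (𝓡∂ (n + 1)) (γ t)}
    (h : HasMFDerivWithinAt 𝓘(ℝ, ℝ) (𝓡∂ (n + 1)) γ (Icc a c) t L) :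
    velocity (n := n) γ a c t = L 1 := by
  have := h.mfderivWithin ((uniqueDiffOn_Icc hac).uniqueMDiffOn t ht)
  rw [velocity, this]
  rfl

variable {V : ∀ p : M, TangentSpace (𝓡∂ (n + 1)) p}

lemma velocity_of_isMIntegralCurveOn {γ : ℝ → M} {a c t : ℝ} (hac : a < c) (ht : t ∈ Icc a c)
    (hγ : IsMIntegralCurveOn γ V (Icc a c)) : velocity (n := n) γ a c t = V (γ t) := by
  rw [velocity_eq hac ht (hγ t ht)]
  exact one_smul ℝ (V (γ t))

variable {F : Type} [NormedAddCommGroup F] [NormedSpace ℝ F]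

lemma isTimelikeCurve_of_isMIntegralCurveOn (hbox : ∀ p, Nonempty (FlowBox F (𝓡∂ (n + 1)) V 1 p))
    (hV : ∀ p, g.IsTimelike (V p)) {γ : ℝ → M} {a c : ℝ} (hac : a < c)
    (hγ : IsMIntegralCurveOn γ V (Icc a c)) : g.IsTimelikeCurve γ a c where
  lt := hac
  contMDiffOn := by
    exact_mod_cast contMDiffOn_of_isMIntegralCurveOn one_ne_zero hbox (convex_Icc a c) hγ
  timelike t ht := by
    rw [velocity_of_isMIntegralCurveOn hac ht hγ]
    exact hV _

lemma mem_chronologicalFuture_of_reach (T : TimeOrientation g)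
    (hbox : ∀ p, Nonempty (FlowBox F (𝓡∂ (n + 1)) V 1 p)) (hV : ∀ p, g.IsTimelike (V p))
    (hT : ∀ p, g.val p (T.field p) (V p) < 0) {p q : M} {t : ℝ} (ht : 0 < t) (h : Reach V p t q) :
    q ∈ T.chronologicalFuture p := by
  obtain ⟨-, γ, hγ, h0, h1⟩ := h
  refine ⟨γ, 0, t, ⟨isTimelikeCurve_of_isMIntegralCurveOn hbox hV ht hγ, fun s hs => ?_⟩, h0, h1⟩
  rw [velocity_of_isMIntegralCurveOn ht hs hγ]
  exact hT _

/-- The product of the orienting field with `V` is continuous and never zero, so it has constant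
sign on the connected `M`. -/
lemma TimeOrientation.forall_val_neg_or_forall_val_pos [ConnectedSpace M] (T : TimeOrientation g)
    (hVc : Continuous fun p => (⟨p, V p⟩ : TangentBundle (𝓡∂ (n + 1)) M))
    (hV : ∀ p, g.IsTimelike (V p)) :
    (∀ p, g.val p (T.field p) (V p) < 0) ∨ ∀ p, g.val p (T.field p) (-V p) < 0 := by
  by_contra! hcon
  obtain ⟨⟨p, hp⟩, q, hq⟩ := hcon
  rw [map_neg, neg_nonneg] at hq
  obtain ⟨r, hr⟩ := mem_range_of_exists_le_of_exists_ge
    (g.continuous_val (f := id) T.continuous hVc) ⟨q, hq⟩ ⟨p, hp⟩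
  exact (T.timelike r).val_ne_zero (hV r) hr

lemma mem_chronologicalFuture_union_of_reach [ConnectedSpace M] (T : TimeOrientation g)
    (hbox : ∀ p, Nonempty (FlowBox F (𝓡∂ (n + 1)) V 1 p))
    (hVc : Continuous fun p => (⟨p, V p⟩ : TangentBundle (𝓡∂ (n + 1)) M))
    (hV : ∀ p, g.IsTimelike (V p)) {p q : M} {t : ℝ} (ht : 0 < t) (h : Reach V p t q) :
    q ∈ T.chronologicalFuture p ∪ T.chronologicalPast p ∧
      p ∈ T.chronologicalFuture q ∪ T.chronologicalPast q := by
  rcases T.forall_val_neg_or_forall_val_pos hVc hV with hT | hT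
  · have := mem_chronologicalFuture_of_reach T hbox hV hT ht h
    exact ⟨Or.inl this, Or.inr this⟩
  · have := mem_chronologicalFuture_of_reach T (V := fun p => -V p) (fun p => (hbox p).map (·.neg))
      (fun p => by simpa [LorentzianMetric.IsTimelike] using hV p) hT ht (reach_neg_iff.2 h)
    exact ⟨Or.inr this, Or.inl this⟩

/-- The point `p` is added separately because curves of length `0` are allowed and `p` need not lie
in `I(p)`. -/
lemma exists_isCompact_of_reach [T2Space M] [ConnectedSpace M] {T : TimeOrientation g}
    (hT : T.IsCausallyCompact) (hbox : ∀ p, Nonempty (FlowBox F (𝓡∂ (n + 1)) V 1 p))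
    (hVc : Continuous fun p => (⟨p, V p⟩ : TangentBundle (𝓡∂ (n + 1)) M))
    (hV : ∀ p, g.IsTimelike (V p)) (p : M) :
    ∃ K : Set M, IsCompact K ∧ ∀ t q, Reach V p t q ∨ Reach V q t p → q ∈ K := by
  refine ⟨_, (hT p).union (isCompact_singleton (x := p)), fun t q h => ?_⟩
  have ht : 0 ≤ t := h.elim (·.1) (·.1)
  rcases ht.eq_or_lt with rfl | ht
  · exact Or.inr (h.elim (fun h => h.eq_of_zero.symm) fun h => h.eq_of_zero)
  · refine Or.inl (subset_closure ?_)
    rcases h with h | h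
    · exact (mem_chronologicalFuture_union_of_reach T hbox hVc hV ht h).1
    · exact (mem_chronologicalFuture_union_of_reach T hbox hVc hV ht h).2

/-- Being a timelike curve is a local property. -/
lemma LorentzianMetric.isTimelikeCurve_of_eventuallyEq {γ : ℝ → M} {a c : ℝ} (hac : a < c)
    (h : ∀ t ∈ Icc a c, ∃ η : ℝ → M, γ =ᶠ[𝓝[Icc a c] t] η ∧
      ∃ a' c', Icc a' c' ∈ 𝓝[Icc a c] t ∧ t ∈ Icc a' c' ∧ g.IsTimelikeCurve η a' c') :
    g.IsTimelikeCurve γ a c := by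
  refine ⟨hac, fun t ht => ?_, fun t ht => ?_⟩
  · obtain ⟨η, hη, a', c', hm, ht', hc⟩ := h t ht
    exact ((hc.contMDiffOn t ht').mono_of_mem_nhdsWithin hm).congr_of_eventuallyEq hη
      (hη.self_of_nhdsWithin ht)
  · obtain ⟨η, hη, a', c', hm, ht', hc⟩ := h t ht
    have h1 : HasMFDerivWithinAt 𝓘(ℝ, ℝ) (𝓡∂ (n + 1)) η (Icc a' c') t
        (mfderivWithin 𝓘(ℝ, ℝ) (𝓡∂ (n + 1)) η (Icc a' c') t) :=
      ((hc.contMDiffOn t ht').mdifferentiableWithinAt one_ne_zero).hasMFDerivWithinAt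
    have h2 := (h1.mono_of_mem_nhdsWithin hm).congr_of_eventuallyEq hη (hη.self_of_nhdsWithin ht)
    rw [velocity_eq hac ht h2]
    have aux : ∀ p p' : M, p = p' → ∀ v : EuclideanSpace ℝ (Fin (n + 1)),
        g.IsTimelike (p := p) v → g.IsTimelike (p := p') v := by
      rintro p _ rfl v hv
      exact hv
    exact aux _ _ (hη.self_of_nhdsWithin ht).symm _ (hc.timelike t ht')

end Lorentz

/-! ### Closing up an almost closed timelike curve. -/

section NoReturn

open Filter Topology

/-- The transition happens for `s` between `-7ρ/16` and `-ρ/4`: after the gluing at `-ρ/2`, leaving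
an overlap of length `ρ/16`, and before the start and end coordinates, which exceed `-ρ/4`. -/
lemma exists_cutoff {ρ : ℝ} (hρ : 0 < ρ) : ∃ χ : ℝ → ℝ, ContDiff ℝ 1 χ ∧
    (∀ s ≤ -(7 / 16 * ρ), χ s = 0) ∧ (∀ s, -(ρ / 4) ≤ s → χ s = 1) ∧ (∀ s, χ s ∈ Icc (0 : ℝ) 1) ∧
    ∃ C, ∀ s, |s| < ρ → |deriv χ s| ≤ C := by
  let χ : ℝ → ℝ := fun s => Real.smoothTransition ((s + 7 / 16 * ρ) / (3 / 16 * ρ))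
  have hχ : ContDiff ℝ 1 χ :=
    (Real.smoothTransition.contDiff (n := 1)).comp
      ((contDiff_id.add contDiff_const).div_const _)
  refine ⟨χ, hχ, fun s hs => ?_, fun s hs => ?_, fun s => ?_, ?_⟩
  · exact Real.smoothTransition.zero_of_nonpos
      (div_nonpos_of_nonpos_of_nonneg (by linarith) (by positivity))
  · refine Real.smoothTransition.one_of_one_le ?_
    rw [one_le_div (by positivity)]
    linarith
  · exact ⟨Real.smoothTransition.nonneg _, Real.smoothTransition.le_one _⟩
  · obtain ⟨C, hC⟩ := (isCompact_Icc (a := -ρ) (b := ρ)).exists_bound_of_continuousOn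
      (hχ.continuous_deriv_one).continuousOn
    exact ⟨C, fun s hs => hC s (abs_le.1 hs.le)⟩

variable {n : ℕ} {M : Type*} [TopologicalSpace M] [ChartedSpace (EuclideanHalfSpace (n + 1)) M]
  [IsManifold (𝓡∂ (n + 1)) ∞ M] {g : LorentzianMetric n M}
  {V : ∀ p : M, TangentSpace (𝓡∂ (n + 1)) p} {F : Type} [NormedAddCommGroup F] [NormedSpace ℝ F]
  {q : M}

namespace FlowBox

variable (b : FlowBox F (𝓡∂ (n + 1)) V 1 q)

omit [IsManifold (𝓡∂ (n + 1)) ∞ M] in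
lemma isOpen_dom (hb : b.times = univ) : IsOpen b.dom := by
  rw [dom, interval, hb, inter_univ]
  exact Metric.isOpen_ball.prod isOpen_Ioo

omit [IsManifold (𝓡∂ (n + 1)) ∞ M] in
lemma mdifferentiableAt_param (hb : b.times = univ) {z : F × ℝ} (hz : z ∈ b.dom) :
    MDifferentiableAt 𝓘(ℝ, F × ℝ) (𝓡∂ (n + 1)) b.param z :=
  ((b.contMDiffOn_param z hz).contMDiffAt ((b.isOpen_dom hb).mem_nhds hz)).mdifferentiableAt
    (by simp)

omit [IsManifold (𝓡∂ (n + 1)) ∞ M] in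
lemma hasMFDerivAt_param_comp (hb : b.times = univ) {w : ℝ → F × ℝ} {w' : F × ℝ} {t : ℝ}
    (hz : w t ∈ b.dom) (hw : HasDerivAt w w' t) :
    HasMFDerivAt 𝓘(ℝ, ℝ) (𝓡∂ (n + 1)) (b.param ∘ w) t
      ((mfderiv 𝓘(ℝ, F × ℝ) (𝓡∂ (n + 1)) b.param (w t)).comp
        ((1 : ℝ →L[ℝ] ℝ).smulRight w' : ℝ →L[ℝ] F × ℝ)) :=
  HasMFDerivAt.comp t (b.mdifferentiableAt_param hb hz).hasMFDerivAt
    hw.hasFDerivAt.hasMFDerivAt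

lemma mfderiv_param_center (hb : b.times = univ) :
    mfderiv 𝓘(ℝ, F × ℝ) (𝓡∂ (n + 1)) b.param (0, 0) ((0, 1) : F × ℝ) = V (b.param (0, 0)) := by
  have hd : ((0, 0) : F × ℝ) ∈ b.dom := b.chart_center ▸ b.chart_mem_dom b.mem_source
  have h1 := b.hasMFDerivAt_param_comp hb (w := fun s => ((0 : F), s)) (t := 0) hd
    ((hasDerivAt_const _ _).prodMk (hasDerivAt_id _))
  have h2 := b.isMIntegralCurveOn 0 hd.1 0 hd.2
  have hn : Ioo (-b.radius) b.radius ∩ b.times ∈ 𝓝 (0 : ℝ) := by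
    rw [hb, inter_univ]
    exact isOpen_Ioo.mem_nhds ⟨by linarith [b.radius_pos], b.radius_pos⟩
  have h3 := hasMFDerivAt_unique h1 (h2.hasMFDerivAt hn)
  have h4 := DFunLike.congr_fun h3 (1 : ℝ)
  let D : F × ℝ →L[ℝ] EuclideanSpace ℝ (Fin (n + 1)) :=
    mfderiv 𝓘(ℝ, F × ℝ) (𝓡∂ (n + 1)) b.param (0, 0)
  let v : EuclideanSpace ℝ (Fin (n + 1)) := V (b.param (0, 0))
  have h5 : D ((1 : ℝ) • ((0, 1) : F × ℝ)) = (1 : ℝ) • v := h4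
  rwa [one_smul, one_smul] at h5

/-- Vectors close to the direction of the flow are timelike. -/
lemma exists_isTimelike_mfderiv_param (hb : b.times = univ) (hV : ∀ p, g.IsTimelike (V p)) :
    ∃ ρ, 0 < ρ ∧ ρ ≤ b.radius ∧ ∀ (y w : F) (s : ℝ), ‖y‖ < ρ → ‖w‖ < ρ → |s| < ρ →
      g.IsTimelike (mfderiv 𝓘(ℝ, F × ℝ) (𝓡∂ (n + 1)) b.param (y, s) ((w, 1) : F × ℝ)) := by
  have ho := b.isOpen_dom hb
  have hd : ((0, 0) : F × ℝ) ∈ b.dom := b.chart_center ▸ b.chart_mem_dom b.mem_source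
  have h1 := ContMDiffOn.continuousOn_tangentMapWithin b.contMDiffOn_param
    (by simp) ho.uniqueMDiffOn
  let j : (F × F) × ℝ → TangentBundle 𝓘(ℝ, F × ℝ) (F × ℝ) :=
    fun z => (tangentBundleModelSpaceHomeomorph 𝓘(ℝ, F × ℝ)).symm ((z.1.1, z.2), (z.1.2, 1))
  have hj : Continuous j := by
    refine (tangentBundleModelSpaceHomeomorph 𝓘(ℝ, F × ℝ)).symm.continuous.comp ?_
    exact (by fun_prop : Continuous fun z : (F × F) × ℝ =>
      (((z.1.1, z.2), (z.1.2, 1)) : (F × ℝ) × (F × ℝ)))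
  have hj0 : j ((0, 0), 0) ∈ Bundle.TotalSpace.proj ⁻¹' b.dom := hd
  have h2 : ContinuousAt (tangentMapWithin 𝓘(ℝ, F × ℝ) (𝓡∂ (n + 1)) b.param b.dom)
      (j ((0, 0), 0)) :=
    h1.continuousAt ((ho.preimage (FiberBundle.continuous_proj _ _)).mem_nhds hj0)
  have hm : ∀ z ∈ b.dom, mfderivWithin 𝓘(ℝ, F × ℝ) (𝓡∂ (n + 1)) b.param b.dom z =
      mfderiv 𝓘(ℝ, F × ℝ) (𝓡∂ (n + 1)) b.param z := fun z hz =>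
    mfderivWithin_of_mem_nhds (ho.mem_nhds hz)
  have h3 : tangentMapWithin 𝓘(ℝ, F × ℝ) (𝓡∂ (n + 1)) b.param b.dom (j ((0, 0), 0)) ∈
      {v : TangentBundle (𝓡∂ (n + 1)) M | g.IsTimelike v.2} := by
    change g.IsTimelike (mfderivWithin 𝓘(ℝ, F × ℝ) (𝓡∂ (n + 1)) b.param b.dom (0, 0)
      ((0, 1) : F × ℝ))
    rw [hm _ hd, b.mfderiv_param_center hb]
    exact hV _
  have h4 : ∀ᶠ z in 𝓝 (((0, 0), 0) : (F × F) × ℝ),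
      tangentMapWithin 𝓘(ℝ, F × ℝ) (𝓡∂ (n + 1)) b.param b.dom (j z) ∈
        {v : TangentBundle (𝓡∂ (n + 1)) M | g.IsTimelike v.2} :=
    hj.continuousAt.eventually (h2.eventually (g.isOpen_setOf_isTimelike.mem_nhds h3))
  obtain ⟨ε, hε, H⟩ := Metric.eventually_nhds_iff.1 h4
  refine ⟨min ε b.radius, lt_min hε b.radius_pos, min_le_right _ _, fun y w s hy hw hs => ?_⟩
  have hd' : ((y, s) : F × ℝ) ∈ b.dom := by
    refine ⟨by simpa using hy.trans_le (min_le_right _ _),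
      abs_lt.1 (hs.trans_le (min_le_right _ _)), ?_⟩
    rw [hb]; exact mem_univ _
  have h5 := H (y := ((y, w), s)) (by
    simp only [Prod.dist_eq, dist_zero_right, Real.norm_eq_abs]
    exact max_lt (max_lt (hy.trans_le (min_le_left _ _)) (hw.trans_le (min_le_left _ _)))
      (hs.trans_le (min_le_left _ _)))
  change g.IsTimelike (mfderivWithin 𝓘(ℝ, F × ℝ) (𝓡∂ (n + 1)) b.param b.dom (y, s)
      ((w, 1) : F × ℝ)) at h5
  rwa [hm _ hd'] at h5

/-- A graph `s ↦ (Y s, s)` with small slope has velocity `(Y', 1)`, which is close to the flow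
direction. The shift `σ` matches its parameter to that of the curve it replaces. -/
lemma isTimelikeCurve_param (hb : b.times = univ) {ρ : ℝ} (hρ : ρ ≤ b.radius)
    (H : ∀ (y w : F) (s : ℝ), ‖y‖ < ρ → ‖w‖ < ρ → |s| < ρ →
      g.IsTimelike (mfderiv 𝓘(ℝ, F × ℝ) (𝓡∂ (n + 1)) b.param (y, s) ((w, 1) : F × ℝ)))
    {Y : ℝ → F} (hY : ContDiff ℝ 1 Y) {a c σ : ℝ} (hac : a < c)
    (h : ∀ t ∈ Icc a c, ‖Y (t + σ)‖ < ρ ∧ ‖deriv Y (t + σ)‖ < ρ ∧ |t + σ| < ρ) :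
    g.IsTimelikeCurve (fun t => b.param (Y (t + σ), t + σ)) a c := by
  have hd : ∀ t ∈ Icc a c, ((Y (t + σ), t + σ) : F × ℝ) ∈ b.dom := fun t ht => by
    obtain ⟨h1, -, h2⟩ := h t ht
    refine ⟨by simpa using h1.trans_le hρ, abs_lt.1 (h2.trans_le hρ), ?_⟩
    rw [hb]; exact mem_univ _
  refine ⟨hac, ?_, fun t ht => ?_⟩
  · have h1 : ContDiff ℝ 1 fun t : ℝ => (Y (t + σ), t + σ) :=
      (hY.comp (contDiff_id.add contDiff_const)).prodMk (contDiff_id.add contDiff_const)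
    exact ContMDiffOn.comp b.contMDiffOn_param h1.contMDiff.contMDiffOn hd
  · obtain ⟨h1, h2, h3⟩ := h t ht
    have hw : HasDerivAt (fun t : ℝ => (Y (t + σ), t + σ)) (deriv Y (t + σ), 1) t :=
      (((hY.differentiable (by simp)) (t + σ)).hasDerivAt.comp_add_const t σ).prodMk
        ((hasDerivAt_id t).add_const σ)
    have h4 := b.hasMFDerivAt_param_comp hb (w := fun t => (Y (t + σ), t + σ)) (hd t ht) hw
    have h5 := velocity_eq hac ht (h4.hasMFDerivWithinAt (s := Icc a c))
    have h6 : velocity (n := n) (b.param ∘ fun t => (Y (t + σ), t + σ)) a c t =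
        mfderiv 𝓘(ℝ, F × ℝ) (𝓡∂ (n + 1)) b.param (Y (t + σ), t + σ)
          ((deriv Y (t + σ), 1) : F × ℝ) := by
      rw [h5]
      let D : F × ℝ →L[ℝ] EuclideanSpace ℝ (Fin (n + 1)) :=
        mfderiv 𝓘(ℝ, F × ℝ) (𝓡∂ (n + 1)) b.param (Y (t + σ), t + σ)
      change D ((1 : ℝ) • ((deriv Y (t + σ), 1) : F × ℝ)) = D (deriv Y (t + σ), 1)
      rw [one_smul]
    change g.IsTimelike (velocity (n := n) (b.param ∘ fun t => (Y (t + σ), t + σ)) a c t)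
    rw [h6]
    exact H _ _ _ h1 h2 h3

/-- If there are no closed timelike curves, then the integral curves of a timelike vector field
do not return to small neighbourhoods. -/
theorem exists_nhds_not_return [T2Space M] (hb : b.times = univ)
    (hbox : ∀ p, Nonempty (FlowBox F (𝓡∂ (n + 1)) V 1 p)) (hV : ∀ p, g.IsTimelike (V p))
    (hg : g.IsChronological) : ∃ N ∈ 𝓝 q, ∃ τ : ℝ,
      ∀ t r r', τ ≤ t → Reach V r t r' → r ∈ N → r' ∉ N := by
  obtain ⟨ρ, hρ, hρb, H⟩ := b.exists_isTimelike_mfderiv_param hb hV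
  obtain ⟨χ, hχ, hχ0, hχ1, hχI, C, hC⟩ := exists_cutoff hρ
  have hC0 : 0 ≤ C := (abs_nonneg _).trans (hC 0 (by simpa using hρ))
  -- Two points of the `ε`-ball are at most `2ε` apart, so the interpolating graph has slope at most
  -- `2εC ≤ ρ/2`. Using `C + 1` keeps the denominator positive.
  set ε : ℝ := ρ / (4 * (C + 1)) with hε
  have hε0 : 0 < ε := by positivity
  have hεC : ε * (C + 1) = ρ / 4 := by rw [hε]; field_simp
  have hεC' : 0 ≤ ε * C := by positivity
  have hchart : ContinuousAt b.chart q :=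
    (b.contMDiffOn_chart.continuousOn).continuousAt (b.isOpen_source.mem_nhds b.mem_source)
  refine ⟨b.source ∩ b.chart ⁻¹' (Metric.ball 0 ε ×ˢ Ioo (-(ρ / 4)) (ρ / 4)),
    inter_mem (b.isOpen_source.mem_nhds b.mem_source) (hchart.preimage_mem_nhds
      ((Metric.isOpen_ball.prod isOpen_Ioo).mem_nhds ?_)), ρ, ?_⟩
  · rw [b.chart_center]
    exact ⟨Metric.mem_ball_self hε0, by linarith, by linarith⟩
  rintro t r r' ht ⟨-, γ, hγ, rfl, rfl⟩ ⟨hr, hy₀, hs₀⟩ ⟨hr', hy₁, hs₁⟩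
  rw [mem_ball_zero_iff] at hy₀ hy₁
  set y₀ := (b.chart (γ 0)).1 with hy₀'
  set y₁ := (b.chart (γ t)).1 with hy₁'
  set s₀ := (b.chart (γ 0)).2 with hs₀'
  set s₁ := (b.chart (γ t)).2 with hs₁'
  obtain ⟨hs₀l, hs₀u⟩ := hs₀
  obtain ⟨hs₁l, hs₁u⟩ := hs₁
  -- The graph leaves the returning line `y₁` and joins the line `y₀` on which the curve began.
  let Y : ℝ → F := fun s => y₁ + χ s • (y₀ - y₁)
  have hY : ContDiff ℝ 1 Y := contDiff_const.add (hχ.smul contDiff_const)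
  have hYb : ∀ s, |s| < ρ → ‖Y s‖ < ρ ∧ ‖deriv Y s‖ < ρ := by
    intro s hs
    have hn : ‖y₀ - y₁‖ ≤ 2 * ε := (norm_sub_le _ _).trans (by linarith)
    constructor
    · have h1 : Y s ∈ Metric.ball (0 : F) ε := by
        have := (convex_ball (0 : F) ε).add_smul_sub_mem (x := y₁) (y := y₀)
          (by simpa using hy₁) (by simpa using hy₀) (hχI s)
        exact this
      rw [mem_ball_zero_iff] at h1
      nlinarith
    · have h1 : HasDerivAt Y (deriv χ s • (y₀ - y₁)) s :=
        (((hχ.differentiable (by simp)) s).hasDerivAt.smul_const _).const_add _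
      rw [h1.deriv, norm_smul, Real.norm_eq_abs]
      calc |deriv χ s| * ‖y₀ - y₁‖ ≤ C * (2 * ε) :=
            mul_le_mul (hC s hs) hn (norm_nonneg _) hC0
        _ < ρ := by linarith
  set σ := s₁ - t with hσ
  set T := s₀ - σ with hT
  -- The parameters `u` and `T` correspond to the time coordinates `-ρ/2` and `s₀`. Since `t ≥ ρ`
  -- and `s₁ < ρ/4`, the switch to the bent curve occurs at `u > 0`.
  set u := -(ρ / 2) - σ with hu
  have hu0 : 0 < u := by linarith
  have huT : u < T := by linarith
  let δ : ℝ → M := fun v => b.param (Y (v + σ), v + σ)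
  have hδ : ∀ {a c : ℝ}, a < c → (∀ v ∈ Icc a c, |v + σ| < ρ) → g.IsTimelikeCurve δ a c :=
    fun hac h => b.isTimelikeCurve_param hb hρb H hY hac fun v hv =>
      ⟨(hYb _ (h v hv)).1, (hYb _ (h v hv)).2, h v hv⟩
  -- Going back from `t`, the curve follows the line `y₁` through the box, and so does `δ` before
  -- the transition starts.
  have hγδ : ∀ v ∈ Icc 0 t, -ρ < v + σ → v + σ ≤ -(7 / 16 * ρ) → γ v = δ v := by
    intro v hv h1 h2
    have h3 := b.eq_param one_ne_zero hbox (convex_Icc 0 t) hγ (t₁ := t) (t := v)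
      ⟨by linarith, le_rfl⟩ hv hr' (by
        rw [interval, hb, inter_univ, ← hs₁']
        constructor <;> linarith)
    rw [h3, ← hy₁', ← hs₁']
    simp only [δ, Y, hχ0 _ h2, zero_smul, add_zero]
    congr 2
    rw [hσ]; ring
  have h0t : 0 < t := by linarith
  have hγt := isTimelikeCurve_of_isMIntegralCurveOn (g := g) hbox hV h0t hγ
  let c : ℝ → M := fun v => if v ≤ u then γ v else δ v
  -- The two pieces agree on an interval beyond `u`, so `c` is timelike without a corner there. No
  -- matching of velocities is needed at the common end point.
  refine hg ⟨c, 0, T, LorentzianMetric.isTimelikeCurve_of_eventuallyEq (by linarith) ?_, ?_⟩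
  · intro v hv
    by_cases hvu : v ≤ u
    · have hvt : v < u + ρ / 16 := by linarith
      refine ⟨γ, ?_, 0, t, ?_, ⟨hv.1, by linarith⟩, hγt⟩
      · filter_upwards [inter_mem_nhdsWithin (Icc 0 T) (Iio_mem_nhds hvt)] with w hw
        obtain ⟨⟨hw0, hwT⟩, hw'⟩ := hw
        rw [mem_Iio] at hw'
        by_cases hwu : w ≤ u
        · exact if_pos hwu
        · refine (if_neg hwu).trans (hγδ w ⟨hw0, by linarith⟩ ?_ ?_).symm <;> linarith
      · filter_upwards [inter_mem_nhdsWithin (Icc 0 T) (Iio_mem_nhds hvt)] with w hw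
        obtain ⟨⟨hw0, hwT⟩, hw'⟩ := hw
        rw [mem_Iio] at hw'
        exact ⟨hw0, by linarith⟩
    · rw [not_le] at hvu
      refine ⟨δ, ?_, u, T, ?_, ⟨hvu.le, hv.2⟩, hδ huT fun w hw => ?_⟩
      · filter_upwards [mem_nhdsWithin_of_mem_nhds (Ioi_mem_nhds hvu)] with w hw
        exact if_neg (not_le.2 hw)
      · filter_upwards [inter_mem_nhdsWithin (Icc 0 T) (Ioi_mem_nhds hvu)] with w hw
        exact ⟨le_of_lt hw.2, hw.1.2⟩
      · rw [abs_lt]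
        constructor <;> linarith [hw.1, hw.2]
  · have h1 : c 0 = γ 0 := if_pos hu0.le
    have h2 : c T = δ T := if_neg (not_le.2 huT)
    have h3 : T + σ = s₀ := by rw [hT]; ring
    rw [h1, h2]
    simp only [δ, h3, Y, hχ1 s₀ hs₀l.le, one_smul, add_sub_cancel]
    exact (b.param_chart _ hr).symm

end FlowBox

end NoReturn

/-! ### The diffeomorphism between the ends, and the flow lines. -/

section Ends

variable {E F E₁ E₂ : Type} [NormedAddCommGroup E] [NormedSpace ℝ E] [NormedAddCommGroup F]
  [NormedSpace ℝ F] [NormedAddCommGroup E₁] [NormedSpace ℝ E₁] [NormedAddCommGroup E₂]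
  [NormedSpace ℝ E₂] {H H₁ H₂ : Type*} [TopologicalSpace H] [TopologicalSpace H₁]
  [TopologicalSpace H₂] {I : ModelWithCorners ℝ E H} {J₁ : ModelWithCorners ℝ E₁ H₁}
  {J₂ : ModelWithCorners ℝ E₂ H₂} {M : Type*} [TopologicalSpace M] [ChartedSpace H M]
  [IsManifold I ∞ M] [T2Space M] {S₁ : Type*} [TopologicalSpace S₁] [ChartedSpace H₁ S₁]
  [IsManifold J₁ ∞ S₁] {S₂ : Type*} [TopologicalSpace S₂] [ChartedSpace H₂ S₂]
  [IsManifold J₂ ∞ S₂] {V : ∀ p : M, TangentSpace I p} {ι₁ : S₁ → M} {ι₂ : S₂ → M}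

namespace IsCrossingField

omit [IsManifold I ∞ M] [IsManifold J₁ ∞ S₁] [IsManifold J₂ ∞ S₂] in
lemma source_ι_neg_source_ι (h : IsCrossingField F V (range ι₁) (range ι₂))
    (hι : Function.Injective ι₁) (x : S₁) : h.source (ι₂ (h.neg.source (ι₁ x))) = x := by
  refine hι ?_
  rw [h.ι_source, h.neg.ι_source]
  exact (h.entry_eq (mem_range_self x) (h.reach_exit (ι₁ x))).2

/-- The diffeomorphism between the ends that follows the integral curves. -/
def endDiffeomorph (h : IsCrossingField F V (range ι₁) (range ι₂))
    (hι₁ : Manifold.IsSmoothEmbedding J₁ I ∞ ι₁) (hι₂ : Manifold.IsSmoothEmbedding J₂ I ∞ ι₂) :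
    Diffeomorph J₁ J₂ S₁ S₂ ∞ where
  toFun x := h.neg.source (ι₁ x)
  invFun y := h.source (ι₂ y)
  left_inv := h.source_ι_neg_source_ι hι₁.isEmbedding.injective
  right_inv y := by
    refine hι₂.isEmbedding.injective ?_
    rw [h.neg.ι_source, h.ι_source]
    exact (h.neg.entry_eq (mem_range_self y) (h.reach_entry (ι₂ y)).neg).2
  contMDiff_toFun := contMDiff_infty_of_nat fun _ hk x =>
    (h.neg.contMDiffAt_source hι₂ hk _).comp x ((hι₁.contMDiff x).of_le (by exact_mod_cast le_top))
  contMDiff_invFun := contMDiff_infty_of_nat fun _ hk y =>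
    (h.contMDiffAt_source hι₁ hk _).comp y ((hι₂.contMDiff y).of_le (by exact_mod_cast le_top))

omit [IsManifold I ∞ M] [IsManifold J₁ ∞ S₁] in
-- Rescaling time to `[0,1]` multiplies the velocity by the length of the integral curve.
lemma exists_isMIntegralCurveOn_flowMap {A₂ : Set M} (h : IsCrossingField F V (range ι₁) A₂)
    (x : S₁) : ∃ γ : ℝ → M, IsMIntegralCurveOn γ (h.length x • V) (Icc 0 1) ∧
      ContMDiffOn 𝓘(ℝ, ℝ) I 1 γ (Icc 0 1) ∧ ∀ t : Icc (0 : ℝ) 1, h.flowMap (x, t) = γ t := by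
  obtain ⟨h0, γ, hγ, hx, -⟩ := h.reach_exit (ι₁ x)
  have hmul : ∀ t ∈ Icc (0 : ℝ) 1, t * h.length x ∈ Icc 0 (h.length x) := fun t ht =>
    ⟨mul_nonneg ht.1 h0, mul_le_of_le_one_left h0 ht.2⟩
  refine ⟨γ ∘ (· * h.length x), (hγ.comp_mul _).mono hmul, ?_, fun t => ?_⟩
  · have h1 := contMDiffOn_of_isMIntegralCurveOn one_ne_zero (h.nonempty_flowBox one_ne_zero)
      (convex_Icc 0 (h.exitTime (ι₁ x))) hγ
    have h2 : ContDiff ℝ 1 fun t : ℝ => t * h.length x := contDiff_id.mul contDiff_const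
    exact ContMDiffOn.comp (t := Icc 0 (h.exitTime (ι₁ x))) (by exact_mod_cast h1)
      h2.contMDiff.contMDiffOn hmul
  have h1 := reach_of_isMIntegralCurveOn (hγ.mono (Icc_subset_Icc_right (hmul t t.2).2))
    (hmul t t.2).1
  rw [hx, sub_zero] at h1
  exact (h.reach_flowMap (x, t)).eq_right one_ne_zero (h.nonempty_flowBox one_ne_zero) h1

end IsCrossingField

end Ends

/-! ### From Lorentzian cobordisms to crossing fields. -/

section Cobordism

variable {n : ℕ} {M : Type*} [TopologicalSpace M] [ChartedSpace (EuclideanHalfSpace (n + 1)) M]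
  [IsManifold (𝓡∂ (n + 1)) ∞ M]

/-- The two sides are based at `(extChartAt p).symm (extChartAt p p)` and at `p`. These points are
equal but not definitionally so, which requires a transport between tangent spaces. -/
lemma chartField_extChartAt_self (V : ∀ p : M, TangentSpace (𝓡∂ (n + 1)) p) (p : M) :
    chartField (𝓡∂ (n + 1)) V p (extChartAt (𝓡∂ (n + 1)) p p) =
      mfderiv (𝓡∂ (n + 1)) 𝓘(ℝ, EuclideanSpace ℝ (Fin (n + 1)))
        (extChartAt (𝓡∂ (n + 1)) p) p (V p) := by
  have aux : ∀ q : M, q = p → (mfderiv (𝓡∂ (n + 1)) 𝓘(ℝ, EuclideanSpace ℝ (Fin (n + 1)))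
      (extChartAt (𝓡∂ (n + 1)) p) q (V q) : EuclideanSpace ℝ (Fin (n + 1))) =
      mfderiv (𝓡∂ (n + 1)) 𝓘(ℝ, EuclideanSpace ℝ (Fin (n + 1)))
        (extChartAt (𝓡∂ (n + 1)) p) p (V p) := by
    rintro _ rfl
    rfl
  exact aux _ (extChartAt_to_inv p)

lemma isInward_iff {V : ∀ p : M, TangentSpace (𝓡∂ (n + 1)) p} {p : M} :
    IsInward (V p) ↔ 0 < chartField (𝓡∂ (n + 1)) V p (extChartAt (𝓡∂ (n + 1)) p p) 0 := by
  rw [chartField_extChartAt_self]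
  rfl

lemma isOutward_iff {V : ∀ p : M, TangentSpace (𝓡∂ (n + 1)) p} {p : M} :
    IsOutward (V p) ↔ chartField (𝓡∂ (n + 1)) V p (extChartAt (𝓡∂ (n + 1)) p p) 0 < 0 := by
  rw [chartField_extChartAt_self, ← neg_pos]
  let D : EuclideanSpace ℝ (Fin (n + 1)) →L[ℝ] EuclideanSpace ℝ (Fin (n + 1)) :=
    mfderiv (𝓡∂ (n + 1)) 𝓘(ℝ, EuclideanSpace ℝ (Fin (n + 1))) (extChartAt (𝓡∂ (n + 1)) p) p
  let v : EuclideanSpace ℝ (Fin (n + 1)) := V p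
  change 0 < D (-v) 0 ↔ 0 < -(D v 0)
  rw [map_neg]
  rfl

lemma chartField_ne_zero {V : ∀ p : M, TangentSpace (𝓡∂ (n + 1)) p} {p : M} (hV : V p ≠ 0) :
    chartField (𝓡∂ (n + 1)) V p (extChartAt (𝓡∂ (n + 1)) p p) ≠ 0 := by
  rw [chartField_extChartAt_self]
  intro h
  refine hV ((isInvertible_mfderiv_extChartAt (I := 𝓡∂ (n + 1))
    (mem_extChartAt_source p)).injective ?_)
  rw [map_zero]
  exact h

variable {g : LorentzianMetric n M}

lemma LorentzianMetric.IsTimelike.ne_zero {p : M} {v : TangentSpace (𝓡∂ (n + 1)) p}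
    (hv : g.IsTimelike v) : v ≠ 0 := by
  rintro rfl
  simp [IsTimelike] at hv

/-- A timelike vector field that crosses the boundary as required by a cobordism crosses a causally
compact chronological manifold from one end to the other. -/
lemma isCrossingField [T2Space M] [ConnectedSpace M] {T : TimeOrientation g} {A₁ A₂ : Set M}
    {V : ∀ p : M, TangentSpace (𝓡∂ (n + 1)) p}
    (hVs : ContMDiff (𝓡∂ (n + 1)) (𝓡∂ (n + 1)).tangent ∞
      fun p => (⟨p, V p⟩ : TangentBundle (𝓡∂ (n + 1)) M))
    (hV : ∀ p, g.IsTimelike (V p)) (hA : A₁ ∪ A₂ = (𝓡∂ (n + 1)).boundary M)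
    (h₁ : ∀ p ∈ A₁, IsInward (V p)) (h₂ : ∀ p ∈ A₂, IsOutward (V p))
    (hcompact : T.IsCausallyCompact) (hchron : g.IsChronological) :
    IsCrossingField (EuclideanSpace ℝ (Fin n)) V A₁ A₂ := by
  have hbox : ∀ k : ℕ, k ≠ 0 → ∀ p, ∃ b : FlowBox (EuclideanSpace ℝ (Fin n)) (𝓡∂ (n + 1)) V k p,
      (p ∈ A₁ → b.times = Ici 0) ∧ (p ∈ A₂ → b.times = Iic 0) ∧
        (p ∉ A₁ → p ∉ A₂ → b.times = univ) := by
    intro k hk p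
    by_cases hp₁ : p ∈ A₁
    · have h := isInward_iff.1 (h₁ p hp₁)
      obtain ⟨b, hb⟩ := exists_flowBox_boundary hVs hk (hA ▸ Or.inl hp₁) (Or.inl ⟨rfl, h⟩)
      refine ⟨b, fun _ => hb, fun hp₂ => ?_, fun hp => absurd hp₁ hp⟩
      -- A vector cannot point both inward and outward, so `A₁` and `A₂` do not meet.
      exact absurd (isOutward_iff.1 (h₂ p hp₂)) h.not_gt
    by_cases hp₂ : p ∈ A₂
    · obtain ⟨b, hb⟩ := exists_flowBox_boundary hVs hk (hA ▸ Or.inr hp₂)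
        (Or.inr ⟨rfl, isOutward_iff.1 (h₂ p hp₂)⟩)
      exact ⟨b, fun hp => absurd hp hp₁, fun _ => hb, fun _ hp => absurd hp₂ hp⟩
    · have hp : (𝓡∂ (n + 1)).IsInteriorPoint p := by
        rw [ModelWithCorners.isInteriorPoint_iff_not_isBoundaryPoint]
        intro hp
        have : p ∈ A₁ ∪ A₂ := hA ▸ hp
        exact this.elim hp₁ hp₂
      obtain ⟨b, hb⟩ := exists_flowBox_interior hVs hk hp (chartField_ne_zero (hV p).ne_zero)
      exact ⟨b, fun hp => absurd hp hp₁, fun hp => absurd hp hp₂, fun _ _ => hb⟩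
  have hbox₁ : ∀ p, Nonempty (FlowBox (EuclideanSpace ℝ (Fin n)) (𝓡∂ (n + 1)) V 1 p) :=
    fun p => ⟨(hbox 1 one_ne_zero p).choose⟩
  refine ⟨hbox, exists_isCompact_of_reach hcompact hbox₁ hVs.continuous hV, fun q hq₁ hq₂ => ?_⟩
  obtain ⟨b, -, -, hb⟩ := hbox 1 one_ne_zero q
  exact b.exists_nhds_not_return (hb hq₁ hq₂) hbox₁ hV hchron

lemma LorentzianMetric.isTimelikeCurve_flowMap [T2Space M] {S : Type*} [TopologicalSpace S] {ι : S → M}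
    {A₂ : Set M} {V : ∀ p : M, TangentSpace (𝓡∂ (n + 1)) p} {F : Type} [NormedAddCommGroup F]
    [NormedSpace ℝ F]
    (h : IsCrossingField F V (range ι) A₂) (hd : Disjoint (range ι) A₂)
    (hV : ∀ p, g.IsTimelike (V p)) (x : S) :
    g.IsTimelikeCurve (fun t => h.flowMap (x, projIcc (0 : ℝ) 1 zero_le_one t)) 0 1 := by
  obtain ⟨γ, hγ, hγs, hγe⟩ := h.exists_isMIntegralCurveOn_flowMap x
  have hγt : g.IsTimelikeCurve γ 0 1 := by
    refine ⟨one_pos, hγs, fun t ht => ?_⟩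
    rw [velocity_of_isMIntegralCurveOn one_pos ht hγ]
    have hl := h.length_pos hd x
    change g.val (γ t) (h.length x • V (γ t)) (h.length x • V (γ t)) < 0
    rw [map_smul, map_smul, smul_apply, smul_eq_mul, smul_eq_mul, ← mul_assoc]
    exact mul_neg_of_pos_of_neg (mul_pos hl hl) (hV _)
  refine isTimelikeCurve_of_eventuallyEq one_pos fun t ht =>
    ⟨γ, ?_, 0, 1, self_mem_nhdsWithin, ht, hγt⟩
  filter_upwards [self_mem_nhdsWithin] with s hs
  rw [hγe, projIcc_of_mem _ hs]

end Cobordism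

end

end LorentzianCobordism

theorem mainTheorem5 (n : ℕ) (hn : 1 ≤ n)
    (S₁ : Type*) [TopologicalSpace S₁] [T2Space S₁] [SecondCountableTopology S₁]
    [ChartedSpace (EuclideanSpace ℝ (Fin n)) S₁] [IsManifold (𝓡 n) ∞ S₁]
    (S₂ : Type*) [TopologicalSpace S₂] [T2Space S₂] [SecondCountableTopology S₂]
    [ChartedSpace (EuclideanSpace ℝ (Fin n)) S₂] [IsManifold (𝓡 n) ∞ S₂]
    (M : Type*) [TopologicalSpace M] [T2Space M] [SecondCountableTopology M] [ConnectedSpace M]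
    [ChartedSpace (EuclideanHalfSpace (n + 1)) M] [IsManifold (𝓡∂ (n + 1)) ∞ M]
    (g : LorentzianCobordism.LorentzianMetric n M)
    (T : LorentzianCobordism.TimeOrientation g)
    (ι₁ : S₁ → M) (ι₂ : S₂ → M)
    (hcob : LorentzianCobordism.IsWeakLorentzianPseudocobordism g ι₁ ι₂)
    (hcompact : T.IsCausallyCompact)
    (hchron : g.IsChronological) :
    (∃ φ : Diffeomorph ((𝓡 n).prod (𝓡∂ 1)) (𝓡∂ (n + 1)) (S₁ × Icc (0 : ℝ) 1) M ∞,
      ∀ x : S₁, g.IsTimelikeCurve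
        (fun t : ℝ => φ (x, projIcc (0 : ℝ) 1 zero_le_one t)) 0 1) ∧
    Nonempty (Diffeomorph ((𝓡 n).prod (𝓡∂ 1)) (𝓡∂ (n + 1)) (S₁ × Icc (0 : ℝ) 1) M ∞) ∧
    Nonempty (Diffeomorph (𝓡 n) (𝓡 n) S₁ S₂ ∞) := by
  obtain ⟨V, hVs, hV, h₁, h₂⟩ := hcob.exists_field
  have h := LorentzianCobordism.isCrossingField hVs hV hcob.range_union_range
    (forall_mem_range.2 h₁) (forall_mem_range.2 h₂) hcompact hchron
  let φ := h.flowDiffeomorph hcob.isSmoothEmbedding₁ hcob.disjoint_range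
  exact ⟨⟨φ, g.isTimelikeCurve_flowMap h hcob.disjoint_range hV⟩, ⟨φ⟩,
    ⟨h.endDiffeomorph hcob.isSmoothEmbedding₁ hcob.isSmoothEmbedding₂⟩⟩
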